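/- **Setting.** Let $d\ge 2$, $0\le k\le d$, $u\ge 0$. A vector $x\in\mathbb{R}_{\ge 0}^d$ is $k$-sparse if it has at most $k$ non-zero entries. A randomized algorithm $M$ on $k$-sparse vectors is $\varepsilon$-differentially private if $\Pr[M(x)\in S]\le e^{\varepsilon}\Pr[M(x')\in S]$ for all measurable $S$ and all $k$-sparse $x,x'\in\mathbb{R}_{\ge0}^d$ with $\|x-x'\|_1\le 1$. Let $\alpha,\varepsilon_1,\varepsilon_2>0$, $\varepsilon=\varepsilon_1+\varepsilon_2$, $s\in\mathbb{N}$, $t=\ln(d/2)/\varepsilon_1$, $m=\lceil t\varepsilon_2/\alpha\rceil$. Let $\mathcal{H}$ be a finite universal family of hash functions from $[d]$ to $[s]$, given by seeds: any two distinct keys collide with probability at most $1/s$ for a uniform seed. **Threshold ALP mechanism.** On input $x$: 1. Let $v_i=x_i+\eta_i$ for all $i\in[d]$ with independent Laplace noise $\eta_i$ of density $\frac{\varepsilon_1}{2}e^{-|\tau|\varepsilon_1}$; let $\tilde v_i=v_i$ if $v_i\ge t$, and $\tilde v_i=0$ otherwise. 2. Independently of step 1, draw $h_1,\dots,h_m$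 independently and uniformly from $\mathcal{H}$, and round each $x_i\varepsilon_2/\alpha$ randomly to an integer $y_i$ ($r$ becomes $\lceil r\rceil$ with probability $r-\lfloor r\rfloor$, and $\lfloor r\rfloor$ otherwise). For $a\in[s]$, $b\in[m]$ let $z_{a,b}=1$ if $h_b(i)=a$ for some $i$ with $b\le y_i$, and $z_{a,b}=0$ otherwise. Obtain $\tilde z$ from $z$ by flipping every bit independently with probability $\frac1{\alpha+2}$. 3. Release $\tilde v$, $h=(h_1,\dots,h_m)$ (the seeds) and $\tilde z$. The estimate $\tilde x_i$ of $x_i$ is $\tilde v_i$ if $\tilde v_i\ne 0$, and otherwise $\alpha/\varepsilon_2$ times the average of the maximizers $n\in\{0,\dots,m\}$ of $\sum_{b=1}^n(2\tilde z_{h_b(i),b}-1)$; it is clamped to $[0,u]$. **Theorem.** Fix constants $0<\alpha_0\le\alpha_1$, $2<\rho_0\le\rho_1$, $\kappa>0$, $\lambda\ge1$ and $a\in\mathbb{R}$. There are constants $C$ and $W\ge 1$, a function $c\mapsto D_c$ and a single word RAM program, depending only on these constants, such that the following holds whenever $\alpha_0\le\alpha\le\alpha_1$, $\rho_0k\le s\le\rho_1k$,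 $k\ge\kappa\ln d$ and $\lambda^{-1}\le\varepsilon_1/\varepsilon_2\le\lambda$. *(i)* For every such family $\mathcal{H}$, the Threshold ALP mechanism is $\varepsilon$-differentially private, and for every $k$-sparse $x\in[0,u]^d$ it satisfies $\mathbb{E}|x_i-\tilde x_i|\le C/\varepsilon$ for all $i\in[d]$ and $\mathbb{E}\max_i|x_i-\tilde x_i|\le C\ln(d)/\varepsilon$. *(ii)* Suppose in addition that $\varepsilon\le(d+u)^a$. Then for some such family $\mathcal{H}$ the output $(\tilde v,h,\tilde z)$ can be encoded as a sequence of words of $w=W\lceil\log_2(d+\lceil u\rceil)\rceil$ bits so that: - the encoded mechanism is $\varepsilon$-differentially private; - on every encoded output and for every $i\in[d]$, the program, given $i$, returns within $C\ln d$ steps a fixed-point number $\hat x_i$ with $|\hat x_i-\tilde x_i|\le(d+u)^{-a}$; - for every $k$-sparse $x\in[0,u]^d$, $\mathbb{E}|x_i-\hat x_i|\le C/\varepsilon$ for all $i\in[d]$ and $\mathbb{E}\max_i|x_i-\hat x_i|\le C\ln(d)/\varepsilon$; - for every $k$-sparse $x\in[0,u]^d$ and every $c>0$, with probability at least $1-d^{-c}$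 the encoding has at most $D_c\,k\ln(d+u)$ bits. Here a word RAM program works with registers holding $w$-bit words and with read access to the memory holding the encoding; every arithmetic, bitwise, shift or comparison instruction, memory access and test of a register takes one step. -/

import Mathlib

open MeasureTheory

noncomputable section

/-! ### Sparse vectors and differential privacy -/

/-- `x` has at most `k` non-zero entries. -/
def IsSparse {d : ℕ} (k : ℕ) (x : Fin d → ℝ) : Prop :=
  (Finset.univ.filter fun i => x i ≠ 0).card ≤ k

/-- Pure `ε`-differential privacy of a randomized algorithm on `k`-sparse non-negative vectors.
`M x` is the law of the output on input `x`; neighbours have `ℓ₁`-distance at most `1`. -/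
def IsDP {d : ℕ} (k : ℕ) (ε : ℝ) {R : Type*} [MeasurableSpace R]
    (M : (Fin d → ℝ) → Measure R) : Prop :=
  ∀ x x' : Fin d → ℝ, (∀ i, 0 ≤ x i) → (∀ i, 0 ≤ x' i) → IsSparse k x → IsSparse k x' →
    ∑ i, |x i - x' i| ≤ 1 →
    ∀ S : Set R, MeasurableSet S → M x S ≤ ENNReal.ofReal (Real.exp ε) * M x' S

/-! ### Sources of randomness -/

/-- The Laplace distribution centred at `0` with scale `1/ε`. -/
def laplace (ε : ℝ) : Measure ℝ :=
  volume.withDensity fun τ => ENNReal.ofReal (ε / 2 * Real.exp (-|τ| * ε))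

/-- A coin that shows `true` with probability `p`, for `0 ≤ p ≤ 1`. -/
def coin (p : ℝ) : Measure Bool :=
  ENNReal.ofReal p • Measure.dirac true + ENNReal.ofReal (1 - p) • Measure.dirac false

/-- Random rounding: `⌈r⌉` with probability `r - ⌊r⌋`, and `⌊r⌋` otherwise. -/
def randRound (r : ℝ) : Measure ℤ :=
  (coin (Int.fract r)).map fun b => if b then ⌈r⌉ else ⌊r⌋

/-- A finite family of hash functions from `[d]` to `[s]`, indexed by seeds. Choosing a hash
function at random means choosing a seed uniformly; storing it means storing the seed. -/
structure HashFamily (d s : ℕ) where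
  Seed : Type
  [fintypeSeed : Fintype Seed]
  [nonemptySeed : Nonempty Seed]
  eval : Seed → Fin d → Fin s

attribute [instance] HashFamily.fintypeSeed HashFamily.nonemptySeed

instance HashFamily.measurableSpaceSeed {d s : ℕ} (H : HashFamily d s) :
    MeasurableSpace H.Seed := ⊤

/-- Any two different keys collide with probability at most `1/s`. -/
def HashFamily.Universal {d s : ℕ} (H : HashFamily d s) : Prop :=
  ∀ i j : Fin d, i ≠ j →
    s * (Finset.univ.filter fun σ : H.Seed => H.eval σ i = H.eval σ j).card
      ≤ Fintype.card H.Seed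

/-! ### The ALP mechanism -/

/-- Number `m = ⌈β/α⌉` of hash functions, i.e. of columns of the embedding. -/
abbrev levels (α β : ℝ) : ℕ := ⌈β / α⌉₊

/-- The released pair of hash functions (as seeds) and noisy bit array. -/
abbrev Embedding {d s : ℕ} (H : HashFamily d s) (m : ℕ) : Type :=
  (Fin m → H.Seed) × (Fin s → Fin m → Bool)

/-- The unary encodings of `y`, hashed into an `s × m` bit array. The columns `1, …, m` are
indexed here by `0, …, m - 1`. -/
def hashUnary {d s m : ℕ} (H : HashFamily d s) (σ : Fin m → H.Seed) (y : Fin d → ℤ)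
    (a : Fin s) (b : Fin m) : Bool :=
  open Classical in decide (∃ i, (b : ℤ) + 1 ≤ y i ∧ H.eval (σ b) i = a)

/-- ALP1-projection: scaling by `1/α` with random rounding, hashing of the unary encodings
with independent hash functions, and randomized response (a bit is flipped with probability
`1/(α+2)`) on every bit of the array. -/
def alp1 {d s : ℕ} (H : HashFamily d s) (α β : ℝ) (x : Fin d → ℝ) :
    Measure (Embedding H (levels α β)) :=
  ((Measure.pi fun i : Fin d => randRound (x i / α)).prod
    ((Measure.pi fun _ : Fin (levels α β) => (PMF.uniformOfFintype H.Seed).toMeasure).prod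
      (Measure.pi fun _ : Fin s => Measure.pi fun _ : Fin (levels α β) =>
        coin (1 / (α + 2))))).map
    fun ω => (ω.2.1, fun a b => xor (hashUnary H ω.2.1 ω.1 a b) (ω.2.2 a b))

/-- ALP-projection with privacy parameter `ε`. -/
def alp {d s : ℕ} (H : HashFamily d s) (α β ε : ℝ) (x : Fin d → ℝ) :
    Measure (Embedding H (levels α (β * ε))) :=
  alp1 H α (β * ε) fun i => x i * ε

/-- Difference between the numbers of ones and of zeros among the first `n` bits of entry `i`. -/
def partialSum {d s m : ℕ} (H : HashFamily d s) (e : Embedding H m) (i : Fin d) (n : ℕ) : ℤ :=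
  ∑ a ∈ Finset.univ.filter (fun a : Fin m => (a : ℕ) < n),
    if e.2 (H.eval (e.1 a) i) a then (1 : ℤ) else -1

/-- The elements of `{0, …, m}` that maximize the partial sum. -/
def maximizers {d s m : ℕ} (H : HashFamily d s) (e : Embedding H m) (i : Fin d) : Finset ℕ :=
  open Classical in (Finset.range (m + 1)).filter fun n =>
    ∀ a ∈ Finset.range (m + 1), partialSum H e i a ≤ partialSum H e i n

/-- ALP1-estimator: the average of the maximizers, multiplied by `α`. -/
def alp1Estimate {d s m : ℕ} (H : HashFamily d s) (α : ℝ) (e : Embedding H m) (i : Fin d) : ℝ :=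
  (∑ n ∈ maximizers H e i, (n : ℝ)) / ((maximizers H e i).card : ℝ) * α

/-- ALP-estimator. -/
def alpEstimate {d s m : ℕ} (H : HashFamily d s) (α ε : ℝ) (e : Embedding H m) (i : Fin d) : ℝ :=
  alp1Estimate H α e i / ε

/-! ### The Threshold ALP mechanism -/

/-- Laplace noise on every entry, followed by the removal of the entries below `t`. -/
def threshold {d : ℕ} (ε t : ℝ) (x : Fin d → ℝ) : Measure (Fin d → ℝ) :=
  (Measure.pi fun _ : Fin d => laplace ε).map
    fun η i => if t ≤ x i + η i then x i + η i else 0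

/-- The threshold `t = ln(d/2)/ε₁`. -/
def thr (d : ℕ) (ε₁ : ℝ) : ℝ := Real.log ((d : ℝ) / 2) / ε₁

/-- Output of Threshold ALP-projection: the thresholded vector, the hash functions and the
bit array; the latter two use `β = t`. -/
abbrev Output {d s : ℕ} (H : HashFamily d s) (α ε₁ ε₂ : ℝ) : Type :=
  (Fin d → ℝ) × Embedding H (levels α (thr d ε₁ * ε₂))

/-- Threshold ALP-projection; its two parts are independent. -/
def thresholdALP {d s : ℕ} (H : HashFamily d s) (α ε₁ ε₂ : ℝ) (x : Fin d → ℝ) :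
    Measure (Output H α ε₁ ε₂) :=
  (threshold ε₁ (thr d ε₁) x).prod (alp H α (thr d ε₁) ε₂ x)

/-- Threshold ALP-estimator, with the output clamped to `[0, u]`. -/
def estimate {d s : ℕ} (H : HashFamily d s) (α ε₁ ε₂ u : ℝ) (o : Output H α ε₁ ε₂)
    (i : Fin d) : ℝ :=
  max 0 (min u (if o.1 i ≠ 0 then o.1 i else alpEstimate H α ε₂ o.2 i))

/-! ### The word RAM

Programs work on `w`-bit words, held in registers, and read a memory of `w`-bit words. Every
instruction and every test of a register takes one step. A query does not write to memory. -/

inductive BinOp where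
  | add | sub | mul | div | mod | and | or | xor | shl | shr | lt | eq

/-- Unsigned arithmetic modulo `2 ^ w`; comparisons return `1` or `0`. -/
def BinOp.eval {w : ℕ} : BinOp → BitVec w → BitVec w → BitVec w
  | .add, a, b => a + b
  | .sub, a, b => a - b
  | .mul, a, b => a * b
  | .div, a, b => a / b
  | .mod, a, b => a % b
  | .and, a, b => a &&& b
  | .or, a, b => a ||| b
  | .xor, a, b => a ^^^ b
  | .shl, a, b => a <<< b.toNat
  | .shr, a, b => a >>> b.toNat
  | .lt, a, b => if a.toNat < b.toNat then 1#w else 0#w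
  | .eq, a, b => if a = b then 1#w else 0#w

/-- Programs. The arguments of type `ℕ` are register numbers, except the constant `n`. -/
inductive Prog where
  | skip
  | const (r n : ℕ)
  | op (o : BinOp) (r a b : ℕ)
  | load (r a : ℕ)
  | seq (p q : Prog)
  | ite (r : ℕ) (p q : Prog)
  | loop (r : ℕ) (p : Prog)

/-- A memory content, i.e. what is stored at the addresses `0, 1, 2, …`. -/
structure Memory (w : ℕ) where
  words : List (BitVec w)

instance (w : ℕ) : MeasurableSpace (Memory w) := ⊤

/-- The number of bits of a memory content. -/
def Memory.bits {w : ℕ} (M : Memory w) : ℕ := w * M.words.length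

/-- `Exec M p R R' t`: on memory `M` and registers `R`, the program `p` halts after `t` steps
with registers `R'`. -/
inductive Exec {w : ℕ} (M : Memory w) :
    Prog → (ℕ → BitVec w) → (ℕ → BitVec w) → ℕ → Prop where
  | skip (R) : Exec M .skip R R 1
  | const (r n R) : Exec M (.const r n) R (Function.update R r (BitVec.ofNat w n)) 1
  | op (o r a b R) : Exec M (.op o r a b) R (Function.update R r (o.eval (R a) (R b))) 1
  | load (r a R) :
      Exec M (.load r a) R (Function.update R r (M.words.getD (R a).toNat 0#w)) 1
  | seq {p q R R' R'' t t'} : Exec M p R R' t → Exec M q R' R'' t' →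
      Exec M (.seq p q) R R'' (t + t')
  | ite_true {r p q R R' t} : R r ≠ 0#w → Exec M p R R' t → Exec M (.ite r p q) R R' (t + 1)
  | ite_false {r p q R R' t} : R r = 0#w → Exec M q R R' t → Exec M (.ite r p q) R R' (t + 1)
  | loop_true {r p R R' R'' t t'} : R r ≠ 0#w → Exec M p R R' t →
      Exec M (.loop r p) R' R'' t' → Exec M (.loop r p) R R'' (t + t' + 1)
  | loop_false {r p R} : R r = 0#w → Exec M (.loop r p) R R 1

/-- Started with the index `i` in register `0` and all other registers zero, the program halts
within `T` steps and returns `v`, as a fixed-point number with its integer part in register `0`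
and `w` fractional bits in register `1`. -/
def Answers {w : ℕ} (p : Prog) (M : Memory w) (i : ℕ) (T v : ℝ) : Prop :=
  ∃ (R : ℕ → BitVec w) (t : ℕ),
    Exec M p (fun r => if r = 0 then BitVec.ofNat w i else 0#w) R t ∧ (t : ℝ) ≤ T ∧
    v = ((R 0).toNat : ℝ) + ((R 1).toNat : ℝ) / 2 ^ w

/-- A word size in `Θ(log(d + u))`. -/
def wordSize (W d : ℕ) (u : ℝ) : ℕ := W * Nat.clog 2 (d + ⌈u⌉₊)

end

/-! Privacy. Both released parts are laws in which a change of the input can be followed one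
coordinate at a time (`lintegral_pi_le_prod_mul`). Shifting Laplace noise by `δ` costs a factor `exp
(ε₁ |δ|)`, and thresholding is post-processing (`lintegral_threshold_le`). For the bit array, fix
the seeds: raising one rounded entry by one changes at most one bit before the noise, and randomized
response with flip probability `1/(α+2)` hides one bit up to a factor `1+α`. Random rounding
interpolates linearly between consecutive integers. A positive function whose consecutive values
differ by a factor of at most `1+α` has an interpolation whose logarithm is `α`-Lipschitz
(`interpolate_le`). Since entries are multiplied by `ε₂/α` before rounding, the cost is exactly `exp
(ε₂ |δ|)`.

Accuracy. The bits read for key `i` form a random walk. Let `Y` be the rounded entry clipped to `[0,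
m]`. Below `Y` every bit is `1` up to noise; above it a bit is `1` only by noise or by a collision,
which universality makes no likelier than `k/s ≤ 1/ρ₀ < 1/2`. So the walk drifts towards `Y` from
both sides. A maximizer `n` has a partial sum at least that at `Y`, hence `exp (θ|n-Y|)` is at most
the sum over all `n` of `exp (θ|n-Y|) exp (ν(S n - S Y))`. The expectation factorizes over the
independent columns and is dominated by a geometric series (`lintegral_exp_average_le`). Thus the
error in units of `α/ε₂` has bounded exponential moments, which give both the expected error and,
through `y ≤ log n + exp y / n`, the expected maximum. If the noisy entry is not released,
truncation at the threshold costs at most the absolute Laplace noise (`abs_sub_estimate_le`).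

Space. The threshold is chosen so that noise alone exceeds it with probability `1/d`; the number of
such exceedances has exponential moment at most `exp 2`, and Chernoff's bound applies
(`thresholdALP_supportCard_le`).

Implementation. The family is `i ↦ ((a i + b) mod p) mod s` with a prime `d < p ≤ 2d`. The memory
holds a header, one word per row of the array (a row has `m = O(log d)` bits), two words per seed,
and the released pairs sorted by key. A query makes one pass over the `m` columns, maintaining the
maximum of the walk and the sum and number of its maximizers, and then one binary search. The
program is verified by symbolic execution (`Stored.answers`). The encoding is a measurable function
of the output, so privacy is inherited, and the fixed-point error is below `(d+u)^(-a) ≤ 1/ε`. -/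

open scoped ENNReal

/-! ### Product measures, one coordinate at a time -/

section ProductMeasures

variable {ι : Type*} {X : ι → Type*} [∀ i, MeasurableSpace (X i)] [DecidableEq ι]

theorem lmarginal_congr_measure {μ ν : ∀ i, Measure (X i)} {s : Finset ι}
    (h : ∀ i ∈ s, μ i = ν i) (f : (∀ i, X i) → ℝ≥0∞) :
    lmarginal μ s f = lmarginal ν s f := by
  have : (fun i : s => μ i) = fun i : s => ν i := funext fun i => h i i.2
  funext x
  simp only [lmarginal, this]

/-- A hybrid argument: the coordinates in `s` are switched from `μ` to `ν` one after the other. Each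
switch moves the integral over the coordinate to the innermost place by Tonelli, where the
hypothesis applies. -/
theorem lmarginal_le_prod_mul_lmarginal {μ ν : ∀ i, Measure (X i)} [∀ i, SigmaFinite (μ i)]
    [∀ i, SigmaFinite (ν i)] {f : (∀ i, X i) → ℝ≥0∞} (hf : Measurable f) (c : ι → ℝ≥0∞)
    (h : ∀ i x, ∫⁻ y, f (Function.update x i y) ∂μ i
      ≤ c i * ∫⁻ y, f (Function.update x i y) ∂ν i) (s : Finset ι) (x : ∀ i, X i) :
    lmarginal μ s f x ≤ (∏ i ∈ s, c i) * lmarginal ν s f x := by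
  induction s using Finset.induction generalizing x with
  | empty => simp
  | insert i s hi ih =>
    -- The hybrid family has `μ` at `i` and `ν` elsewhere; both orders of integration of its
    -- marginal are used below.
    let ξ : ∀ i, Measure (X i) := Function.update ν i (μ i)
    have hξi : ξ i = μ i := by simp [ξ]
    have hξ : ∀ j ∈ s, ξ j = ν j := fun j hj => by
      have : j ≠ i := fun h => hi (h ▸ hj)
      simp [ξ, this]
    have : ∀ j, SigmaFinite (ξ j) := fun j => by
      by_cases hj : j = i
      · subst hj; rw [hξi]; infer_instance
      · simp only [ξ, Function.update_of_ne hj]; infer_instance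
    have hm : ∀ (κ : Measure (X i)) [SigmaFinite κ],
        Measurable fun x : ∀ i, X i => ∫⁻ y, f (Function.update x i y) ∂κ := fun κ _ => by
      refine Measurable.lintegral_prod_right' (f := fun p : (∀ i, X i) × X i =>
        f (Function.update p.1 i p.2)) (hf.comp ?_)
      exact measurable_update'
    calc lmarginal μ (insert i s) f x
        = ∫⁻ y, lmarginal μ s f (Function.update x i y) ∂μ i := lmarginal_insert f hf hi x
      _ ≤ ∫⁻ y, (∏ i ∈ s, c i) * lmarginal ν s f (Function.update x i y) ∂μ i :=
          lintegral_mono fun y => ih _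
      _ = (∏ i ∈ s, c i) * ∫⁻ y, lmarginal ν s f (Function.update x i y) ∂μ i := by
          rw [lintegral_const_mul]
          exact (hf.lmarginal ν).comp (measurable_update x)
      _ = (∏ i ∈ s, c i) * lmarginal ξ (insert i s) f x := by
          rw [lmarginal_insert f hf hi x, hξi, lmarginal_congr_measure hξ]
      _ = (∏ i ∈ s, c i) * lmarginal ν s (fun x => ∫⁻ y, f (Function.update x i y) ∂μ i) x := by
          rw [lmarginal_insert' f hf hi, hξi, lmarginal_congr_measure hξ]
      _ ≤ (∏ i ∈ s, c i) *
            lmarginal ν s (fun x => c i * ∫⁻ y, f (Function.update x i y) ∂ν i) x := by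
          gcongr
          exact lmarginal_mono (fun x => h i x) x
      _ = (∏ i ∈ s, c i) * (c i * lmarginal ν (insert i s) f x) := by
          rw [lmarginal_insert' f hf hi]
          simp only [lmarginal]
          rw [lintegral_const_mul]
          exact (hm (ν i)).comp measurable_updateFinset
      _ = _ := by rw [Finset.prod_insert hi]; ring

/-- Two product measures can be compared by comparing one factor at a time. -/
theorem lintegral_pi_le_prod_mul [Fintype ι] {μ ν : ∀ i, Measure (X i)} [∀ i, SigmaFinite (μ i)]
    [∀ i, SigmaFinite (ν i)] {f : (∀ i, X i) → ℝ≥0∞} (hf : Measurable f) (c : ι → ℝ≥0∞)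
    (h : ∀ i x, ∫⁻ y, f (Function.update x i y) ∂μ i
      ≤ c i * ∫⁻ y, f (Function.update x i y) ∂ν i) :
    ∫⁻ x, f x ∂Measure.pi μ ≤ (∏ i, c i) * ∫⁻ x, f x ∂Measure.pi ν := by
  rcases isEmpty_or_nonempty (∀ i, X i) with h' | ⟨⟨x⟩⟩
  · simp
  · rw [lintegral_eq_lmarginal_univ x, lintegral_eq_lmarginal_univ x]
    exact lmarginal_le_prod_mul_lmarginal hf c h _ _

/-- The integral of a product of functions of single coordinates. -/
theorem lintegral_pi_prod [Fintype ι] {μ : ∀ i, Measure (X i)} [∀ i, SigmaFinite (μ i)]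
    {f : ∀ i, X i → ℝ≥0∞} (hf : ∀ i, Measurable (f i)) :
    ∫⁻ x, ∏ i, f i (x i) ∂Measure.pi μ = ∏ i, ∫⁻ y, f i y ∂μ i := by
  have key : ∀ s : Finset ι, ∀ x, lmarginal μ s (fun x => ∏ i ∈ s, f i (x i)) x
      = ∏ i ∈ s, ∫⁻ y, f i y ∂μ i := by
    intro s
    induction s using Finset.induction with
    | empty => simp
    | insert i s hi ih =>
      intro x
      have hm : ∀ s : Finset ι, Measurable fun x : ∀ i, X i => ∏ i ∈ s, f i (x i) := fun s =>
        Finset.measurable_fun_prod _ fun i _ => (hf i).comp (measurable_pi_apply i)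
      rw [lmarginal_insert' _ (hm _) hi]
      have : (fun x : ∀ i, X i => ∫⁻ y, ∏ j ∈ insert i s, f j (Function.update x i y j) ∂μ i)
          = fun x => (∫⁻ y, f i y ∂μ i) * ∏ j ∈ s, f j (x j) := by
        funext x
        rw [← lintegral_mul_const _ (hf i)]
        refine lintegral_congr fun y => ?_
        rw [Finset.prod_insert hi, Function.update_self]
        congr 1
        refine Finset.prod_congr rfl fun j hj => ?_
        rw [Function.update_of_ne]
        exact fun h => hi (h ▸ hj)
      rw [this, Finset.prod_insert hi, ← ih x]
      simp only [lmarginal]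
      rw [lintegral_const_mul]
      exact (hm s).comp measurable_updateFinset
  rcases isEmpty_or_nonempty (∀ i, X i) with h' | ⟨⟨x⟩⟩
  -- Without a base point for the marginals, some factor is empty and both sides vanish.
  · have : ∃ i, IsEmpty (X i) := by
      by_contra hc
      push Not at hc
      exact h'.elim (fun i => (hc i).some)
    obtain ⟨i, hi⟩ := this
    rw [lintegral_of_isEmpty, eq_comm, Finset.prod_eq_zero (Finset.mem_univ i)]
    exact lintegral_of_isEmpty _ _
  · rw [lintegral_eq_lmarginal_univ x]
    exact key _ _

end ProductMeasures

/-! ### The Laplace distribution -/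

theorem lintegral_exp_mul_Ioi {a : ℝ} (ha : a < 0) (c : ℝ) :
    ∫⁻ x in Set.Ioi c, ENNReal.ofReal (Real.exp (a * x)) = ENNReal.ofReal (-Real.exp (a * c) / a) := by
  rw [← ofReal_integral_eq_lintegral_ofReal (integrableOn_exp_mul_Ioi ha c)
    (Filter.Eventually.of_forall fun x => (Real.exp_pos _).le), integral_exp_mul_Ioi ha]

theorem lintegral_exp_mul_Iic {a : ℝ} (ha : 0 < a) (c : ℝ) :
    ∫⁻ x in Set.Iic c, ENNReal.ofReal (Real.exp (a * x)) = ENNReal.ofReal (Real.exp (a * c) / a) := by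
  rw [← ofReal_integral_eq_lintegral_ofReal (integrableOn_exp_mul_Iic ha c)
    (Filter.Eventually.of_forall fun x => (Real.exp_pos _).le), integral_exp_mul_Iic ha]

theorem lintegral_exp_neg_abs {b : ℝ} (hb : 0 < b) :
    ∫⁻ x : ℝ, ENNReal.ofReal (Real.exp (-|x| * b)) = ENNReal.ofReal (2 / b) := by
  rw [← lintegral_add_compl _ (measurableSet_Iic (a := (0 : ℝ))), Set.compl_Iic]
  have h1 : ∫⁻ x in Set.Iic (0 : ℝ), ENNReal.ofReal (Real.exp (-|x| * b))
      = ∫⁻ x in Set.Iic (0 : ℝ), ENNReal.ofReal (Real.exp (b * x)) := by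
    refine setLIntegral_congr_fun measurableSet_Iic fun x hx => ?_
    simp only [abs_of_nonpos (Set.mem_Iic.1 hx)]
    congr 2; ring
  have h2 : ∫⁻ x in Set.Ioi (0 : ℝ), ENNReal.ofReal (Real.exp (-|x| * b))
      = ∫⁻ x in Set.Ioi (0 : ℝ), ENNReal.ofReal (Real.exp (-b * x)) := by
    refine setLIntegral_congr_fun measurableSet_Ioi fun x hx => ?_
    simp only [abs_of_pos (Set.mem_Ioi.1 hx)]
    congr 2; ring
  rw [h1, h2, lintegral_exp_mul_Iic hb, lintegral_exp_mul_Ioi (by linarith),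
    ← ENNReal.ofReal_add (by positivity)]
  · congr 1; simp; field_simp; norm_num
  · simp; positivity

theorem measurable_laplace_density (ε : ℝ) :
    Measurable fun τ : ℝ => ENNReal.ofReal (ε / 2 * Real.exp (-|τ| * ε)) := by fun_prop

theorem lintegral_laplace {ε : ℝ} {f : ℝ → ℝ≥0∞} (hf : Measurable f) :
    ∫⁻ τ, f τ ∂laplace ε = ∫⁻ τ, ENNReal.ofReal (ε / 2 * Real.exp (-|τ| * ε)) * f τ := by
  rw [laplace, lintegral_withDensity_eq_lintegral_mul _ (measurable_laplace_density ε) hf]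
  rfl

/-- Exponential moments of the absolute value of a Laplace variable. -/
theorem lintegral_exp_abs_laplace {ε θ : ℝ} (hε : 0 < ε) (hθ : θ < ε) :
    ∫⁻ τ, ENNReal.ofReal (Real.exp (θ * |τ|)) ∂laplace ε = ENNReal.ofReal (ε / (ε - θ)) := by
  rw [lintegral_laplace (by fun_prop)]
  have h : ∀ τ : ℝ, ENNReal.ofReal (ε / 2 * Real.exp (-|τ| * ε)) *
      ENNReal.ofReal (Real.exp (θ * |τ|))
      = ENNReal.ofReal (ε / 2) * ENNReal.ofReal (Real.exp (-|τ| * (ε - θ))) := fun τ => by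
    rw [← ENNReal.ofReal_mul (by positivity), ← ENNReal.ofReal_mul (by positivity), mul_assoc,
      ← Real.exp_add]
    congr 3; ring_nf
  simp_rw [h]
  rw [lintegral_const_mul _ (by fun_prop), lintegral_exp_neg_abs (by linarith),
    ← ENNReal.ofReal_mul (by positivity)]
  congr 1
  field_simp

theorem isProbabilityMeasure_laplace {ε : ℝ} (hε : 0 < ε) : IsProbabilityMeasure (laplace ε) := by
  constructor
  have := lintegral_exp_abs_laplace hε hε
  simpa [hε.ne'] using this

/-- The upper tail of a Laplace variable. -/
theorem laplace_Ici {ε t : ℝ} (hε : 0 < ε) (ht : 0 ≤ t) :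
    laplace ε (Set.Ici t) = ENNReal.ofReal (Real.exp (-(ε * t)) / 2) := by
  rw [laplace, withDensity_apply _ measurableSet_Ici, setLIntegral_congr Ioi_ae_eq_Ici.symm]
  have h : ∫⁻ x in Set.Ioi t, ENNReal.ofReal (ε / 2 * Real.exp (-|x| * ε))
      = ∫⁻ x in Set.Ioi t, ENNReal.ofReal (ε / 2) * ENNReal.ofReal (Real.exp (-ε * x)) := by
    refine setLIntegral_congr_fun measurableSet_Ioi fun x hx => ?_
    simp only [abs_of_pos (lt_of_le_of_lt ht (Set.mem_Ioi.1 hx))]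
    rw [← ENNReal.ofReal_mul (by positivity)]
    congr 3; ring
  rw [h, lintegral_const_mul _ (by fun_prop), lintegral_exp_mul_Ioi (by linarith),
    ← ENNReal.ofReal_mul (by positivity)]
  congr 1
  rw [neg_mul]
  field_simp

/-- Shifting Laplace noise by `δ` changes densities by a factor of at most `exp (ε |δ|)`. -/
theorem lintegral_laplace_add_le {ε : ℝ} (hε : 0 ≤ ε) (r r' : ℝ) {f : ℝ → ℝ≥0∞}
    (hf : Measurable f) :
    ∫⁻ τ, f (r + τ) ∂laplace ε
      ≤ ENNReal.ofReal (Real.exp (ε * |r - r'|)) * ∫⁻ τ, f (r' + τ) ∂laplace ε := by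
  -- Translation by `r - r'` gives `f` the same argument on both sides, so that only the densities
  -- remain to be compared.
  rw [lintegral_laplace (by fun_prop), lintegral_laplace (by fun_prop),
    ← lintegral_const_mul _ (by fun_prop),
    ← lintegral_sub_right_eq_self (μ := volume) (fun τ => ENNReal.ofReal (ε / 2 * Real.exp (-|τ| * ε))
      * f (r + τ)) (r - r')]
  refine lintegral_mono fun τ => ?_
  have : r + (τ - (r - r')) = r' + τ := by ring
  simp only [this]
  rw [← mul_assoc]
  gcongr
  rw [← ENNReal.ofReal_mul (by positivity)]
  refine ENNReal.ofReal_le_ofReal ?_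
  rw [mul_left_comm, ← Real.exp_add]
  gcongr
  have h1 : |τ| ≤ |τ - (r - r')| + |r - r'| := by
    have := abs_add_le (τ - (r - r')) (r - r'); simpa using this
  nlinarith

/-! ### The thresholded Laplace mechanism -/

theorem measurable_cut (t : ℝ) : Measurable fun r : ℝ => if t ≤ r then r else 0 :=
  Measurable.ite measurableSet_Ici measurable_id measurable_const

theorem isProbabilityMeasure_threshold {d : ℕ} {ε : ℝ} (hε : 0 < ε) (t : ℝ) (x : Fin d → ℝ) :
    IsProbabilityMeasure (threshold ε t x) := by
  have := isProbabilityMeasure_laplace hε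
  refine Measure.isProbabilityMeasure_map (Measurable.aemeasurable ?_)
  exact measurable_pi_lambda _ fun i =>
    (measurable_cut t).comp (measurable_const.add (measurable_pi_apply i))

/-- Thresholding acts on each coordinate separately, so the law is a product of image measures, and
the factor `exp (ε ∑ |x i - x' i|)` splits accordingly. -/
theorem lintegral_threshold_le {d : ℕ} {ε : ℝ} (hε : 0 < ε) (t : ℝ) (x x' : Fin d → ℝ)
    {f : (Fin d → ℝ) → ℝ≥0∞} (hf : Measurable f) :
    ∫⁻ v, f v ∂threshold ε t x
      ≤ ENNReal.ofReal (Real.exp (ε * ∑ i, |x i - x' i|)) * ∫⁻ v, f v ∂threshold ε t x' := by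
  have := isProbabilityMeasure_laplace hε
  have hm : ∀ r : ℝ, Measurable fun τ => if t ≤ r + τ then r + τ else 0 := fun r =>
    (measurable_cut t).comp (measurable_const_add r)
  have hs : ∀ r : ℝ, SigmaFinite ((laplace ε).map fun τ => if t ≤ r + τ then r + τ else 0) :=
    fun r => by
      have := Measure.isProbabilityMeasure_map (μ := laplace ε) (hm r).aemeasurable
      infer_instance
  have hpi : ∀ x : Fin d → ℝ, threshold ε t x = Measure.pi fun i =>
      (laplace ε).map fun τ => if t ≤ x i + τ then x i + τ else 0 := fun x => by
    rw [threshold, ← Measure.pi_map_pi fun i => (hm (x i)).aemeasurable]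
  rw [hpi, hpi, Finset.mul_sum, Real.exp_sum, ENNReal.ofReal_prod_of_nonneg
    fun i _ => (Real.exp_pos _).le]
  refine lintegral_pi_le_prod_mul hf _ fun i y => ?_
  have hu : Measurable fun r => f (Function.update y i r) := hf.comp (measurable_update y)
  rw [lintegral_map hu (hm _), lintegral_map hu (hm _)]
  exact lintegral_laplace_add_le hε.le (x i) (x' i) (hu.comp (measurable_cut t))

instance HashFamily.discreteMeasurableSpaceSeed {d s : ℕ} (H : HashFamily d s) :
    DiscreteMeasurableSpace H.Seed := ⟨fun _ => trivial⟩

/-! ### Coins and random rounding -/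

theorem lintegral_coin (p : ℝ) (g : Bool → ℝ≥0∞) :
    ∫⁻ b, g b ∂coin p = ENNReal.ofReal p * g true + ENNReal.ofReal (1 - p) * g false := by
  simp [coin, lintegral_add_measure, lintegral_smul_measure]

theorem isProbabilityMeasure_coin {p : ℝ} (h0 : 0 ≤ p) (h1 : p ≤ 1) :
    IsProbabilityMeasure (coin p) := by
  constructor
  have := lintegral_coin p (fun _ => 1)
  rw [lintegral_one] at this
  rw [this, mul_one, mul_one, ← ENNReal.ofReal_add h0 (by linarith)]
  simp

theorem lintegral_randRound (r : ℝ) (g : ℤ → ℝ≥0∞) :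
    ∫⁻ n, g n ∂randRound r
      = ENNReal.ofReal (Int.fract r) * g ⌈r⌉ + ENNReal.ofReal (1 - Int.fract r) * g ⌊r⌋ := by
  rw [randRound, lintegral_map (measurable_of_countable _) (measurable_of_countable _),
    lintegral_coin]
  simp

instance isProbabilityMeasure_coin_fract (r : ℝ) : IsProbabilityMeasure (coin (Int.fract r)) :=
  isProbabilityMeasure_coin (Int.fract_nonneg r) (Int.fract_lt_one r).le

instance isProbabilityMeasure_randRound (r : ℝ) : IsProbabilityMeasure (randRound r) :=
  Measure.isProbabilityMeasure_map (measurable_of_countable _).aemeasurable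

/-- The expectation of `g` after random rounding of `r`. -/
noncomputable def interpolate (g : ℤ → ℝ) (r : ℝ) : ℝ :=
  Int.fract r * g ⌈r⌉ + (1 - Int.fract r) * g ⌊r⌋

/-- Both endpoints of the cell are allowed, so that adjacent cells can be glued at integers. -/
theorem interpolate_eq (g : ℤ → ℝ) {r : ℝ} {n : ℤ} (h0 : n ≤ r) (h1 : r ≤ n + 1) :
    interpolate g r = (r - n) * g (n + 1) + (1 - (r - n)) * g n := by
  rcases h1.lt_or_eq with h1 | h1
  · have hf : ⌊r⌋ = n := Int.floor_eq_iff.2 ⟨h0, h1⟩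
    have hfr : Int.fract r = r - n := by rw [Int.fract, hf]
    rcases h0.lt_or_eq with h0 | h0
    · have hc : ⌈r⌉ = n + 1 := Int.ceil_eq_iff.2 ⟨by push_cast; linarith, by push_cast; linarith⟩
      rw [interpolate, hfr, hf, hc]
    · rw [interpolate, hfr, hf, ← h0]; simp
  · have h2 : r = ((n + 1 : ℤ) : ℝ) := by push_cast; exact h1
    rw [interpolate, h2, Int.fract_intCast, Int.floor_intCast]
    push_cast; ring

/-- With endpoint values `A` and `B`, the interpolation is affine with slope at most `α min A B` in
absolute value, hence at most `α` times its value at any point of the cell; then `1 + y ≤ exp y`. -/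
theorem interpolate_le_of_cell {g : ℤ → ℝ} {α : ℝ} (hg : ∀ n, 0 ≤ g n)
    (h1 : ∀ n, g (n + 1) ≤ (1 + α) * g n) (h2 : ∀ n, g n ≤ (1 + α) * g (n + 1)) (hα : 0 ≤ α)
    {r r' : ℝ} {n : ℤ} (hr : n ≤ r) (hr1 : r ≤ n + 1) (hr' : n ≤ r') (hr1' : r' ≤ n + 1) :
    interpolate g r ≤ Real.exp (α * |r - r'|) * interpolate g r' := by
  rw [interpolate_eq g hr hr1, interpolate_eq g hr' hr1']
  have e1 := Real.add_one_le_exp (α * |r - r'|)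
  have hA := hg n
  have hB := hg (n + 1)
  have h1 := h1 n
  have h2 := h2 n
  generalize g n = A at *
  generalize g (n + 1) = B at *
  have hmix : 0 ≤ (r' - n) * B + (1 - (r' - n)) * A :=
    add_nonneg (mul_nonneg (by linarith) hB) (mul_nonneg (by linarith) hA)
  refine le_trans ?_ (mul_le_mul_of_nonneg_right e1 hmix)
  have hmin : ∀ c, c ≤ A → c ≤ B → c ≤ (r' - n) * B + (1 - (r' - n)) * A := fun c hcA hcB => by
    nlinarith [mul_nonneg (sub_nonneg.2 hr') (sub_nonneg.2 hcB),
      mul_nonneg (sub_nonneg.2 hr1') (sub_nonneg.2 hcA)]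
  suffices h : (r - r') * (B - A) ≤ α * |r - r'| * ((r' - n) * B + (1 - (r' - n)) * A) by linarith
  have habs : (r - r') * (B - A) ≤ |r - r'| * |B - A| := by rw [← abs_mul]; exact le_abs_self _
  refine habs.trans ?_
  rw [mul_comm α, mul_assoc]
  refine mul_le_mul_of_nonneg_left ?_ (abs_nonneg _)
  rcases le_total A B with h | h
  · rw [abs_of_nonneg (by linarith)]
    have := mul_le_mul_of_nonneg_left (hmin A le_rfl h) hα
    linarith
  · rw [abs_of_nonpos (by linarith)]
    have := mul_le_mul_of_nonneg_left (hmin B h le_rfl) hα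
    linarith

/-- The bounds on single cells are multiplied along the cells between `r` and `r'`; distances add
up, so the exponentials multiply to the right factor. -/
theorem interpolate_le {g : ℤ → ℝ} {α : ℝ} (hg : ∀ n, 0 ≤ g n)
    (h1 : ∀ n, g (n + 1) ≤ (1 + α) * g n) (h2 : ∀ n, g n ≤ (1 + α) * g (n + 1)) (hα : 0 ≤ α)
    (r r' : ℝ) : interpolate g r ≤ Real.exp (α * |r - r'|) * interpolate g r' := by
  -- Induction on the number of cells, in both directions at once so that the order of `r` and `r'`
  -- no longer matters afterwards.
  have key : ∀ (N : ℕ) (r r' : ℝ), r ≤ r' → r' ≤ ⌊r⌋ + (N + 1) →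
      interpolate g r ≤ Real.exp (α * (r' - r)) * interpolate g r' ∧
      interpolate g r' ≤ Real.exp (α * (r' - r)) * interpolate g r := by
    intro N
    induction N with
    | zero =>
      intro r r' h h'
      simp only [Nat.cast_zero, zero_add] at h'
      have h0 := Int.floor_le r
      have ha := interpolate_le_of_cell hg h1 h2 hα h0 (by linarith) (by linarith : _ ≤ r') h'
      have hb := interpolate_le_of_cell hg h1 h2 hα (by linarith : _ ≤ r') h' h0 (by linarith)
      rw [abs_sub_comm, abs_of_nonneg (by linarith)] at ha
      rw [abs_of_nonneg (by linarith)] at hb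
      exact ⟨ha, hb⟩
    | succ N ih =>
      intro r r' h h'
      by_cases hc : r' ≤ ⌊r⌋ + (N + 1)
      · exact ih r r' h hc
      push Not at hc
      have hr : r ≤ ⌊r⌋ + (N + 1) := by
        have := Int.lt_floor_add_one r
        have : (0 : ℝ) ≤ N := N.cast_nonneg
        linarith
      obtain ⟨ia, ib⟩ := ih r (⌊r⌋ + (N + 1)) hr le_rfl
      push_cast at h'
      have c1 : (((⌊r⌋ + (N + 1) : ℤ)) : ℝ) = ⌊r⌋ + (N + 1) := by push_cast; ring
      have ha := interpolate_le_of_cell hg h1 h2 hα (n := ⌊r⌋ + (N + 1)) c1.le (by linarith)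
        (by linarith : _ ≤ r') (by linarith)
      have hb := interpolate_le_of_cell hg h1 h2 hα (n := ⌊r⌋ + (N + 1))
        (by linarith : _ ≤ r') (by linarith) c1.le (by linarith)
      rw [abs_sub_comm, abs_of_nonneg (by linarith)] at ha
      rw [abs_of_nonneg (by linarith)] at hb
      have e : Real.exp (α * (r' - r)) = Real.exp (α * (⌊r⌋ + (N + 1) - r))
          * Real.exp (α * (r' - (⌊r⌋ + (N + 1)))) := by
        rw [← Real.exp_add]; congr 1; ring
      rw [e]
      constructor
      · rw [mul_assoc]
        exact ia.trans (mul_le_mul_of_nonneg_left ha (Real.exp_pos _).le)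
      · rw [mul_comm (Real.exp _), mul_assoc]
        exact hb.trans (mul_le_mul_of_nonneg_left ib (Real.exp_pos _).le)
  have hN : ∀ r r' : ℝ, ∃ N : ℕ, r' ≤ ⌊r⌋ + (N + 1) := fun r r' => by
    obtain ⟨N, hN⟩ := exists_nat_ge (r' - ⌊r⌋)
    exact ⟨N, by linarith⟩
  rcases le_total r r' with h | h
  · obtain ⟨N, hN⟩ := hN r r'
    rw [abs_sub_comm, abs_of_nonneg (by linarith)]
    exact (key N r r' h hN).1
  · obtain ⟨N, hN⟩ := hN r' r
    rw [abs_of_nonneg (by linarith)]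
    exact (key N r' r h hN).2

/-- This is where rounding at random pays off: a jump factor `1 + α` per integer becomes a smooth
rate `α`, which the division of the entries by `α` turns into rate one. -/
theorem lintegral_randRound_le {g : ℤ → ℝ≥0∞} {α : ℝ} (hg : ∀ n, g n ≠ ∞)
    (h1 : ∀ n, g (n + 1) ≤ ENNReal.ofReal (1 + α) * g n)
    (h2 : ∀ n, g n ≤ ENNReal.ofReal (1 + α) * g (n + 1)) (hα : 0 ≤ α) (r r' : ℝ) :
    ∫⁻ n, g n ∂randRound r
      ≤ ENNReal.ofReal (Real.exp (α * |r - r'|)) * ∫⁻ n, g n ∂randRound r' := by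
  have hint : ∀ r, ∫⁻ n, g n ∂randRound r
      = ENNReal.ofReal (interpolate (fun n => (g n).toReal) r) := fun r => by
    have := Int.fract_nonneg r
    have := Int.fract_lt_one r
    rw [lintegral_randRound, interpolate, ENNReal.ofReal_add (by positivity)
      (mul_nonneg (by linarith) ENNReal.toReal_nonneg),
      ENNReal.ofReal_mul (by positivity), ENNReal.ofReal_mul (by linarith),
      ENNReal.ofReal_toReal (hg _), ENNReal.ofReal_toReal (hg _)]
  have htr : ∀ a b : ℝ≥0∞, b ≠ ∞ → a ≤ ENNReal.ofReal (1 + α) * b →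
      a.toReal ≤ (1 + α) * b.toReal := fun a b hb h => by
    have := ENNReal.toReal_mono (ENNReal.mul_ne_top ENNReal.ofReal_ne_top hb) h
    rwa [ENNReal.toReal_mul, ENNReal.toReal_ofReal (by linarith)] at this
  rw [hint, hint, ← ENNReal.ofReal_mul (Real.exp_pos _).le]
  exact ENNReal.ofReal_le_ofReal (interpolate_le (fun n => ENNReal.toReal_nonneg)
    (fun n => htr _ _ (hg _) (h1 n)) (fun n => htr _ _ (hg _) (h2 n)) hα r r')

/-! ### Randomized response -/

/-- The noise of randomized response on an `s × m` bit array. -/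
noncomputable def flips (α : ℝ) (s m : ℕ) : Measure (Fin s → Fin m → Bool) :=
  Measure.pi fun _ : Fin s => Measure.pi fun _ : Fin m => coin (1 / (α + 2))

theorem isProbabilityMeasure_flipCoin {α : ℝ} (hα : 0 ≤ α) :
    IsProbabilityMeasure (coin (1 / (α + 2))) :=
  isProbabilityMeasure_coin (by positivity) (by rw [div_le_one (by linarith)]; linarith)

theorem isProbabilityMeasure_flips {α : ℝ} (hα : 0 ≤ α) (s m : ℕ) :
    IsProbabilityMeasure (flips α s m) := by
  have := isProbabilityMeasure_flipCoin hα
  unfold flips; infer_instance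

/-- The two outcomes have probabilities `1/(α+2)` and `(1+α)/(α+2)`, whose ratio is `1 + α`. -/
theorem lintegral_flipCoin_le {α : ℝ} (hα : 0 ≤ α) (g : Bool → ℝ≥0∞) (z z' : Bool) :
    ∫⁻ b, g (xor z b) ∂coin (1 / (α + 2))
      ≤ (if z = z' then 1 else ENNReal.ofReal (1 + α)) * ∫⁻ b, g (xor z' b) ∂coin (1 / (α + 2)) := by
  split_ifs with h
  · rw [h, one_mul]
  have hz : z' = !z := by cases z <;> cases z' <;> simp_all
  subst hz
  rw [lintegral_coin, lintegral_coin, mul_add, ← mul_assoc, ← mul_assoc,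
    ← ENNReal.ofReal_mul (by linarith), ← ENNReal.ofReal_mul (by linarith), add_comm]
  have e1 : (1 + α) * (1 / (α + 2)) = 1 - 1 / (α + 2) := by field_simp; ring
  have e2 : 1 / (α + 2) ≤ 1 - 1 / (α + 2) := by rw [← e1]; nlinarith [show 0 < 1 / (α + 2) by positivity]
  have e3 : 1 / (α + 2) ≤ (1 + α) * (1 - 1 / (α + 2)) := by
    have : 0 < 1 / (α + 2) := by positivity
    nlinarith
  have x1 : ((!z) ^^ true) = (z ^^ false) := by cases z <;> rfl
  have x2 : ((!z) ^^ false) = (z ^^ true) := by cases z <;> rfl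
  rw [x1, x2]
  exact add_le_add (mul_le_mul' (ENNReal.ofReal_le_ofReal e1.ge) le_rfl)
    (mul_le_mul' (ENNReal.ofReal_le_ofReal e3) le_rfl)

/-- The noisy array is a product of independent noisy bits, so only positions where `z` and `z'`
differ are paid for. -/
theorem lintegral_flips_le {α : ℝ} (hα : 0 ≤ α) {s m : ℕ} (z z' : Fin s → Fin m → Bool)
    (f : (Fin s → Fin m → Bool) → ℝ≥0∞) :
    ∫⁻ e, f (fun a b => xor (z a b) (e a b)) ∂flips α s m
      ≤ (∏ a, ∏ b, if z a b = z' a b then 1 else ENNReal.ofReal (1 + α)) *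
        ∫⁻ e, f (fun a b => xor (z' a b) (e a b)) ∂flips α s m := by
  have := isProbabilityMeasure_flipCoin hα
  have hp : ∀ z : Bool, IsProbabilityMeasure ((coin (1 / (α + 2))).map (xor z)) := fun z =>
    Measure.isProbabilityMeasure_map (measurable_of_countable _).aemeasurable
  have hpi : ∀ z : Fin m → Bool, IsProbabilityMeasure
      ((Measure.pi fun _ : Fin m => coin (1 / (α + 2))).map fun e b => xor (z b) (e b)) := fun z =>
    Measure.isProbabilityMeasure_map (measurable_of_countable _).aemeasurable
  have hmap : ∀ z : Fin s → Fin m → Bool,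
      ∫⁻ e, f (fun a b => xor (z a b) (e a b)) ∂flips α s m
        = ∫⁻ e, f e ∂(Measure.pi fun a => Measure.pi fun b =>
            (coin (1 / (α + 2))).map (xor (z a b))) := fun z => by
    have h1 : (Measure.pi fun a => Measure.pi fun b => (coin (1 / (α + 2))).map (xor (z a b)))
        = (flips α s m).map fun e a b => xor (z a b) (e a b) := by
      unfold flips
      rw [Measure.pi_map_pi (f := fun a (e : Fin m → Bool) b => xor (z a b) (e b))
        fun a => (measurable_of_countable _).aemeasurable]
      congr 1
      funext a
      rw [Measure.pi_map_pi fun b => (measurable_of_countable _).aemeasurable]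
    rw [h1, lintegral_map (measurable_of_countable _) (measurable_of_countable _)]
  rw [hmap, hmap]
  refine lintegral_pi_le_prod_mul (measurable_of_countable _) _ fun a e => ?_
  refine lintegral_pi_le_prod_mul (measurable_of_countable _) _ fun b e' => ?_
  rw [lintegral_map (measurable_of_countable _) (measurable_of_countable _),
    lintegral_map (measurable_of_countable _) (measurable_of_countable _)]
  exact lintegral_flipCoin_le hα (fun c => f (Function.update e a (Function.update e' b c))) _ _

/-! ### Privacy of the ALP-projection -/

/-- The distribution of the seeds. -/
noncomputable def seeds {d s : ℕ} (H : HashFamily d s) (m : ℕ) : Measure (Fin m → H.Seed) :=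
  Measure.pi fun _ : Fin m => (PMF.uniformOfFintype H.Seed).toMeasure

instance isProbabilityMeasure_seeds {d s : ℕ} (H : HashFamily d s) (m : ℕ) :
    IsProbabilityMeasure (seeds H m) := by unfold seeds; infer_instance

theorem lintegral_alp1 {d s : ℕ} (H : HashFamily d s) {α : ℝ} (hα : 0 ≤ α) (β : ℝ)
    (x : Fin d → ℝ) (f : Embedding H (levels α β) → ℝ≥0∞) :
    ∫⁻ o, f o ∂alp1 H α β x
      = ∫⁻ y, ∫⁻ σ, ∫⁻ e, f (σ, fun a b => xor (hashUnary H σ y a b) (e a b))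
          ∂flips α s (levels α β) ∂seeds H (levels α β)
          ∂Measure.pi fun i : Fin d => randRound (x i / α) := by
  have := isProbabilityMeasure_flips hα s (levels α β)
  have h : alp1 H α β x = ((Measure.pi fun i : Fin d => randRound (x i / α)).prod
      ((seeds H (levels α β)).prod (flips α s (levels α β)))).map
        fun ω => (ω.2.1, fun a b => xor (hashUnary H ω.2.1 ω.1 a b) (ω.2.2 a b)) := rfl
  rw [h, lintegral_map (measurable_of_countable _) (measurable_of_countable _),
    lintegral_prod _ (measurable_of_countable _).aemeasurable]
  refine lintegral_congr fun y => ?_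
  rw [lintegral_prod _ (measurable_of_countable _).aemeasurable]

theorem isProbabilityMeasure_alp1 {d s : ℕ} (H : HashFamily d s) {α : ℝ} (hα : 0 ≤ α) (β : ℝ)
    (x : Fin d → ℝ) : IsProbabilityMeasure (alp1 H α β x) := by
  have := isProbabilityMeasure_flips hα s (levels α β)
  constructor
  have := lintegral_alp1 H hα β x fun _ => 1
  simpa using this

/-- Two vectors whose unary encodings differ in a single position `(i, n + 1)` have almost the same
noisy hashed encodings. -/
theorem hashUnary_prod_le {d s m : ℕ} (H : HashFamily d s) (σ : Fin m → H.Seed)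
    (y y' : Fin d → ℤ) (i : Fin d) (n : ℤ) (hne : ∀ j ≠ i, y j = y' j)
    (hi : ∀ b : Fin m, (b : ℤ) ≠ n → ((b : ℤ) + 1 ≤ y i ↔ (b : ℤ) + 1 ≤ y' i))
    {c : ℝ≥0∞} (hc : 1 ≤ c) :
    (∏ a, ∏ b, if hashUnary H σ y a b = hashUnary H σ y' a b then 1 else c) ≤ c := by
  -- The unary position that changes influences one bit only, in column `n` and in the row to which
  -- `i` is hashed there.
  have hdiff : ∀ a b, hashUnary H σ y a b ≠ hashUnary H σ y' a b →
      (b : ℤ) = n ∧ H.eval (σ b) i = a := by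
    intro a b h
    by_contra hcon
    apply h
    unfold hashUnary
    rw [decide_eq_decide]
    refine exists_congr fun j => ?_
    by_cases hj : j = i
    · subst hj
      by_cases hb : (b : ℤ) = n
      · have : H.eval (σ b) j ≠ a := fun h => hcon ⟨hb, h⟩
        simp [this]
      · rw [hi b hb]
    · rw [hne j hj]
  by_cases hb : ∃ b : Fin m, (b : ℤ) = n
  · obtain ⟨b, hb⟩ := hb
    calc _ ≤ ∏ a, ∏ b', if a = H.eval (σ b) i ∧ b' = b then c else 1 := by
          refine Finset.prod_le_prod' fun a _ => Finset.prod_le_prod' fun b' _ => ?_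
          split_ifs with h1 h2 h2
          · exact hc
          · exact le_rfl
          · exact le_rfl
          · obtain ⟨h3, h4⟩ := hdiff a b' h1
            have : b' = b := by ext; have := h3.trans hb.symm; exact_mod_cast this
            subst this
            exact absurd ⟨h4.symm, rfl⟩ h2
      _ = c := by
          rw [Finset.prod_eq_single (H.eval (σ b) i), Finset.prod_eq_single b]
          · simp
          · intro b' _ h; simp [h]
          · simp
          · intro a _ h; simp [h]
          · simp
  -- If `n` is not the index of a column, the two arrays agree.
  · push Not at hb
    refine le_trans (le_of_eq ?_) hc
    refine Finset.prod_eq_one fun a _ => Finset.prod_eq_one fun b _ => ?_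
    rw [if_pos]
    by_contra h
    exact hb b (hdiff a b h).1

/-- The expectation given the rounded vector changes by a factor of at most `1 + α` when one
coordinate moves by one. Averaging over the rounding, coordinate by coordinate, gives the
exponential. The bound on `f` keeps the conditional expectations finite. -/
theorem lintegral_alp1_le {d s : ℕ} (H : HashFamily d s) {α : ℝ} (hα : 0 < α) (β : ℝ)
    (x x' : Fin d → ℝ) {f : Embedding H (levels α β) → ℝ≥0∞} (hf : ∀ o, f o ≤ 1) :
    ∫⁻ o, f o ∂alp1 H α β x
      ≤ ENNReal.ofReal (Real.exp (∑ i, |x i - x' i|)) * ∫⁻ o, f o ∂alp1 H α β x' := by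
  have := isProbabilityMeasure_flips hα.le s (levels α β)
  rw [lintegral_alp1 H hα.le, lintegral_alp1 H hα.le]
  set F : (Fin d → ℤ) → ℝ≥0∞ := fun y => ∫⁻ σ, ∫⁻ e,
    f (σ, fun a b => xor (hashUnary H σ y a b) (e a b)) ∂flips α s (levels α β)
      ∂seeds H (levels α β) with hF
  have hF1 : ∀ y, F y ≠ ∞ := fun y => by
    refine ne_of_lt (lt_of_le_of_lt ?_ ENNReal.one_lt_top)
    calc F y ≤ ∫⁻ σ, ∫⁻ e, 1 ∂flips α s (levels α β) ∂seeds H (levels α β) :=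
          lintegral_mono fun σ => lintegral_mono fun e => hf _
      _ = 1 := by simp
  have h1α : (1 : ℝ≥0∞) ≤ ENNReal.ofReal (1 + α) := by
    rw [← ENNReal.ofReal_one]; exact ENNReal.ofReal_le_ofReal (by linarith)
  have hstep : ∀ (y y' : Fin d → ℤ) (i : Fin d) (n : ℤ), (∀ j ≠ i, y j = y' j) →
      (∀ b : Fin (levels α β), (b : ℤ) ≠ n → ((b : ℤ) + 1 ≤ y i ↔ (b : ℤ) + 1 ≤ y' i)) →
      F y ≤ ENNReal.ofReal (1 + α) * F y' := by
    intro y y' i n hne hi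
    rw [hF]
    simp only
    rw [← lintegral_const_mul _ (measurable_of_countable _)]
    refine lintegral_mono fun σ => ?_
    refine (lintegral_flips_le hα.le _ (hashUnary H σ y') fun z => f (σ, z)).trans ?_
    gcongr
    exact hashUnary_prod_le H σ y y' i n hne hi h1α
  rw [Real.exp_sum, ENNReal.ofReal_prod_of_nonneg fun i _ => (Real.exp_pos _).le]
  refine lintegral_pi_le_prod_mul (measurable_of_countable _) _ fun i y => ?_
  have hd : |x i - x' i| = α * |x i / α - x' i / α| := by
    rw [← sub_div, abs_div, abs_of_pos hα]; field_simp
  rw [hd]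
  refine lintegral_randRound_le (fun n => hF1 _) (fun n => ?_) (fun n => ?_) hα.le _ _
  · refine hstep _ _ i n (fun j hj => by simp [hj]) fun b hb => ?_
    simp only [Function.update_self]
    omega
  · refine hstep _ _ i n (fun j hj => by simp [hj]) fun b hb => ?_
    simp only [Function.update_self]
    omega

/-- Threshold ALP-projection is differentially private. -/
theorem isDP_thresholdALP {d s : ℕ} (k : ℕ) (H : HashFamily d s) {α ε₁ ε₂ : ℝ} (hα : 0 < α)
    (hε₁ : 0 < ε₁) (hε₂ : 0 < ε₂) : IsDP k (ε₁ + ε₂) (thresholdALP H α ε₁ ε₂) := by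
  intro x x' _ _ _ _ hxx' S hS
  have := isProbabilityMeasure_alp1 H hα.le (thr d ε₁ * ε₂) fun i => x i * ε₂
  have := isProbabilityMeasure_alp1 H hα.le (thr d ε₁ * ε₂) fun i => x' i * ε₂
  have := isProbabilityMeasure_threshold hε₁ (thr d ε₁) x
  have := isProbabilityMeasure_threshold hε₁ (thr d ε₁) x'
  set A := alp H α (thr d ε₁) ε₂ x with hA
  set A' := alp H α (thr d ε₁) ε₂ x' with hA'
  have : IsProbabilityMeasure A := ‹IsProbabilityMeasure (alp1 H α _ fun i => x i * ε₂)›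
  have : IsProbabilityMeasure A' := ‹IsProbabilityMeasure (alp1 H α _ fun i => x' i * ε₂)›
  -- The sections at fixed `v` cost `exp ε₂`; exchanging the law of `v` afterwards costs `exp ε₁`.
  have hAA : ∀ v, A (Prod.mk v ⁻¹' S) ≤ ENNReal.ofReal (Real.exp ε₂) * A' (Prod.mk v ⁻¹' S) := by
    intro v
    have hS' : MeasurableSet (Prod.mk v ⁻¹' S) := measurable_prodMk_left hS
    have h := lintegral_alp1_le H hα (thr d ε₁ * ε₂) (fun i => x i * ε₂) (fun i => x' i * ε₂)
      (f := (Prod.mk v ⁻¹' S).indicator 1) fun o => Set.indicator_le_self' (by simp) o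
    rw [lintegral_indicator_one hS', lintegral_indicator_one hS'] at h
    refine h.trans ?_
    gcongr
    · calc ∑ i, |x i * ε₂ - x' i * ε₂| = (∑ i, |x i - x' i|) * ε₂ := by
            rw [Finset.sum_mul]
            refine Finset.sum_congr rfl fun i _ => ?_
            rw [← sub_mul, abs_mul, abs_of_pos hε₂]
        _ ≤ 1 * ε₂ := by gcongr
        _ = ε₂ := one_mul _
    · exact le_rfl
  have hm : Measurable fun v => A' (Prod.mk v ⁻¹' S) := measurable_measure_prodMk_left hS
  unfold thresholdALP
  rw [Measure.prod_apply hS, Measure.prod_apply hS]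
  calc ∫⁻ v, A (Prod.mk v ⁻¹' S) ∂threshold ε₁ (thr d ε₁) x
      ≤ ∫⁻ v, ENNReal.ofReal (Real.exp ε₂) * A' (Prod.mk v ⁻¹' S) ∂threshold ε₁ (thr d ε₁) x :=
        lintegral_mono hAA
    _ = ENNReal.ofReal (Real.exp ε₂) * ∫⁻ v, A' (Prod.mk v ⁻¹' S) ∂threshold ε₁ (thr d ε₁) x :=
        lintegral_const_mul _ hm
    _ ≤ ENNReal.ofReal (Real.exp ε₂) * (ENNReal.ofReal (Real.exp ε₁) *
          ∫⁻ v, A' (Prod.mk v ⁻¹' S) ∂threshold ε₁ (thr d ε₁) x') := by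
        gcongr
        refine (lintegral_threshold_le hε₁ _ x x' hm).trans ?_
        gcongr
        nlinarith
    _ = _ := by
        rw [← mul_assoc, ← ENNReal.ofReal_mul (Real.exp_pos _).le, ← Real.exp_add, add_comm ε₂]

/-! ### Expectations of products over the columns -/

/-- A single noise bit is used in each column, and these bits are independent. Factors `1` at all
other positions turn the integrand into a product over the whole array. -/
theorem lintegral_flips_prod {α : ℝ} (hα : 0 ≤ α) {s m : ℕ} (a : Fin m → Fin s)
    (W : Fin m → Bool → ℝ≥0∞) :
    ∫⁻ e, ∏ b, W b (e (a b) b) ∂flips α s m = ∏ b, ∫⁻ c, W b c ∂coin (1 / (α + 2)) := by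
  have := isProbabilityMeasure_flipCoin hα
  have h1 : ∀ e : Fin s → Fin m → Bool, ∏ b, W b (e (a b) b)
      = ∏ a', ∏ b, if a' = a b then W b (e a' b) else 1 := fun e => by
    rw [Finset.prod_comm]
    refine Finset.prod_congr rfl fun b _ => ?_
    rw [Finset.prod_eq_single (a b)] <;> simp +contextual
  have h2 : ∀ (a' : Fin s) (b : Fin m), ∫⁻ c, (if a' = a b then W b c else 1) ∂coin (1 / (α + 2))
      = if a' = a b then ∫⁻ c, W b c ∂coin (1 / (α + 2)) else 1 := fun a' b => by
    split_ifs <;> simp only [lintegral_one, measure_univ]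
  simp_rw [h1]
  unfold flips
  rw [lintegral_pi_prod (f := fun a' (e : Fin m → Bool) => ∏ b, if a' = a b then W b (e b) else 1)
    fun a' => measurable_of_countable _]
  have h3 : ∀ a', ∫⁻ e : Fin m → Bool, ∏ b, (if a' = a b then W b (e b) else 1)
      ∂(Measure.pi fun _ => coin (1 / (α + 2)))
      = ∏ b, if a' = a b then ∫⁻ c, W b c ∂coin (1 / (α + 2)) else 1 := fun a' => by
    rw [lintegral_pi_prod (f := fun b c => if a' = a b then W b c else 1)
      fun a' => measurable_of_countable _]
    exact Finset.prod_congr rfl fun b _ => h2 a' b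
  simp_rw [h3]
  rw [Finset.prod_comm]
  refine Finset.prod_congr rfl fun b _ => ?_
  rw [Finset.prod_eq_single (a b)] <;> simp +contextual

theorem lintegral_seeds_prod {d s : ℕ} (H : HashFamily d s) (m : ℕ)
    (V : Fin m → H.Seed → ℝ≥0∞) :
    ∫⁻ σ, ∏ b, V b (σ b) ∂seeds H m
      = ∏ b, ∫⁻ τ, V b τ ∂(PMF.uniformOfFintype H.Seed).toMeasure :=
  lintegral_pi_prod fun _ => measurable_of_countable _

/-- In a universal family, the probability that a key collides with one of at most `k` other
keys is at most `k / s`. -/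
theorem HashFamily.Universal.measure_collision_le {d s : ℕ} {H : HashFamily d s}
    (hH : H.Universal) (hs : 0 < s) (i : Fin d) (J : Finset (Fin d)) (hi : i ∉ J) :
    (PMF.uniformOfFintype H.Seed).toMeasure {τ | ∃ j ∈ J, H.eval τ j = H.eval τ i}
      ≤ ENNReal.ofReal (J.card / s) := by
  have h1 : ∀ j ∈ J, (PMF.uniformOfFintype H.Seed).toMeasure {τ | H.eval τ j = H.eval τ i}
      ≤ ENNReal.ofReal (1 / s) := by
    intro j hj
    have hne : j ≠ i := fun h => hi (h ▸ hj)
    have hu := hH j i hne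
    classical
    rw [PMF.toMeasure_uniformOfFintype_apply _ (MeasurableSet.of_discrete)]
    have hc : Fintype.card {τ | H.eval τ j = H.eval τ i}
        = (Finset.univ.filter fun τ : H.Seed => H.eval τ j = H.eval τ i).card := by
      rw [← Set.toFinset_card]; congr 1; ext; simp
    have hpos : (0 : ℝ) < Fintype.card H.Seed := by exact_mod_cast Fintype.card_pos
    rw [hc, ← ENNReal.ofReal_natCast, ← ENNReal.ofReal_natCast, ← ENNReal.ofReal_div_of_pos hpos]
    refine ENNReal.ofReal_le_ofReal ?_
    have hs' : (0 : ℝ) < s := by exact_mod_cast hs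
    rw [div_le_div_iff₀ hpos hs']
    have : ((s * (Finset.univ.filter fun τ : H.Seed => H.eval τ j = H.eval τ i).card : ℕ) : ℝ)
      ≤ Fintype.card H.Seed := by exact_mod_cast hu
    push_cast at this
    linarith
  have h2 : {τ | ∃ j ∈ J, H.eval τ j = H.eval τ i} = ⋃ j ∈ J, {τ | H.eval τ j = H.eval τ i} := by
    ext; simp
  rw [h2]
  refine (measure_biUnion_finset_le J _).trans ((Finset.sum_le_sum h1).trans ?_)
  rw [Finset.sum_const, nsmul_eq_mul, ← ENNReal.ofReal_natCast,
    ← ENNReal.ofReal_mul (Nat.cast_nonneg _)]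
  refine ENNReal.ofReal_le_ofReal (le_of_eq ?_)
  ring

/-! ### The random walk -/

/-- A `1` counts as `1`, and a `0` as `-1`. -/
noncomputable def bitSign (c : Bool) : ℝ := if c then 1 else -1

/-- Exponential weight of a bit in column `b`, whose product over the columns compares the
partial sums at `n` and at `Y`. -/
noncomputable def walkWeight (ν : ℝ) (n Y b : ℕ) (c : Bool) : ℝ :=
  Real.exp (ν * (((if b < n then 1 else 0) - (if b < Y then 1 else 0)) * bitSign c))

theorem prod_walkWeight {d s m : ℕ} (H : HashFamily d s) (e : Embedding H m) (i : Fin d)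
    (ν : ℝ) (n Y : ℕ) :
    ∏ b : Fin m, walkWeight ν n Y b (e.2 (H.eval (e.1 b) i) b)
      = Real.exp (ν * (partialSum H e i n - partialSum H e i Y)) := by
  have hp : ∀ n, (partialSum H e i n : ℝ)
      = ∑ b : Fin m, (if (b : ℕ) < n then (1 : ℝ) else 0) * bitSign (e.2 (H.eval (e.1 b) i) b) := by
    intro n
    rw [partialSum, Int.cast_sum, Finset.sum_filter]
    refine Finset.sum_congr rfl fun b _ => ?_
    unfold bitSign
    split_ifs <;> simp
  unfold walkWeight
  rw [← Real.exp_sum, ← Finset.mul_sum, hp, hp, ← Finset.sum_sub_distrib]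
  congr 2
  refine Finset.sum_congr rfl fun b _ => ?_
  ring

theorem walkWeight_pos (ν : ℝ) (n Y b : ℕ) (c : Bool) : 0 < walkWeight ν n Y b c :=
  Real.exp_pos _

theorem maximizers_nonempty {d s m : ℕ} (H : HashFamily d s) (e : Embedding H m) (i : Fin d) :
    (maximizers H e i).Nonempty := by
  obtain ⟨n, hn, h⟩ := Finset.exists_max_image (Finset.range (m + 1)) (partialSum H e i)
    ⟨0, by simp⟩
  exact ⟨n, by simp only [maximizers, Finset.mem_filter]; exact ⟨hn, h⟩⟩

/-- The average of the maximizers of the partial sums. -/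
noncomputable def averageMaximizer {d s m : ℕ} (H : HashFamily d s) (e : Embedding H m)
    (i : Fin d) : ℝ :=
  (∑ n ∈ maximizers H e i, (n : ℝ)) / ((maximizers H e i).card : ℝ)

theorem abs_average_sub_le {S : Finset ℕ} (hS : S.Nonempty) {Y g : ℝ}
    (h : ∀ n ∈ S, |(n : ℝ) - Y| ≤ g) : |(∑ n ∈ S, (n : ℝ)) / S.card - Y| ≤ g := by
  have hc : (0 : ℝ) < S.card := by exact_mod_cast hS.card_pos
  have : (∑ n ∈ S, (n : ℝ)) / S.card - Y = (∑ n ∈ S, ((n : ℝ) - Y)) / S.card := by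
    rw [Finset.sum_sub_distrib, Finset.sum_const, nsmul_eq_mul]; field_simp
  rw [this, abs_div, abs_of_pos hc, div_le_iff₀ hc]
  refine (Finset.abs_sum_le_sum_abs _ _).trans ((Finset.sum_le_sum h).trans (le_of_eq ?_))
  rw [Finset.sum_const, nsmul_eq_mul]; ring

/-- At a maximizer `n` the product of the weights is at least `1`, because the partial sum there is
no smaller than at `Y`. So the sum on the right, taken over all `n`, bounds the term of every
maximizer and therefore the average. -/
theorem exp_average_le {d s m : ℕ} (H : HashFamily d s) (e : Embedding H m) (i : Fin d)
    {θ ν : ℝ} (hθ : 0 < θ) (hν : 0 ≤ ν) {Y : ℕ} (hY : Y ≤ m) :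
    Real.exp (θ * |averageMaximizer H e i - Y|) ≤ ∑ n ∈ Finset.range (m + 1),
      Real.exp (θ * |(n : ℝ) - Y|) *
        ∏ b : Fin m, walkWeight ν n Y b (e.2 (H.eval (e.1 b) i) b) := by
  set B := ∑ n ∈ Finset.range (m + 1), Real.exp (θ * |(n : ℝ) - Y|) *
    ∏ b : Fin m, walkWeight ν n Y b (e.2 (H.eval (e.1 b) i) b) with hB
  have hn : ∀ n ∈ maximizers H e i, Real.exp (θ * |(n : ℝ) - Y|) ≤ B := by
    intro n hn
    simp only [maximizers, Finset.mem_filter] at hn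
    have h1 : 1 ≤ ∏ b : Fin m, walkWeight ν n Y b (e.2 (H.eval (e.1 b) i) b) := by
      rw [prod_walkWeight]
      refine Real.one_le_exp (mul_nonneg hν ?_)
      have := hn.2 Y (by simp; omega)
      rw [sub_nonneg]
      exact_mod_cast this
    calc Real.exp (θ * |(n : ℝ) - Y|)
        ≤ Real.exp (θ * |(n : ℝ) - Y|) *
          ∏ b : Fin m, walkWeight ν n Y b (e.2 (H.eval (e.1 b) i) b) :=
          le_mul_of_one_le_right (Real.exp_pos _).le h1
      _ ≤ B := Finset.single_le_sum (f := fun n : ℕ => Real.exp (θ * |(n : ℝ) - Y|) *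
          ∏ b : Fin m, walkWeight ν n Y b (e.2 (H.eval (e.1 b) i) b))
          (fun n _ => mul_nonneg (Real.exp_pos _).le
            (Finset.prod_nonneg fun b _ => (walkWeight_pos _ _ _ _ _).le)) hn.1
  have hBpos : 0 < B := by
    obtain ⟨n, h⟩ := maximizers_nonempty H e i
    exact (Real.exp_pos _).trans_le (hn n h)
  -- The bound is brought into the form of a distance, since distances to `Y` pass to averages.
  have : |averageMaximizer H e i - Y| ≤ Real.log B / θ := by
    refine abs_average_sub_le (maximizers_nonempty H e i) fun n h => ?_
    rw [le_div_iff₀ hθ, Real.le_log_iff_exp_le hBpos, mul_comm]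
    exact hn n h
  calc Real.exp (θ * |averageMaximizer H e i - Y|) ≤ Real.exp (θ * (Real.log B / θ)) := by gcongr
    _ = B := by rw [mul_div_cancel₀ _ hθ.ne', Real.exp_log hBpos]

theorem sum_pow_le_of_injOn {ι : Type*} (A : Finset ι) (φ : ι → ℕ) (hφ : Set.InjOn φ A) {g : ℝ}
    (h0 : 0 ≤ g) (h1 : g < 1) : ∑ a ∈ A, g ^ φ a ≤ 1 / (1 - g) := by
  rw [← Finset.sum_image (f := fun n => g ^ n) hφ, one_div, ← tsum_geometric_of_lt_one h0 h1]
  exact (summable_geometric_of_lt_one h0 h1).sum_le_tsum _ fun _ _ => by positivity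

/-- The distance to `Y` is injective on either side of `Y`, which leaves two geometric series. -/
theorem sum_pow_dist_le (A : Finset ℕ) (Y : ℕ) {g : ℝ} (h0 : 0 ≤ g) (h1 : g < 1) :
    ∑ n ∈ A, g ^ (Nat.dist n Y) ≤ 2 / (1 - g) := by
  rw [← Finset.sum_filter_add_sum_filter_not A (fun n => n ≤ Y)]
  have ha := sum_pow_le_of_injOn (A.filter fun n => n ≤ Y) (fun n => Nat.dist n Y)
    (fun a ha b hb h => by simp [Nat.dist] at *; omega) h0 h1
  have hb := sum_pow_le_of_injOn (A.filter fun n => ¬ n ≤ Y) (fun n => Nat.dist n Y)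
    (fun a ha b hb h => by simp [Nat.dist] at *; omega) h0 h1
  calc _ ≤ 1 / (1 - g) + 1 / (1 - g) := add_le_add ha hb
    _ = _ := by ring

/-- Exactly the columns between `n` and `Y` contribute a factor `q`. -/
theorem prod_column_eq_pow (m n Y : ℕ) (hn : n ≤ m) (hY : Y ≤ m) (q : ℝ≥0∞) :
    (∏ b : Fin m, if ((b : ℕ) < n ↔ (b : ℕ) < Y) then 1 else q) = q ^ Nat.dist n Y := by
  rw [Fin.prod_univ_eq_prod_range (fun b => if (b < n ↔ b < Y) then 1 else q), Finset.prod_ite]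
  rw [Finset.prod_const_one, one_mul, Finset.prod_const]
  congr 1
  have : (Finset.range m).filter (fun b => ¬ (b < n ↔ b < Y)) = Finset.Ico (min n Y) (max n Y) := by
    ext b; simp only [Finset.mem_filter, Finset.mem_range, Finset.mem_Ico]; omega
  rw [this, Nat.card_Ico, Nat.dist]; omega

/-- The bit read for key `i` in column `b`, before randomized response, if the hash function of
this column has seed `τ`. -/
noncomputable def readBit {d s : ℕ} (H : HashFamily d s) (y : Fin d → ℤ) (i : Fin d) (b : ℕ)
    (τ : H.Seed) : Bool :=
  open Classical in decide (∃ j, (b : ℤ) + 1 ≤ y j ∧ H.eval τ j = H.eval τ i)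

/-- The weight is trivial unless the column lies between `n` and `Y`. There, a bit has the wrong
value with probability at most `p + γ(1-2p)`, where `p` is the flip probability: above `Y` a wrong
bit needs a flip or a collision, below `Y` it needs a flip. -/
theorem lintegral_column_le {d s k : ℕ} {H : HashFamily d s} (hH : H.Universal) (hs : 0 < s)
    {α γ ν q : ℝ} (hα : 0 ≤ α) (hν : 0 ≤ ν) (hγ0 : 0 ≤ γ) (hγ : (k : ℝ) / s ≤ γ)
    (hq : (1 / (α + 2) + γ * (1 - 2 * (1 / (α + 2)))) * Real.exp ν +
      (1 - (1 / (α + 2) + γ * (1 - 2 * (1 / (α + 2))))) * Real.exp (-ν) ≤ q)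
    {y : Fin d → ℤ} (hy : (Finset.univ.filter fun j => 1 ≤ y j).card ≤ k) (i : Fin d)
    {m b n Y : ℕ} (hb : b < m) (hYm : (Y : ℤ) = max 0 (min (y i) m)) :
    ∫⁻ τ, ∫⁻ c, ENNReal.ofReal (walkWeight ν n Y b (xor (readBit H y i b τ) c))
        ∂coin (1 / (α + 2)) ∂(PMF.uniformOfFintype H.Seed).toMeasure
      ≤ if (b < n ↔ b < Y) then 1 else ENNReal.ofReal q := by
  have := isProbabilityMeasure_flipCoin hα
  have hp0 : 0 ≤ 1 / (α + 2) := by positivity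
  have hp1 : 0 ≤ 1 - 2 * (1 / (α + 2)) := by
    rw [sub_nonneg, mul_one_div, div_le_one (by linarith)]; linarith
  generalize hpdef : 1 / (α + 2) = p at *
  have hL : Real.exp (-ν) ≤ Real.exp ν := Real.exp_le_exp.2 (by linarith)
  have hLpos := Real.exp_pos (-ν)
  split_ifs with h
  · have hw : ∀ c, walkWeight ν n Y b c = 1 := fun c => by
      unfold walkWeight
      by_cases h' : b < n
      · simp [h', h.1 h']
      · have h2 : ¬ b < Y := fun h'' => h' (h.2 h'')
        simp [h', h2]
    simp only [hw, ENNReal.ofReal_one, lintegral_one, measure_univ, le_refl]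
  · by_cases hn : b < n
    · have hY : ¬ b < Y := fun h' => h ⟨fun _ => h', fun _ => hn⟩
      have hw : ∀ c, walkWeight ν n Y b c = if c then Real.exp ν else Real.exp (-ν) := fun c => by
        unfold walkWeight bitSign; cases c <;> simp [hn, hY]
      -- Since `Y ≤ b < m`, the clipping at `m` is inactive: key `i` does not set the bit itself,
      -- and a `1` before the noise is due to a collision with `J`.
      have hyi : y i < b + 1 := by omega
      set J := Finset.univ.filter fun j => (b : ℤ) + 1 ≤ y j with hJ
      have hJk : J.card ≤ k := le_trans (Finset.card_le_card fun j hj => by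
        simp only [hJ, Finset.mem_filter, Finset.mem_univ, true_and] at hj ⊢; omega) hy
      have hiJ : i ∉ J := by simp [hJ]; omega
      have hc := hH.measure_collision_le hs i J hiJ
      set Z := {τ | ∃ j ∈ J, H.eval τ j = H.eval τ i} with hZ
      have hcoll : (PMF.uniformOfFintype H.Seed).toMeasure Z ≤ ENNReal.ofReal γ := by
        refine hc.trans (ENNReal.ofReal_le_ofReal (le_trans ?_ hγ))
        gcongr
      have hval : ∀ τ, ∫⁻ c, ENNReal.ofReal (walkWeight ν n Y b (xor (readBit H y i b τ) c)) ∂coin p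
          ≤ ENNReal.ofReal (p * Real.exp ν + (1 - p) * Real.exp (-ν)) +
            ENNReal.ofReal ((1 - 2 * p) * (Real.exp ν - Real.exp (-ν))) * Z.indicator 1 τ := by
        intro τ
        rw [lintegral_coin, hw, hw, ← ENNReal.ofReal_mul hp0, ← ENNReal.ofReal_mul (by linarith),
          ← ENNReal.ofReal_add (by split_ifs <;> positivity)
            (by split_ifs <;> exact mul_nonneg (by linarith) (Real.exp_pos _).le)]
        by_cases hτ : readBit H y i b τ = true
        · have hZτ : τ ∈ Z := by
            simp only [readBit, decide_eq_true_eq] at hτ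
            obtain ⟨j, hj, hj'⟩ := hτ
            exact ⟨j, by simp [hJ]; omega, hj'⟩
          rw [hτ, Set.indicator_of_mem hZτ, Pi.one_apply, mul_one, ← ENNReal.ofReal_add
            (add_nonneg (by positivity) (mul_nonneg (by linarith) hLpos.le))
            (mul_nonneg hp1 (by linarith))]
          refine ENNReal.ofReal_le_ofReal (le_of_eq ?_)
          simp; ring
        · rw [Bool.not_eq_true] at hτ
          rw [hτ]
          refine le_trans (ENNReal.ofReal_le_ofReal (le_of_eq ?_)) le_self_add
          simp
      refine (lintegral_mono hval).trans ?_
      rw [lintegral_add_left (by fun_prop), lintegral_const_mul _ (measurable_of_countable _),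
        lintegral_indicator_one MeasurableSet.of_discrete, lintegral_const, measure_univ, mul_one]
      calc _ ≤ ENNReal.ofReal (p * Real.exp ν + (1 - p) * Real.exp (-ν)) +
            ENNReal.ofReal ((1 - 2 * p) * (Real.exp ν - Real.exp (-ν))) * ENNReal.ofReal γ := by
              gcongr
        _ ≤ ENNReal.ofReal q := by
          rw [← ENNReal.ofReal_mul (mul_nonneg hp1 (by linarith)), ← ENNReal.ofReal_add
            (add_nonneg (by positivity) (mul_nonneg (by linarith) hLpos.le))
            (mul_nonneg (mul_nonneg hp1 (by linarith)) hγ0)]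
          refine ENNReal.ofReal_le_ofReal (le_trans (le_of_eq ?_) hq)
          ring
    · have hY : b < Y := by
        by_contra h'
        exact h ⟨fun h'' => absurd h'' hn, fun h'' => absurd h'' h'⟩
      have hw : ∀ c, walkWeight ν n Y b c = if c then Real.exp (-ν) else Real.exp ν := fun c => by
        unfold walkWeight bitSign; cases c <;> simp [hn, hY]
      -- Here `b < Y`, so key `i` itself sets the bit, whatever the seed.
      have hz : ∀ τ, readBit H y i b τ = true := fun τ => by
        simp only [readBit, decide_eq_true_eq]
        exact ⟨i, by omega, rfl⟩
      simp_rw [hz, hw, lintegral_coin]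
      rw [lintegral_const, measure_univ, mul_one, ← ENNReal.ofReal_mul hp0,
        ← ENNReal.ofReal_mul (by linarith), ← ENNReal.ofReal_add
          (by split_ifs <;> positivity)
            (by split_ifs <;> exact mul_nonneg (by linarith) (Real.exp_pos _).le)]
      refine ENNReal.ofReal_le_ofReal (le_trans ?_ hq)
      simp only [Bool.true_xor, Bool.not_true, Bool.not_false, if_true, Bool.false_eq_true, if_false]
      nlinarith [mul_nonneg hγ0 (mul_nonneg hp1 (sub_nonneg.2 hL))]

/-- After `exp_average_le`, independence of seeds and noise across columns makes the expectation a
product of column expectations. The term of `n` is at most the power of `exp θ * q` with exponent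
`|n - Y|`, and these sum to a constant independent of `m`. -/
theorem lintegral_exp_average_le {d s k : ℕ} {H : HashFamily d s} (hH : H.Universal) (hs : 0 < s)
    {α γ ν q θ : ℝ} (hα : 0 ≤ α) (hν : 0 ≤ ν) (hγ0 : 0 ≤ γ) (hγ : (k : ℝ) / s ≤ γ)
    (hq : (1 / (α + 2) + γ * (1 - 2 * (1 / (α + 2)))) * Real.exp ν +
      (1 - (1 / (α + 2) + γ * (1 - 2 * (1 / (α + 2))))) * Real.exp (-ν) ≤ q)
    (hq0 : 0 ≤ q) (hθ : 0 < θ) (hθq : Real.exp θ * q < 1)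
    {y : Fin d → ℤ} (hy : (Finset.univ.filter fun j => 1 ≤ y j).card ≤ k) (i : Fin d)
    {m Y : ℕ} (hYm : (Y : ℤ) = max 0 (min (y i) m)) :
    ∫⁻ σ, ∫⁻ e, ENNReal.ofReal (Real.exp (θ *
        |averageMaximizer H (m := m) (σ, fun a b => xor (hashUnary H σ y a b) (e a b)) i - Y|))
          ∂flips α s m ∂seeds H m
      ≤ ENNReal.ofReal (2 / (1 - Real.exp θ * q)) := by
  have hY : Y ≤ m := by omega
  calc _ ≤ ∫⁻ σ, ∫⁻ e, ∑ n ∈ Finset.range (m + 1), ENNReal.ofReal (Real.exp (θ * |(n : ℝ) - Y|)) *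
        ∏ b : Fin m, ENNReal.ofReal (walkWeight ν n Y b
          (xor (readBit H y i b (σ b)) (e (H.eval (σ b) i) b))) ∂flips α s m ∂seeds H m := by
        refine lintegral_mono fun σ => lintegral_mono fun e => ?_
        refine (ENNReal.ofReal_le_ofReal (exp_average_le H _ i hθ hν hY)).trans (le_of_eq ?_)
        rw [ENNReal.ofReal_sum_of_nonneg fun n _ => mul_nonneg (Real.exp_pos _).le
          (Finset.prod_nonneg fun b _ => (walkWeight_pos _ _ _ _ _).le)]
        refine Finset.sum_congr rfl fun n _ => ?_
        rw [ENNReal.ofReal_mul (Real.exp_pos _).le, ENNReal.ofReal_prod_of_nonneg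
          fun b _ => (walkWeight_pos _ _ _ _ _).le]
        rfl
    _ = ∑ n ∈ Finset.range (m + 1), ENNReal.ofReal (Real.exp (θ * |(n : ℝ) - Y|)) *
        ∏ b : Fin m, ∫⁻ τ, ∫⁻ c, ENNReal.ofReal (walkWeight ν n Y b (xor (readBit H y i b τ) c))
          ∂coin (1 / (α + 2)) ∂(PMF.uniformOfFintype H.Seed).toMeasure := by
        have h1 : ∀ σ : Fin m → H.Seed, ∫⁻ e, ∑ n ∈ Finset.range (m + 1),
            ENNReal.ofReal (Real.exp (θ * |(n : ℝ) - Y|)) * ∏ b : Fin m, ENNReal.ofReal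
              (walkWeight ν n Y b (xor (readBit H y i b (σ b)) (e (H.eval (σ b) i) b))) ∂flips α s m
            = ∑ n ∈ Finset.range (m + 1), ENNReal.ofReal (Real.exp (θ * |(n : ℝ) - Y|)) *
              ∏ b : Fin m, ∫⁻ c, ENNReal.ofReal
                (walkWeight ν n Y b (xor (readBit H y i b (σ b)) c)) ∂coin (1 / (α + 2)) := by
          intro σ
          rw [lintegral_finsetSum _ fun n _ => measurable_of_countable _]
          refine Finset.sum_congr rfl fun n _ => ?_
          rw [lintegral_const_mul _ (measurable_of_countable _)]
          congr 1
          exact lintegral_flips_prod hα (fun b => H.eval (σ b) i)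
            fun b c => ENNReal.ofReal (walkWeight ν n Y b (xor (readBit H y i b (σ b)) c))
        simp_rw [h1]
        rw [lintegral_finsetSum _ fun n _ => measurable_of_countable _]
        refine Finset.sum_congr rfl fun n _ => ?_
        rw [lintegral_const_mul _ (measurable_of_countable _)]
        congr 1
        exact lintegral_seeds_prod H m fun b τ => ∫⁻ c, ENNReal.ofReal
          (walkWeight ν n Y b (xor (readBit H y i b τ) c)) ∂coin (1 / (α + 2))
    _ ≤ ∑ n ∈ Finset.range (m + 1), ENNReal.ofReal (Real.exp θ ^ Nat.dist n Y) *
          ENNReal.ofReal q ^ Nat.dist n Y := by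
        refine Finset.sum_le_sum fun n hn => ?_
        have hnm : n ≤ m := by simp at hn; omega
        have hd : Real.exp (θ * |(n : ℝ) - Y|) = Real.exp θ ^ Nat.dist n Y := by
          rw [← Real.exp_nat_mul, mul_comm]
          congr 2
          rcases le_total n Y with h | h
          · rw [Nat.dist_eq_sub_of_le h, Nat.cast_sub h, abs_sub_comm, abs_of_nonneg]
            simpa using h
          · rw [Nat.dist_eq_sub_of_le_right h, Nat.cast_sub h, abs_of_nonneg]
            simpa using h
        rw [hd, ← prod_column_eq_pow m n Y hnm hY]
        gcongr with b
        exact lintegral_column_le hH hs hα hν hγ0 hγ hq hy i b.2 hYm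
    _ ≤ _ := by
        simp_rw [← ENNReal.ofReal_pow hq0, ← ENNReal.ofReal_mul (pow_nonneg (Real.exp_pos θ).le _),
          ← mul_pow]
        rw [← ENNReal.ofReal_sum_of_nonneg fun n _ =>
          pow_nonneg (mul_nonneg (Real.exp_pos θ).le hq0) _]
        exact ENNReal.ofReal_le_ofReal
          (sum_pow_dist_le _ Y (mul_nonneg (Real.exp_pos θ).le hq0) hθq)

/-- The drift of the random walk is bounded away from zero, uniformly in `α`. -/
theorem exists_walk_constants {α₀ ρ₀ : ℝ} (hα₀ : 0 < α₀) (hρ₀ : 2 < ρ₀) :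
    ∃ ν q θ : ℝ, 0 ≤ ν ∧ 0 ≤ q ∧ 0 < θ ∧ Real.exp θ * q < 1 ∧ ∀ α, α₀ ≤ α →
      (1 / (α + 2) + 1 / ρ₀ * (1 - 2 * (1 / (α + 2)))) * Real.exp ν +
      (1 - (1 / (α + 2) + 1 / ρ₀ * (1 - 2 * (1 / (α + 2))))) * Real.exp (-ν) ≤ q := by
  have hγ : 1 / ρ₀ < 1 / 2 := one_div_lt_one_div_of_lt two_pos hρ₀
  have hγ0 : 0 < 1 / ρ₀ := by positivity
  generalize 1 / ρ₀ = γ at *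
  have hp0 : 0 < 1 / (α₀ + 2) := by positivity
  have hp1 : 1 / (α₀ + 2) < 1 / 2 := one_div_lt_one_div_of_lt two_pos (by linarith)
  set p₀ := 1 / (α₀ + 2) with hp₀
  set r := p₀ + γ * (1 - 2 * p₀) with hr
  have hr0 : 0 < r := by
    have := mul_pos hγ0 (by linarith : 0 < 1 - 2 * p₀)
    linarith
  have hr1 : r < 1 / 2 := by nlinarith [mul_pos (sub_pos.2 hγ) (sub_pos.2 hp1)]
  -- With `L = exp ν`, this choice gives `q = 1/2 + 2r(1-r)`, which is below `1` because `r < 1/2`.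
  set L := 1 / (2 * r) with hL
  have hL1 : 1 ≤ L := by rw [hL, le_div_iff₀ (by linarith)]; linarith
  have hLpos : 0 < L := by linarith
  have hLinv : L⁻¹ = 2 * r := by rw [hL]; simp
  have hrL : r * L = 1 / 2 := by rw [hL]; field_simp
  set q := r * L + (1 - r) * L⁻¹ with hq
  have hq' : q = 1 / 2 + 2 * r * (1 - r) := by rw [hq, hLinv, hrL]; ring
  have hq0 : 0 < q := by rw [hq']; nlinarith
  have hq1 : q < 1 := by rw [hq']; nlinarith [mul_pos (sub_pos.2 hr1) (sub_pos.2 hr1)]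
  -- The third witness makes `exp θ * q` equal to the square root of `q`.
  refine ⟨Real.log L, q, -Real.log q / 2, Real.log_nonneg hL1, hq0.le, ?_, ?_, ?_⟩
  · have := Real.log_neg hq0 hq1; linarith
  · conv_lhs => rw [← Real.exp_log hq0, ← Real.exp_add, Real.log_exp]
    rw [Real.exp_lt_one_iff]
    have := Real.log_neg hq0 hq1; linarith
  · intro α hα
    rw [Real.exp_neg, Real.exp_log hLpos]
    have hp : 1 / (α + 2) ≤ p₀ := one_div_le_one_div_of_le (by linarith) (by linarith)
    have hLL : L⁻¹ ≤ L := (inv_le_one_of_one_le₀ hL1).trans hL1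
    -- The probability of a wrong bit increases with the flip probability, so `α₀` is the worst
    -- case.
    have : 1 / (α + 2) + γ * (1 - 2 * (1 / (α + 2))) ≤ r := by nlinarith
    rw [hq]
    nlinarith [mul_nonneg (sub_nonneg.2 this) (sub_nonneg.2 hLL)]

/-! ### From rounded entries to real entries -/

theorem ae_randRound (r : ℝ) : ∀ᵐ n ∂randRound r, n = ⌈r⌉ ∨ n = ⌊r⌋ := by
  rw [randRound, ae_map_iff (measurable_of_countable _).aemeasurable MeasurableSet.of_discrete]
  refine Filter.Eventually.of_forall fun b => ?_
  cases b <;> simp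

/-- Rounding `r` and rounding up `T` are each off by at most `1`, and a minimum is off by no more
than the larger of the two, so the errors do not add. -/
theorem abs_clip_sub_min_le {r T : ℝ} (hr : 0 ≤ r) (hT : 0 ≤ T) {n : ℤ}
    (hn : n = ⌈r⌉ ∨ n = ⌊r⌋) {Y : ℕ} (hY : (Y : ℤ) = max 0 (min n ⌈T⌉₊)) :
    |(Y : ℝ) - min r T| ≤ 1 := by
  have hn0 : 0 ≤ n := by
    rcases hn with rfl | rfl
    · exact Int.ceil_nonneg hr
    · exact Int.floor_nonneg.2 hr
  have hY' : (Y : ℝ) = min (n : ℝ) (⌈T⌉₊ : ℝ) := by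
    have : (Y : ℤ) = min n ⌈T⌉₊ := by omega
    exact_mod_cast this
  have h1 : |(n : ℝ) - r| ≤ 1 := by
    rw [abs_le]
    rcases hn with rfl | rfl
    · have := Int.le_ceil r; have := Int.ceil_lt_add_one r; constructor <;> linarith
    · have := Int.floor_le r; have := Int.lt_floor_add_one r; constructor <;> linarith
  have h2 : |(⌈T⌉₊ : ℝ) - T| ≤ 1 := by
    have := Nat.le_ceil T; have := Nat.ceil_lt_add_one hT
    rw [abs_le]; constructor <;> linarith
  rw [hY']
  exact (abs_min_sub_min_le_max _ _ _ _).trans (max_le h1 h2)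

/-- Exponential moments of the error of the ALP-estimator, for the truncated entries. -/
theorem lintegral_exp_alp1_error_le {d s k : ℕ} {H : HashFamily d s} (hH : H.Universal)
    (hs : 0 < s) {α γ ν q θ β : ℝ} (hα : 0 < α) (hν : 0 ≤ ν) (hγ0 : 0 ≤ γ)
    (hγ : (k : ℝ) / s ≤ γ)
    (hq : (1 / (α + 2) + γ * (1 - 2 * (1 / (α + 2)))) * Real.exp ν +
      (1 - (1 / (α + 2) + γ * (1 - 2 * (1 / (α + 2))))) * Real.exp (-ν) ≤ q)
    (hq0 : 0 ≤ q) (hθ : 0 < θ) (hθq : Real.exp θ * q < 1) (hβ : 0 ≤ β)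
    {x : Fin d → ℝ} (hx : ∀ i, 0 ≤ x i) (hxk : IsSparse k x) (i : Fin d) :
    ∫⁻ o, ENNReal.ofReal (Real.exp (θ * |averageMaximizer H o i - min (x i / α) (β / α)|))
        ∂alp1 H α β x
      ≤ ENNReal.ofReal (Real.exp θ * (2 / (1 - Real.exp θ * q))) := by
  have := isProbabilityMeasure_flips hα.le s (levels α β)
  rw [lintegral_alp1 H hα.le]
  have hae : ∀ᵐ y ∂(Measure.pi fun i : Fin d => randRound (x i / α)),
      ∀ j, y j = ⌈x j / α⌉ ∨ y j = ⌊x j / α⌋ := by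
    rw [ae_all_iff]
    intro j
    exact (Measure.quasiMeasurePreserving_eval (fun i => randRound (x i / α)) j).ae
      (ae_randRound (x j / α))
  calc _ ≤ ∫⁻ y, ENNReal.ofReal (Real.exp θ * (2 / (1 - Real.exp θ * q)))
        ∂(Measure.pi fun i : Fin d => randRound (x i / α)) := by
        refine lintegral_mono_ae (hae.mono fun y hy => ?_)
        -- Zero is rounded to zero, so rounding preserves sparsity.
        have hyk : (Finset.univ.filter fun j => 1 ≤ y j).card ≤ k := by
          refine le_trans (Finset.card_le_card fun j hj => ?_) hxk
          simp only [Finset.mem_filter, Finset.mem_univ, true_and] at hj ⊢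
          intro h0
          have := hy j
          simp [h0] at this
          omega
        obtain ⟨Y, hY⟩ := Int.eq_ofNat_of_zero_le
          (le_max_left (0 : ℤ) (min (y i) (levels α β : ℕ)))
        have hdist := abs_clip_sub_min_le (div_nonneg (hx i) hα.le) (div_nonneg hβ hα.le)
          (hy i) (Y := Y) hY.symm
        have hmain := lintegral_exp_average_le hH hs hα.le hν hγ0 hγ hq hq0 hθ hθq hyk i hY.symm
        calc _ ≤ ∫⁻ σ, ∫⁻ e, ENNReal.ofReal (Real.exp θ) * ENNReal.ofReal (Real.exp (θ *
              |averageMaximizer H (m := levels α β)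
                (σ, fun a b => xor (hashUnary H σ y a b) (e a b)) i - Y|))
                ∂flips α s (levels α β) ∂seeds H (levels α β) := by
              refine lintegral_mono fun σ => lintegral_mono fun e => ?_
              rw [← ENNReal.ofReal_mul (Real.exp_pos _).le, ← Real.exp_add]
              refine ENNReal.ofReal_le_ofReal (Real.exp_le_exp.2 ?_)
              have := abs_sub_le (averageMaximizer H (m := levels α β)
                (σ, fun a b => xor (hashUnary H σ y a b) (e a b)) i) Y (min (x i / α) (β / α))
              nlinarith
          _ ≤ _ := by
              simp_rw [lintegral_const_mul _ (measurable_of_countable _)]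
              rw [ENNReal.ofReal_mul (Real.exp_pos _).le]
              gcongr
    _ = _ := by rw [lintegral_const, measure_univ, mul_one]

/-! ### The error of Threshold ALP -/

/-- Splits an expectation between the two independent parts and goes back to the Laplace noise
itself. As only an upper bound is claimed, `f` may be non-measurable. -/
theorem lintegral_thresholdALP_le {d s : ℕ} (H : HashFamily d s) {α ε₁ ε₂ : ℝ} (hα : 0 < α)
    (hε₁ : 0 < ε₁) (x : Fin d → ℝ) {f : Output H α ε₁ ε₂ → ℝ≥0∞} {U : (Fin d → ℝ) → ℝ≥0∞}
    {V : Embedding H (levels α (thr d ε₁ * ε₂)) → ℝ≥0∞} (hU : Measurable U)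
    (hf : ∀ η e, f (fun i => if thr d ε₁ ≤ x i + η i then x i + η i else 0, e) ≤ U η + V e) :
    ∫⁻ o, f o ∂thresholdALP H α ε₁ ε₂ x
      ≤ ∫⁻ η, U η ∂(Measure.pi fun _ : Fin d => laplace ε₁) +
        ∫⁻ e, V e ∂alp H α (thr d ε₁) ε₂ x := by
  have := isProbabilityMeasure_laplace hε₁
  have := isProbabilityMeasure_threshold hε₁ (thr d ε₁) x
  have : IsProbabilityMeasure (alp H α (thr d ε₁) ε₂ x) := isProbabilityMeasure_alp1 H hα.le _ _
  have hmap : thresholdALP H α ε₁ ε₂ x = ((Measure.pi fun _ : Fin d => laplace ε₁).prod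
      (alp H α (thr d ε₁) ε₂ x)).map (Prod.map
        (fun η i => if thr d ε₁ ≤ x i + η i then x i + η i else 0) id) := by
    rw [← Measure.map_prod_map _ _ _ measurable_id, Measure.map_id]
    · rfl
    · exact measurable_pi_lambda _ fun i =>
        (measurable_cut _).comp (measurable_const.add (measurable_pi_apply i))
  rw [hmap]
  refine (lintegral_map_le _ _).trans ((lintegral_mono
    fun p : (Fin d → ℝ) × Embedding H (levels α (thr d ε₁ * ε₂)) => hf p.1 p.2).trans ?_)
  have hV : Measurable V := measurable_of_countable _
  rw [lintegral_add_left (f := fun p : (Fin d → ℝ) × Embedding H (levels α (thr d ε₁ * ε₂)) =>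
    U p.1) (hU.comp measurable_fst)]
  refine le_of_eq (congrArg₂ _ ?_ ?_)
  · exact measurePreserving_fst.lintegral_comp hU
  · exact measurePreserving_snd.lintegral_comp hV

theorem thr_nonneg {d : ℕ} (hd : 2 ≤ d) {ε₁ : ℝ} (hε₁ : 0 < ε₁) : 0 ≤ thr d ε₁ := by
  have : (2 : ℝ) ≤ d := by exact_mod_cast hd
  exact div_nonneg (Real.log_nonneg (by linarith)) hε₁.le

theorem abs_sub_clamp_le {x v u : ℝ} (h0 : 0 ≤ x) (hu : x ≤ u) :
    |x - max 0 (min u v)| ≤ |x - v| := by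
  rcases le_total u v with h | h
  · rw [min_eq_left h, max_eq_right (h0.trans hu), abs_sub_comm, abs_sub_comm x,
      abs_of_nonneg (by linarith), abs_of_nonneg (by linarith)]
    linarith
  · rw [min_eq_right h]
    rcases le_total 0 v with h' | h'
    · rw [max_eq_right h']
    · rw [max_eq_left h', abs_of_nonneg (by linarith), abs_of_nonneg (by linarith)]; linarith

/-- The error of an estimate is controlled by the Laplace noise and by the error of the
ALP-estimator on truncated entries. -/
theorem abs_sub_estimate_le {d s : ℕ} (H : HashFamily d s) {α ε₁ ε₂ u : ℝ} (hα : 0 < α)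
    (hε₂ : 0 < ε₂) (ht : 0 ≤ thr d ε₁) {x : Fin d → ℝ} {i : Fin d}
    (hx : 0 ≤ x i ∧ x i ≤ u) (η : Fin d → ℝ) (e : Embedding H (levels α (thr d ε₁ * ε₂))) :
    |x i - estimate H α ε₁ ε₂ u (fun i => if thr d ε₁ ≤ x i + η i then x i + η i else 0, e) i|
      ≤ |η i| + α / ε₂ *
        |averageMaximizer H e i - min (x i * ε₂ / α) (thr d ε₁ * ε₂ / α)| := by
  refine (abs_sub_clamp_le hx.1 hx.2).trans ?_
  set A := averageMaximizer H e i with hA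
  have hest : alpEstimate H α ε₂ e i = α / ε₂ * A := by
    rw [hA, averageMaximizer, alpEstimate, alp1Estimate]; ring
  have hpos : 0 ≤ α / ε₂ := by positivity
  have hmin : α / ε₂ * min (x i * ε₂ / α) (thr d ε₁ * ε₂ / α) = min (x i) (thr d ε₁) := by
    rw [mul_min_of_nonneg _ _ hpos]
    congr 1 <;> field_simp
  have hη : -|η i| ≤ η i := neg_abs_le _
  -- The ALP-estimate aims at the truncated entry. If it is used, `x i` exceeds the threshold by at
  -- most `|η i|`.
  have hmain : x i + η i ≤ thr d ε₁ → |x i - α / ε₂ * A|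
      ≤ |η i| + α / ε₂ * |A - min (x i * ε₂ / α) (thr d ε₁ * ε₂ / α)| := by
    intro hle
    have h1 : |x i - min (x i) (thr d ε₁)| ≤ |η i| := by
      rw [abs_of_nonneg (by linarith [min_le_left (x i) (thr d ε₁)])]
      rcases min_cases (x i) (thr d ε₁) with h | h
      · rw [h.1]; simp
      · rw [h.1]; linarith
    have h2 : |min (x i) (thr d ε₁) - α / ε₂ * A|
        = α / ε₂ * |A - min (x i * ε₂ / α) (thr d ε₁ * ε₂ / α)| := by
      rw [← hmin, ← mul_sub, abs_mul, abs_of_nonneg hpos, abs_sub_comm]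
    linarith [abs_sub_le (x i) (min (x i) (thr d ε₁)) (α / ε₂ * A)]
  simp only
  rw [hest]
  by_cases hv : thr d ε₁ ≤ x i + η i
  · rw [if_pos hv]
    -- A value that passes the threshold may be `0`, if the threshold is `0`; the estimator then
    -- treats it as not released.
    by_cases h0 : x i + η i = 0
    · rw [if_neg (not_not.2 h0)]
      exact hmain (by rw [h0]; exact ht)
    · rw [if_pos h0]
      have : x i - (x i + η i) = -η i := by ring
      rw [this, abs_neg]
      exact le_add_of_nonneg_right (mul_nonneg hpos (abs_nonneg _))
  · rw [if_neg hv, if_neg (not_not.2 rfl)]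
    exact hmain (not_le.1 hv).le

/-- Used with `n = d`: the maximum of `d` variables is at most `log d` plus the average of their
exponentials, which replaces a union bound over tails. -/
theorem mul_le_log_add {y n : ℝ} (hn : 0 < n) : y ≤ Real.log n + Real.exp y / n := by
  have h := Real.add_one_le_exp (y - Real.log n)
  rw [Real.exp_sub, Real.exp_log hn] at h
  linarith

theorem lintegral_abs_laplace_pi_le {d : ℕ} {ε₁ : ℝ} (hε₁ : 0 < ε₁) (i : Fin d) :
    ∫⁻ η, ENNReal.ofReal (Real.exp (ε₁ / 2 * |η i|)) ∂(Measure.pi fun _ : Fin d => laplace ε₁)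
      = ENNReal.ofReal 2 := by
  have := isProbabilityMeasure_laplace hε₁
  rw [(measurePreserving_eval (fun _ : Fin d => laplace ε₁) i).lintegral_comp
    (f := fun τ => ENNReal.ofReal (Real.exp (ε₁ / 2 * |τ|))) (by fun_prop),
    lintegral_exp_abs_laplace hε₁ (by linarith)]
  congr 1
  field_simp; norm_num

/-- Expected errors, if the ALP-estimator has exponential moments. -/
theorem lintegral_error_le {d s : ℕ} (hd : 2 ≤ d) (H : HashFamily d s) {α ε₁ ε₂ u θ K : ℝ}
    (hα : 0 < α) (hε₁ : 0 < ε₁) (hε₂ : 0 < ε₂) (hθ : 0 < θ) (hK : 0 ≤ K) {x : Fin d → ℝ}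
    (hx : ∀ i, 0 ≤ x i ∧ x i ≤ u)
    (hmom : ∀ i, ∫⁻ e, ENNReal.ofReal (Real.exp (θ * |averageMaximizer H e i -
      min (x i * ε₂ / α) (thr d ε₁ * ε₂ / α)|)) ∂alp H α (thr d ε₁) ε₂ x ≤ ENNReal.ofReal K) :
    (∀ i, ∫⁻ o, ENNReal.ofReal |x i - estimate H α ε₁ ε₂ u o i| ∂thresholdALP H α ε₁ ε₂ x
      ≤ ENNReal.ofReal (4 / ε₁ + α / ε₂ * (K / θ))) ∧
    ∫⁻ o, ENNReal.ofReal (⨆ i, |x i - estimate H α ε₁ ε₂ u o i|) ∂thresholdALP H α ε₁ ε₂ x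
      ≤ ENNReal.ofReal (2 / ε₁ * (Real.log d + 2) + α / ε₂ * ((Real.log d + K) / θ)) := by
  have := isProbabilityMeasure_laplace hε₁
  have : IsProbabilityMeasure (alp H α (thr d ε₁) ε₂ x) := isProbabilityMeasure_alp1 H hα.le _ _
  have ht := thr_nonneg hd hε₁
  have hd1 : (2 : ℝ) ≤ d := by exact_mod_cast hd
  have hd0 : (0 : ℝ) < d := by linarith
  have hlog : 0 ≤ Real.log d := Real.log_nonneg (by linarith)
  have hpos : 0 ≤ α / ε₂ := by positivity
  set X : Fin d → Embedding H (levels α (thr d ε₁ * ε₂)) → ℝ := fun i e =>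
    |averageMaximizer H e i - min (x i * ε₂ / α) (thr d ε₁ * ε₂ / α)| with hX
  have hmU : ∀ c : ℝ, ∀ i : Fin d, Measurable fun η : Fin d → ℝ =>
      ENNReal.ofReal c * ENNReal.ofReal (Real.exp (ε₁ / 2 * |η i|)) := fun c i => by fun_prop
  constructor
  · intro i
    refine (lintegral_thresholdALP_le H hα hε₁ x
      (U := fun η => ENNReal.ofReal (2 / ε₁) * ENNReal.ofReal (Real.exp (ε₁ / 2 * |η i|)))
      (V := fun e => ENNReal.ofReal (α / ε₂ / θ) * ENNReal.ofReal (Real.exp (θ * X i e)))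
      (hmU _ i) fun η e => ?_).trans ?_
    · rw [← ENNReal.ofReal_mul (by positivity), ← ENNReal.ofReal_mul (by positivity),
        ← ENNReal.ofReal_add (by positivity) (by positivity)]
      refine ENNReal.ofReal_le_ofReal ((abs_sub_estimate_le H hα hε₂ ht (hx i) η e).trans ?_)
      refine add_le_add ?_ ?_
      · have := Real.add_one_le_exp (ε₁ / 2 * |η i|)
        rw [div_mul_eq_mul_div, le_div_iff₀ hε₁]
        linarith
      · rw [show ∀ E, α / ε₂ / θ * E = α / ε₂ * (E / θ) from fun E => by ring]
        refine mul_le_mul_of_nonneg_left ?_ hpos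
        rw [le_div_iff₀ hθ]
        have := Real.add_one_le_exp (θ * X i e)
        simp only [hX] at this ⊢
        linarith
    · rw [lintegral_const_mul _ (by fun_prop), lintegral_const_mul _ (measurable_of_countable _),
        lintegral_abs_laplace_pi_le hε₁, ← ENNReal.ofReal_mul (by positivity)]
      refine (add_le_add le_rfl (mul_le_mul' le_rfl (hmom i))).trans ?_
      rw [← ENNReal.ofReal_mul (by positivity), ← ENNReal.ofReal_add (by positivity) (by positivity)]
      refine ENNReal.ofReal_le_ofReal (le_of_eq ?_)
      ring
  · have : Nonempty (Fin d) := ⟨⟨0, by omega⟩⟩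
    refine (lintegral_thresholdALP_le H hα hε₁ x
      (U := fun η => ENNReal.ofReal (2 / ε₁ * Real.log d) + ∑ i,
        ENNReal.ofReal (2 / ε₁ / d) * ENNReal.ofReal (Real.exp (ε₁ / 2 * |η i|)))
      (V := fun e => ENNReal.ofReal (α / ε₂ * (Real.log d / θ)) + ∑ i,
        ENNReal.ofReal (α / ε₂ / θ / d) * ENNReal.ofReal (Real.exp (θ * X i e)))
      (measurable_const.add (Finset.measurable_fun_sum _ fun i _ => hmU _ i)) fun η e => ?_).trans ?_
    · simp_rw [← ENNReal.ofReal_mul (show 0 ≤ 2 / ε₁ / d by positivity),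
        ← ENNReal.ofReal_mul (show 0 ≤ α / ε₂ / θ / d by positivity)]
      rw [← ENNReal.ofReal_sum_of_nonneg fun i _ => by positivity,
        ← ENNReal.ofReal_sum_of_nonneg fun i _ => by positivity,
        ← ENNReal.ofReal_add (by positivity) (Finset.sum_nonneg fun i _ => by positivity),
        ← ENNReal.ofReal_add (by positivity) (Finset.sum_nonneg fun i _ => by positivity),
        ← ENNReal.ofReal_add (add_nonneg (by positivity) (Finset.sum_nonneg fun i _ => by positivity))
          (add_nonneg (by positivity) (Finset.sum_nonneg fun i _ => by positivity))]
      refine ENNReal.ofReal_le_ofReal (ciSup_le fun i => ?_)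
      refine (abs_sub_estimate_le H hα hε₂ ht (hx i) η e).trans (add_le_add ?_ ?_)
      · calc |η i| = 2 / ε₁ * (ε₁ / 2 * |η i|) := by field_simp
          _ ≤ 2 / ε₁ * (Real.log d + Real.exp (ε₁ / 2 * |η i|) / d) := by
              gcongr; exact mul_le_log_add hd0
          _ = 2 / ε₁ * Real.log d + 2 / ε₁ / d * Real.exp (ε₁ / 2 * |η i|) := by ring
          _ ≤ _ := by
              gcongr
              exact Finset.single_le_sum (f := fun i => 2 / ε₁ / d * Real.exp (ε₁ / 2 * |η i|))
                (fun i _ => by positivity) (Finset.mem_univ i)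
      · calc α / ε₂ * X i e = α / ε₂ / θ * (θ * X i e) := by field_simp
          _ ≤ α / ε₂ / θ * (Real.log d + Real.exp (θ * X i e) / d) := by
              gcongr; exact mul_le_log_add hd0
          _ = α / ε₂ * (Real.log d / θ) + α / ε₂ / θ / d * Real.exp (θ * X i e) := by ring
          _ ≤ _ := by
              gcongr
              exact Finset.single_le_sum (f := fun i => α / ε₂ / θ / d * Real.exp (θ * X i e))
                (fun i _ => by positivity) (Finset.mem_univ i)
    · rw [lintegral_add_left measurable_const, lintegral_add_left measurable_const,
        lintegral_finsetSum _ fun i _ => hmU _ i,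
        lintegral_finsetSum _ fun i _ => measurable_of_countable _, lintegral_const, lintegral_const,
        measure_univ, measure_univ, mul_one, mul_one]
      have h1 : ∀ i : Fin d, ∫⁻ η, ENNReal.ofReal (2 / ε₁ / d) *
          ENNReal.ofReal (Real.exp (ε₁ / 2 * |η i|)) ∂(Measure.pi fun _ : Fin d => laplace ε₁)
          = ENNReal.ofReal (2 / ε₁ / d * 2) := fun i => by
        rw [lintegral_const_mul _ (by fun_prop), lintegral_abs_laplace_pi_le hε₁,
          ← ENNReal.ofReal_mul (by positivity)]
      have h2 : ∀ i : Fin d, ∫⁻ e, ENNReal.ofReal (α / ε₂ / θ / d) *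
          ENNReal.ofReal (Real.exp (θ * X i e)) ∂alp H α (thr d ε₁) ε₂ x
          ≤ ENNReal.ofReal (α / ε₂ / θ / d * K) := fun i => by
        rw [lintegral_const_mul _ (measurable_of_countable _), ENNReal.ofReal_mul (by positivity)]
        exact mul_le_mul' le_rfl (hmom i)
      simp_rw [h1]
      refine (add_le_add le_rfl (add_le_add le_rfl (Finset.sum_le_sum fun i _ => h2 i))).trans ?_
      simp only [Finset.sum_const, Finset.card_univ, Fintype.card_fin, nsmul_eq_mul]
      rw [← ENNReal.ofReal_natCast, ← ENNReal.ofReal_mul hd0.le, ← ENNReal.ofReal_mul hd0.le,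
        ← ENNReal.ofReal_add (by positivity) (by positivity),
        ← ENNReal.ofReal_add (by positivity) (by positivity),
        ← ENNReal.ofReal_add (by positivity) (by positivity)]
      refine ENNReal.ofReal_le_ofReal (le_of_eq ?_)
      field_simp

/-- The expected errors of Threshold ALP. -/
theorem exists_error_constant {α₀ α₁ ρ₀ lam : ℝ} (hα₀ : 0 < α₀) (hρ₀ : 2 < ρ₀) :
    ∃ C : ℝ, 0 ≤ C ∧ ∀ (d k s : ℕ) (u α ε₁ ε₂ : ℝ), 2 ≤ d → 0 < k → α₀ ≤ α → α ≤ α₁ →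
      ρ₀ * k ≤ s → 0 < ε₁ → 0 < ε₂ → ε₁ ≤ lam * ε₂ → ε₂ ≤ lam * ε₁ →
      ∀ H : HashFamily d s, H.Universal →
      ∀ x : Fin d → ℝ, (∀ i, 0 ≤ x i ∧ x i ≤ u) → IsSparse k x →
        (∀ i, ∫⁻ o, ENNReal.ofReal |x i - estimate H α ε₁ ε₂ u o i| ∂thresholdALP H α ε₁ ε₂ x
          ≤ ENNReal.ofReal (C / (ε₁ + ε₂))) ∧
        ∫⁻ o, ENNReal.ofReal (⨆ i, |x i - estimate H α ε₁ ε₂ u o i|) ∂thresholdALP H α ε₁ ε₂ x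
          ≤ ENNReal.ofReal (C * Real.log d / (ε₁ + ε₂)) := by
  obtain ⟨ν, q, θ, hν, hq0, hθ, hθq, hwalk⟩ := exists_walk_constants hα₀ hρ₀
  set K := Real.exp θ * (2 / (1 - Real.exp θ * q)) with hKdef
  have hK : 0 ≤ K := by
    have : 0 < 1 - Real.exp θ * q := by linarith
    positivity
  -- The inequality `1 ≤ 2 log d` absorbs additive constants: `2 (log d + 2) ≤ 10 log d` and `log d
  -- + K ≤ (1 + 2K) log d`. The factors `1 + |lam|` come from replacing `1/ε₁` and `1/ε₂` by
  -- multiples of `1/(ε₁ + ε₂)`.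
  set C := 10 * (1 + |lam|) + |α₁| * (1 + |lam|) * ((1 + 2 * K) / θ) with hC
  refine ⟨C, by positivity, ?_⟩
  intro d k s u α ε₁ ε₂ hd hk hαl hαu hks hε₁ hε₂ hl₁ hl₂ H hH x hx hxk
  have hα : 0 < α := hα₀.trans_le hαl
  have hk' : (1 : ℝ) ≤ k := by exact_mod_cast hk
  have hs' : (0 : ℝ) < s := by nlinarith
  have hs : 0 < s := by exact_mod_cast hs'
  have hγ : (k : ℝ) / s ≤ 1 / ρ₀ := by
    rw [div_le_div_iff₀ hs' (by linarith)]; linarith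
  have ht := thr_nonneg hd hε₁
  obtain ⟨h1, h2⟩ := lintegral_error_le hd H hα hε₁ hε₂ hθ hK hx fun i =>
    lintegral_exp_alp1_error_le hH hs hα hν (by positivity) hγ (hwalk α hαl) hq0 hθ hθq
      (mul_nonneg ht hε₂.le) (x := fun i => x i * ε₂) (fun i => mul_nonneg (hx i).1 hε₂.le)
      (by unfold IsSparse at hxk ⊢; simpa [hε₂.ne'] using hxk) i
  have hd1 : (2 : ℝ) ≤ d := by exact_mod_cast hd
  have hlog : 1 ≤ 2 * Real.log d := by
    have h := Real.log_two_gt_d9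
    have := Real.log_le_log two_pos hd1
    linarith
  have hlam := le_abs_self lam
  have hε : 0 < ε₁ + ε₂ := by linarith
  have e1 : 1 / ε₁ ≤ (1 + |lam|) / (ε₁ + ε₂) := by
    rw [div_le_div_iff₀ hε₁ hε]; nlinarith
  have e2 : 1 / ε₂ ≤ (1 + |lam|) / (ε₁ + ε₂) := by
    rw [div_le_div_iff₀ hε₂ hε]; nlinarith
  have hαa : α ≤ |α₁| := hαu.trans (le_abs_self _)
  have key : ∀ a b : ℝ, 0 ≤ a → 0 ≤ b → a / ε₁ + α / ε₂ * (b / θ)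
      ≤ (a * (1 + |lam|) + |α₁| * (1 + |lam|) * (b / θ)) / (ε₁ + ε₂) := fun a b ha hb => by
    have g1 : a / ε₁ ≤ a * ((1 + |lam|) / (ε₁ + ε₂)) := by
      rw [div_eq_mul_one_div]; gcongr
    have g2 : α / ε₂ * (b / θ) ≤ |α₁| * ((1 + |lam|) / (ε₁ + ε₂)) * (b / θ) := by
      rw [div_eq_mul_one_div α]; gcongr
    calc _ ≤ _ := add_le_add g1 g2
      _ = _ := by ring
  refine ⟨fun i => (h1 i).trans (ENNReal.ofReal_le_ofReal ((key 4 K (by norm_num) hK).trans ?_)),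
    h2.trans (ENNReal.ofReal_le_ofReal ?_)⟩
  · rw [hC]
    gcongr
    · norm_num
    · linarith
  · have h3 := key (2 * (Real.log d + 2)) (Real.log d + K) (by linarith) (by linarith)
    rw [← div_mul_eq_mul_div] at h3
    refine h3.trans ?_
    rw [hC, add_mul]
    gcongr ?_ / _
    refine add_le_add ?_ ?_
    · have : 0 ≤ 1 + |lam| := by positivity
      nlinarith
    · rw [mul_assoc (|α₁| * (1 + |lam|)), div_mul_eq_mul_div]
      gcongr
      nlinarith

/-! ### The number of released entries -/

/-- The reason for the choice of the threshold: by `laplace_Ici`, the noise reaches it with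
probability exactly `1/d`. -/
theorem exp_neg_mul_thr {d : ℕ} (hd : 2 ≤ d) {ε₁ : ℝ} (hε₁ : 0 < ε₁) :
    Real.exp (-(ε₁ * thr d ε₁)) / 2 = 1 / d := by
  have : (2 : ℝ) ≤ d := by exact_mod_cast hd
  rw [thr, mul_div_cancel₀ _ hε₁.ne', Real.exp_neg, Real.exp_log (by linarith)]
  field_simp

/-- The integral is `1 + (e-1)/d`, and `e - 1 ≤ 2`. -/
theorem lintegral_exp_exceed {d : ℕ} (hd : 2 ≤ d) {ε₁ : ℝ} (hε₁ : 0 < ε₁) :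
    ∫⁻ τ, ENNReal.ofReal (Real.exp (if thr d ε₁ ≤ τ then 1 else 0)) ∂laplace ε₁
      ≤ ENNReal.ofReal (Real.exp (2 / d)) := by
  have := isProbabilityMeasure_laplace hε₁
  have h : ∀ τ : ℝ, ENNReal.ofReal (Real.exp (if thr d ε₁ ≤ τ then 1 else 0))
      ≤ 1 + ENNReal.ofReal 2 * (Set.Ici (thr d ε₁)).indicator 1 τ := fun τ => by
    by_cases hτ : thr d ε₁ ≤ τ
    · rw [if_pos hτ, Set.indicator_of_mem (Set.mem_Ici.2 hτ), Pi.one_apply, mul_one,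
        ← ENNReal.ofReal_one, ← ENNReal.ofReal_add (by norm_num) (by norm_num)]
      refine ENNReal.ofReal_le_ofReal ?_
      have := Real.exp_one_lt_d9
      linarith
    · rw [if_neg hτ]; simp
  refine (lintegral_mono h).trans ?_
  rw [lintegral_add_left measurable_const, lintegral_const_mul _
    (measurable_one.indicator measurableSet_Ici), lintegral_indicator_one measurableSet_Ici,
    laplace_Ici hε₁ (thr_nonneg hd hε₁), exp_neg_mul_thr hd hε₁, lintegral_const, measure_univ,
    mul_one, ← ENNReal.ofReal_mul (by norm_num), ← ENNReal.ofReal_one,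
    ← ENNReal.ofReal_add (by norm_num) (by positivity)]
  refine ENNReal.ofReal_le_ofReal ?_
  have := Real.add_one_le_exp (2 / (d : ℝ))
  rw [mul_one_div]; linarith

/-- The number of non-zero entries. -/
noncomputable def supportCard {d : ℕ} (v : Fin d → ℝ) : ℕ :=
  (Finset.univ.filter fun i => v i ≠ 0).card

theorem measurable_supportCard {d : ℕ} : Measurable (supportCard (d := d)) := by
  have : supportCard (d := d) = fun v => ∑ i, if v i ≠ 0 then 1 else 0 := by
    funext v; rw [supportCard, Finset.card_filter]
  rw [this]
  refine Finset.measurable_fun_sum _ fun i _ => Measurable.ite ?_ measurable_const measurable_const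
  exact measurableSet_preimage (measurable_pi_apply (X := fun _ : Fin d => ℝ) i)
    (measurableSet_singleton (0 : ℝ)).compl

/-- With high probability, few entries are released in addition to those of the input. -/
theorem thresholdALP_supportCard_le {d s k : ℕ} (hd : 2 ≤ d) (H : HashFamily d s)
    {α ε₁ ε₂ : ℝ} (hα : 0 < α) (hε₁ : 0 < ε₁) {x : Fin d → ℝ} (hxk : IsSparse k x) (R : ℝ) :
    thresholdALP H α ε₁ ε₂ x {o | k + R < supportCard o.1}
      ≤ ENNReal.ofReal (Real.exp (2 - R)) := by
  have := isProbabilityMeasure_laplace hε₁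
  have hm : MeasurableSet {o : Output H α ε₁ ε₂ | k + R < supportCard o.1} :=
    measurableSet_lt measurable_const
      ((measurable_from_nat (f := fun n : ℕ => (n : ℝ))).comp
        (measurable_supportCard.comp measurable_fst))
  have hmi : ∀ i : Fin d, Measurable fun τ : ℝ =>
      ENNReal.ofReal (Real.exp (if thr d ε₁ ≤ τ then 1 else 0)) := fun i =>
    (Real.measurable_exp.comp
      (Measurable.ite measurableSet_Ici measurable_const measurable_const)).ennreal_ofReal
  rw [← lintegral_indicator_one hm]
  -- Chernoff's bound with parameter `1`: the `d` factors `exp (2/d)` multiply to `exp 2`. An entry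
  -- outside the support of `x` is released only if its noise exceeds the threshold.
  refine (lintegral_thresholdALP_le H hα hε₁ x
    (U := fun η => ENNReal.ofReal (Real.exp (-R)) *
      ∏ i, ENNReal.ofReal (Real.exp (if thr d ε₁ ≤ η i then 1 else 0)))
    (V := fun _ => 0) (measurable_const.mul (Finset.measurable_fun_prod _ fun i _ =>
      (hmi i).comp (measurable_pi_apply i))) fun η e => ?_).trans ?_
  · rw [add_zero, ← ENNReal.ofReal_prod_of_nonneg fun i _ => (Real.exp_pos _).le,
      ← ENNReal.ofReal_mul (Real.exp_pos _).le, ← Real.exp_sum, ← Real.exp_add]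
    refine Set.indicator_apply_le' (fun ho => ?_) fun _ => zero_le
    rw [Pi.one_apply, ← ENNReal.ofReal_one]
    refine ENNReal.ofReal_le_ofReal (Real.one_le_exp ?_)
    have hle : supportCard (fun i => if thr d ε₁ ≤ x i + η i then x i + η i else 0)
        ≤ k + (Finset.univ.filter fun i => thr d ε₁ ≤ η i).card := by
      refine le_trans (Finset.card_le_card fun i hi => ?_)
        ((Finset.card_union_le (Finset.univ.filter fun i => x i ≠ 0) _).trans
          (Nat.add_le_add_right hxk _))
      simp only [Finset.mem_filter, Finset.mem_univ, true_and, Finset.mem_union] at hi ⊢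
      by_contra hcon
      push Not at hcon
      rw [hcon.1, zero_add, if_neg (not_le.2 hcon.2)] at hi
      exact hi rfl
    have ho' : (k : ℝ) + R
        < supportCard (fun i => if thr d ε₁ ≤ x i + η i then x i + η i else 0) := ho
    have hle' : (supportCard (fun i => if thr d ε₁ ≤ x i + η i then x i + η i else 0) : ℝ)
        ≤ k + (Finset.univ.filter fun i => thr d ε₁ ≤ η i).card := by exact_mod_cast hle
    rw [← Finset.sum_filter, Finset.sum_const, nsmul_eq_mul, mul_one]
    linarith
  · have hmp : Measurable fun η : Fin d → ℝ =>
        ∏ i, ENNReal.ofReal (Real.exp (if thr d ε₁ ≤ η i then 1 else 0)) :=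
      Finset.measurable_fun_prod _ fun i _ => (hmi i).comp (measurable_pi_apply i)
    rw [lintegral_const_mul _ hmp, lintegral_pi_prod hmi, lintegral_const, zero_mul,
      add_zero]
    refine (mul_le_mul' le_rfl (Finset.prod_le_prod' fun i _ => lintegral_exp_exceed hd hε₁)).trans ?_
    rw [Finset.prod_const, Finset.card_univ, Fintype.card_fin,
      ← ENNReal.ofReal_pow (Real.exp_pos _).le, ← Real.exp_nat_mul,
      ← ENNReal.ofReal_mul (Real.exp_pos _).le, ← Real.exp_add]
    refine ENNReal.ofReal_le_ofReal (Real.exp_le_exp.2 (le_of_eq ?_))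
    have : (0 : ℝ) < d := by exact_mod_cast (by omega : 0 < d)
    field_simp; ring

/-! ### An affine universal hash family -/

/-- The hash functions `i ↦ ((a i + b) mod p) mod s` with `0 < a < p` and `0 ≤ b < p`. -/
def affineHash (d : ℕ) {s p : ℕ} (hs : 0 < s) (hp : p.Prime) : HashFamily d s where
  Seed := Fin (p - 1) × Fin p
  nonemptySeed := ⟨(⟨0, Nat.sub_pos_of_lt hp.one_lt⟩, ⟨0, hp.pos⟩)⟩
  eval τ i := ⟨((τ.1 + 1) * i + τ.2) % p % s, Nat.mod_lt _ hs⟩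

/-- The numbers below `p` in the residue class of `r` are determined by their quotients by `s`,
which are at most `(p - 1) / s`; removing `r` itself saves the extra one. -/
theorem card_ne_modEq_le {p s r : ℕ} (hr : r < p) :
    ((Finset.range p).filter fun t => t ≠ r ∧ t % s = r % s).card ≤ (p - 1) / s := by
  set T := (Finset.range p).filter fun t => t % s = r % s with hT
  have h1 : ((Finset.range p).filter fun t => t ≠ r ∧ t % s = r % s) = T.erase r := by
    ext t; simp only [hT, Finset.mem_filter, Finset.mem_range, Finset.mem_erase]; tauto
  have hrT : r ∈ T := by simp [hT, hr]
  have h2 : T.card ≤ (Finset.range ((p - 1) / s + 1)).card := by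
    refine Finset.card_le_card_of_injOn (fun t => t / s) (fun t ht => ?_) fun a ha b hb hab => ?_
    · simp only [hT, Finset.coe_filter, Finset.mem_range, Set.mem_ofPred_eq] at ht
      simp only [Finset.coe_range, Set.mem_Iio, Nat.lt_succ_iff]
      exact Nat.div_le_div_right (by omega)
    · simp only [hT, Finset.coe_filter, Finset.mem_range, Set.mem_ofPred_eq] at ha hb
      have hab : a / s = b / s := hab
      rw [← Nat.div_add_mod a s, ← Nat.div_add_mod b s, hab, ha.2, hb.2]
  rw [h1, Finset.card_erase_of_mem hrT]
  rw [Finset.card_range] at h2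
  exact Nat.sub_le_of_le_add h2

/-- For distinct keys, seeds map injectively to pairs of distinct residues mod `p`. A collision
means that the two residues agree mod `s`, and there are at most `p ⌊(p-1)/s⌋` such pairs among `p
(p-1)` seeds. -/
theorem affineHash_universal (d : ℕ) {s p : ℕ} (hs : 0 < s) (hp : p.Prime) (hdp : d ≤ p) :
    (affineHash d hs hp).Universal := by
  intro i j hij
  have : Fact p.Prime := ⟨hp⟩
  set P := ((Finset.range p) ×ˢ (Finset.range p)).filter
    fun q => q.2 ≠ q.1 ∧ q.2 % s = q.1 % s with hP
  have hcast : ∀ k : Fin d, ∀ τ : Fin (p - 1) × Fin p,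
      ((((τ.1 + 1) * k + τ.2) % p : ℕ) : ZMod p) = ((τ.1 : ℕ) + 1) * (k : ℕ) + (τ.2 : ℕ) :=
    fun k τ => by rw [ZMod.natCast_mod]; push_cast; ring
  have hinj : ∀ a b : ℕ, a < p → b < p → (a : ZMod p) = b → a = b := fun a b ha hb h => by
    have := (ZMod.natCast_eq_natCast_iff' a b p).1 h
    rwa [Nat.mod_eq_of_lt ha, Nat.mod_eq_of_lt hb] at this
  have hij' : ((i : ℕ) : ZMod p) - (j : ℕ) ≠ 0 := fun h => by
    have := hinj i j (by omega) (by omega) (sub_eq_zero.1 h)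
    exact hij (Fin.ext this)
  have ha0 : ∀ a : Fin (p - 1), ((a : ℕ) : ZMod p) + 1 ≠ 0 := fun a h => by
    have h' : ((a + 1 : ℕ) : ZMod p) = (0 : ℕ) := by push_cast; exact h
    have := hinj (a + 1) 0 (by omega) hp.pos h'
    omega
  have h1 : (Finset.univ.filter fun σ : (affineHash d hs hp).Seed =>
      (affineHash d hs hp).eval σ i = (affineHash d hs hp).eval σ j).card ≤ P.card := by
    refine Finset.card_le_card_of_injOn (fun τ : Fin (p - 1) × Fin p =>
      (((τ.1 + 1) * i + τ.2) % p, ((τ.1 + 1) * j + τ.2) % p)) (fun τ hτ => ?_) ?_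
    · simp only [Finset.coe_filter, Finset.mem_univ, true_and, Set.mem_ofPred_eq] at hτ
      have hτ := Fin.val_eq_of_eq hτ
      simp only [hP, Finset.coe_filter, Finset.mem_product, Finset.mem_range, Set.mem_ofPred_eq]
      refine ⟨⟨Nat.mod_lt _ hp.pos, Nat.mod_lt _ hp.pos⟩, fun h => ?_, hτ.symm⟩
      have h2 := ((hcast j τ).symm.trans (congrArg (Nat.cast : ℕ → ZMod p) h)).trans (hcast i τ)
      have h3 : (((τ.1 : ℕ) : ZMod p) + 1) * ((i : ℕ) - (j : ℕ)) = 0 := by linear_combination -h2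
      rcases mul_eq_zero.1 h3 with h | h
      · exact ha0 _ h
      · exact hij' h
    · intro (τ : Fin (p - 1) × Fin p) _ (τ' : Fin (p - 1) × Fin p) _ h
      have e1 := ((hcast i τ).symm.trans
        (congrArg (Nat.cast : ℕ → ZMod p) (Prod.ext_iff.1 h).1)).trans (hcast i τ')
      have e2 := ((hcast j τ).symm.trans
        (congrArg (Nat.cast : ℕ → ZMod p) (Prod.ext_iff.1 h).2)).trans (hcast j τ')
      have h3 : (((τ.1 : ℕ) : ZMod p) - (τ'.1 : ℕ)) * ((i : ℕ) - (j : ℕ)) = 0 := by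
        linear_combination e1 - e2
      have h4 : ((τ.1 : ℕ) : ZMod p) = (τ'.1 : ℕ) := by
        rcases mul_eq_zero.1 h3 with h | h
        · exact sub_eq_zero.1 h
        · exact absurd h hij'
      have h5 : ((τ.2 : ℕ) : ZMod p) = (τ'.2 : ℕ) := by
        rw [h4] at e1; linear_combination e1
      exact Prod.ext (Fin.ext (hinj _ _ (by omega) (by omega) h4))
        (Fin.ext (hinj _ _ τ.2.2 τ'.2.2 h5))
  have h2 : P.card ≤ p * ((p - 1) / s) := by
    rw [hP, Finset.card_filter, Finset.sum_product]
    calc _ ≤ ∑ _r ∈ Finset.range p, (p - 1) / s := by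
          refine Finset.sum_le_sum fun r hr => ?_
          rw [← Finset.card_filter]
          exact card_ne_modEq_le (Finset.mem_range.1 hr)
      _ = _ := by simp
  have hcard : Fintype.card (affineHash d hs hp).Seed = (p - 1) * p := by
    change Fintype.card (Fin (p - 1) × Fin p) = _
    simp
  rw [hcard]
  calc _ ≤ s * (p * ((p - 1) / s)) := Nat.mul_le_mul_left _ (h1.trans h2)
    _ = p * (s * ((p - 1) / s)) := by ring
    _ ≤ p * (p - 1) := Nat.mul_le_mul_left _ (Nat.mul_div_le _ _)
    _ = _ := mul_comm _ _

/-! ### Symbolic execution -/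

/-- The result of a program is determined by the memory and the initial registers. -/
theorem Exec.deterministic {w : ℕ} {M : Memory w} {p : Prog} {R R₁ R₂ : ℕ → BitVec w} {t₁ t₂ : ℕ}
    (h₁ : Exec M p R R₁ t₁) (h₂ : Exec M p R R₂ t₂) : R₁ = R₂ := by
  induction h₁ generalizing R₂ t₂ with
  | skip | const | op | load => cases h₂; rfl
  | seq _ _ ih₁ ih₂ =>
    cases h₂ with
    | seq h h' => cases ih₁ h; exact ih₂ h'
  | ite_true hr _ ih =>
    cases h₂ with
    | ite_true _ h => exact ih h
    | ite_false h => exact absurd h hr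
  | ite_false hr _ ih =>
    cases h₂ with
    | ite_true h => exact absurd hr h
    | ite_false _ h => exact ih h
  | loop_true hr _ _ ih₁ ih₂ =>
    cases h₂ with
    | loop_true _ h h' => cases ih₁ h; exact ih₂ h'
    | loop_false h => exact absurd h hr
  | loop_false hr =>
    cases h₂ with
    | loop_true h => exact absurd hr h
    | loop_false => rfl

/-- Makes the answer a function of the memory alone, as needed for an estimator that sees only the
encoding. -/
theorem Answers.unique {w : ℕ} {p : Prog} {M : Memory w} {i : ℕ} {T T' v v' : ℝ}
    (h : Answers p M i T v) (h' : Answers p M i T' v') : v = v' := by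
  obtain ⟨R, t, he, _, rfl⟩ := h
  obtain ⟨R', t', he', _, rfl⟩ := h'
  rw [he.deterministic he']

/-- `Regs L R`: the registers have the values that are listed in `L`; of several entries for the
same register, the first one counts. -/
def Regs {w : ℕ} (L : List (ℕ × ℕ)) (R : ℕ → BitVec w) : Prop :=
  ∀ r v, L.lookup r = some v → (R r).toNat = v

/-- `Steps M p L T L'`: from registers described by `L`, the program `p` halts within `T` steps
with registers described by `L'`. -/
def Steps {w : ℕ} (M : Memory w) (p : Prog) (L : List (ℕ × ℕ)) (T : ℕ) (L' : List (ℕ × ℕ)) : Prop :=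
  ∀ R : ℕ → BitVec w, Regs L R → ∃ R' t, Exec M p R R' t ∧ t ≤ T ∧ Regs L' R'

theorem Regs.update {w : ℕ} {L : List (ℕ × ℕ)} {R : ℕ → BitVec w} (h : Regs L R) (r : ℕ)
    {x : BitVec w} {n : ℕ} (hx : x.toNat = n) : Regs ((r, n) :: L) (Function.update R r x) := by
  intro r' v hv
  rw [List.lookup_cons] at hv
  by_cases hr : r' = r
  · subst hr
    simp at hv
    rw [Function.update_self, hx, hv]
  · have : (r' == r) = false := by simpa using hr
    rw [this] at hv
    rw [Function.update_of_ne hr]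
    exact h _ _ hv

namespace Steps

variable {w : ℕ} {M : Memory w} {p q : Prog} {L L' L'' : List (ℕ × ℕ)} {T T' r a b x y z n : ℕ}

theorem mono (h : Steps M p L T L') (hT : T ≤ T') : Steps M p L T' L' := fun R hR => by
  obtain ⟨R', t, he, ht, hR'⟩ := h R hR
  exact ⟨R', t, he, ht.trans hT, hR'⟩

theorem seq (hp : Steps M p L T L') (hq : Steps M q L' T' L'') :
    Steps M (.seq p q) L (T + T') L'' := fun R hR => by
  obtain ⟨R₁, t₁, he₁, ht₁, hR₁⟩ := hp R hR
  obtain ⟨R₂, t₂, he₂, ht₂, hR₂⟩ := hq R₁ hR₁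
  exact ⟨R₂, _, .seq he₁ he₂, add_le_add ht₁ ht₂, hR₂⟩

theorem step (hp : Steps M p L 1 L') (hq : Steps M q L' T L'') :
    Steps M (.seq p q) L (T + 1) L'' := (hp.seq hq).mono (by omega)

/-- Symbolic execution only prepends entries; at the end of a block this discards shadowed and
irrelevant ones. -/
theorem done (h : ∀ e ∈ L', L.lookup e.1 = some e.2) : Steps M .skip L 1 L' := fun R hR =>
  ⟨R, 1, .skip R, le_rfl, fun r v hv => hR _ _ (h (r, v) (by
    have := List.lookup_eq_some_iff.1 hv
    obtain ⟨l₁, l₂, rfl, -⟩ := this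
    simp))⟩

theorem const (hn : n < 2 ^ w) : Steps M (.const r n) L 1 ((r, n) :: L) := fun R hR =>
  ⟨_, 1, .const r n R, le_rfl, hR.update r (by simp [Nat.mod_eq_of_lt hn])⟩

theorem load (ha : L.lookup a = some x) (hz : (M.words.getD x 0#w).toNat = z) :
    Steps M (.load r a) L 1 ((r, z) :: L) := fun R hR =>
  ⟨_, 1, .load r a R, le_rfl, hR.update r (by rw [hR _ _ ha, hz])⟩

theorem op {o : BinOp} (ha : L.lookup a = some x) (hb : L.lookup b = some y)
    (h : ∀ u v : BitVec w, u.toNat = x → v.toNat = y → (o.eval u v).toNat = z) :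
    Steps M (.op o r a b) L 1 ((r, z) :: L) := fun R hR =>
  ⟨_, 1, .op o r a b R, le_rfl, hR.update r (h _ _ (hR _ _ ha) (hR _ _ hb))⟩

theorem add (ha : L.lookup a = some x) (hb : L.lookup b = some y) (h : x + y < 2 ^ w) :
    Steps M (.op .add r a b) L 1 ((r, x + y) :: L) :=
  op ha hb fun u v hu hv => by simp [BinOp.eval, hu, hv, Nat.mod_eq_of_lt h]

theorem sub (ha : L.lookup a = some x) (hb : L.lookup b = some y) (h : y ≤ x) :
    Steps M (.op .sub r a b) L 1 ((r, x - y) :: L) :=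
  op ha hb fun u v hu hv => by
    simp only [BinOp.eval]
    rw [BitVec.toNat_sub_of_le (by rw [BitVec.le_def, hu, hv]; exact h), hu, hv]

theorem mul (ha : L.lookup a = some x) (hb : L.lookup b = some y) (h : x * y < 2 ^ w) :
    Steps M (.op .mul r a b) L 1 ((r, x * y) :: L) :=
  op ha hb fun u v hu hv => by simp [BinOp.eval, hu, hv, Nat.mod_eq_of_lt h]

theorem div (ha : L.lookup a = some x) (hb : L.lookup b = some y) :
    Steps M (.op .div r a b) L 1 ((r, x / y) :: L) :=
  op ha hb fun u v hu hv => by simp [BinOp.eval, hu, hv]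

theorem mod (ha : L.lookup a = some x) (hb : L.lookup b = some y) :
    Steps M (.op .mod r a b) L 1 ((r, x % y) :: L) :=
  op ha hb fun u v hu hv => by simp [BinOp.eval, hu, hv]

theorem and (ha : L.lookup a = some x) (hb : L.lookup b = some y) :
    Steps M (.op .and r a b) L 1 ((r, x &&& y) :: L) :=
  op ha hb fun u v hu hv => by simp [BinOp.eval, hu, hv]

/-- Copying a register. -/
theorem copy (ha : L.lookup a = some x) : Steps M (.op .or r a a) L 1 ((r, x) :: L) :=
  op ha ha fun u v hu hv => by simp [BinOp.eval, hu, hv]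

theorem shl (ha : L.lookup a = some x) (hb : L.lookup b = some y) :
    Steps M (.op .shl r a b) L 1 ((r, x * 2 ^ y % 2 ^ w) :: L) :=
  op ha hb fun u v hu hv => by simp [BinOp.eval, hu, hv, Nat.shiftLeft_eq]

theorem shr (ha : L.lookup a = some x) (hb : L.lookup b = some y) :
    Steps M (.op .shr r a b) L 1 ((r, x / 2 ^ y) :: L) :=
  op ha hb fun u v hu hv => by simp [BinOp.eval, hu, hv, Nat.shiftRight_eq_div_pow]

theorem lt (hw : 0 < w) (ha : L.lookup a = some x) (hb : L.lookup b = some y) :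
    Steps M (.op .lt r a b) L 1 ((r, if x < y then 1 else 0) :: L) :=
  op ha hb fun u v hu hv => by
    simp only [BinOp.eval, hu, hv]
    split_ifs <;> simp [hw]

theorem eq (hw : 0 < w) (ha : L.lookup a = some x) (hb : L.lookup b = some y) :
    Steps M (.op .eq r a b) L 1 ((r, if x = y then 1 else 0) :: L) :=
  op ha hb fun u v hu hv => by
    simp only [BinOp.eval, ← BitVec.toNat_inj, hu, hv]
    split_ifs <;> simp [hw]

theorem ite (hr : L.lookup r = some x) (hp : x ≠ 0 → Steps M p L T L')
    (hq : x = 0 → Steps M q L T L') : Steps M (.ite r p q) L (T + 1) L' := fun R hR => by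
  have hx := hR _ _ hr
  by_cases h : x = 0
  · obtain ⟨R', t, he, ht, hR'⟩ := hq h R hR
    exact ⟨R', _, .ite_false (by rw [← BitVec.toNat_inj, hx, h]; simp) he,
      Nat.add_le_add_right ht 1, hR'⟩
  · obtain ⟨R', t, he, ht, hR'⟩ := hp h R hR
    exact ⟨R', _, .ite_true (by rw [ne_eq, ← BitVec.toNat_inj, hx]; simpa using h) he,
      Nat.add_le_add_right ht 1, hR'⟩

theorem loop_step (hr : L.lookup r = some x) (hx : x ≠ 0) (hp : Steps M p L T L')
    (hq : Steps M (.loop r p) L' T' L'') : Steps M (.loop r p) L (T + T' + 1) L'' := fun R hR => by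
  have hx' := hR _ _ hr
  obtain ⟨R₁, t₁, he₁, ht₁, hR₁⟩ := hp R hR
  obtain ⟨R₂, t₂, he₂, ht₂, hR₂⟩ := hq R₁ hR₁
  exact ⟨R₂, _, .loop_true (by rw [ne_eq, ← BitVec.toNat_inj, hx']; simpa using hx) he₁ he₂,
    by omega, hR₂⟩

theorem loop_done (hr : L.lookup r = some 0) : Steps M (.loop r p) L 1 L := fun R hR =>
  ⟨R, 1, .loop_false (by rw [← BitVec.toNat_inj, hR _ _ hr]; simp), le_rfl, hR⟩

/-- A loop that counts down from `m`. -/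
theorem loop_count {m : ℕ} (I : ℕ → List (ℕ × ℕ)) (hr : ∀ j ≤ m, (I j).lookup r = some (m - j))
    (hp : ∀ j < m, Steps M p (I j) T (I (j + 1))) :
    Steps M (.loop r p) (I 0) (m * (T + 1) + 1) (I m) := by
  have key : ∀ n j, j + n = m → Steps M (.loop r p) (I j) (n * (T + 1) + 1) (I m) := by
    intro n
    induction n with
    | zero =>
      intro j hj
      obtain rfl : j = m := by omega
      have := hr j le_rfl
      rw [Nat.sub_self] at this
      simpa using loop_done this
    | succ n ih =>
      intro j hj
      refine (loop_step (hr j (by omega)) (by omega) (hp j (by omega)) (ih (j + 1) (by omega))).mono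
        (le_of_eq (by ring))
  exact key m 0 (by omega)

end Steps

/-! ### The query program -/

/-- Execution of a list of instructions. -/
def block (l : List Prog) : Prog := l.foldr .seq .skip

/-- The header of the encoding goes to registers `2, …, 11`, except for the number of columns,
which initializes the walk. -/
def initProg : Prog := block
  [.const 12 1, .const 13 0, .const 16 0, .const 17 1, .const 19 10,
   .load 2 13, .load 3 12, .const 1 2, .load 4 1, .const 1 3, .load 5 1, .const 1 4, .load 6 1,
   .const 1 5, .load 7 1, .const 1 6, .load 8 1, .const 1 7, .load 9 1, .const 1 8, .load 10 1,
   .const 1 9, .load 11 1, .op .or 14 4 4, .op .or 15 4 4, .op .or 18 4 4]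

/-- One column: evaluate the hash function, read the bit, and update the partial sum, the maximum,
and the sum and the number of the maximizers. -/
def columnProg : Prog := block
  [.load 20 10, .op .add 10 10 12, .load 21 10, .op .add 10 10 12,
   .op .mul 20 20 0, .op .add 20 20 21, .op .mod 20 20 2, .op .mod 20 20 3,
   .op .add 20 20 19, .load 20 20, .op .shr 20 20 13, .op .and 20 20 12,
   .op .add 20 20 20, .op .add 14 14 20, .op .sub 14 14 12, .op .add 13 13 12, .op .sub 18 18 12,
   .op .lt 20 15 14, .op .eq 21 15 14,
   .ite 20 (block [.op .or 15 14 14, .op .or 16 13 13, .op .or 17 12 12])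
     (.ite 21 (block [.op .add 16 16 13, .op .add 17 17 12]) (block []))]

/-- The clamped ALP-estimate, and the preparation of the binary search. -/
def averageProg : Prog := block
  [.op .mul 16 16 5, .op .div 16 16 17, .op .lt 20 6 16,
   .ite 20 (block [.op .or 16 6 6]) (block []), .const 13 0, .op .add 14 0 12]

/-- One step of binary search for the key in register `14` among the entries at `11`. -/
def searchProg : Prog := block
  [.op .shr 20 9 12, .op .add 21 13 20, .op .add 22 21 21, .op .add 22 22 11, .load 22 22,
   .op .lt 22 22 14,
   .ite 22 (block [.op .add 13 21 12, .op .sub 9 9 20, .op .sub 9 9 12]) (block [.op .or 9 20 20])]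

/-- If the key was found, take its value; then split into integer and fractional part. -/
def finishProg : Prog := block
  [.op .add 22 13 13, .op .add 22 22 11, .load 23 22, .op .eq 23 23 14,
   .ite 23 (block [.op .add 22 22 12, .load 16 22]) (block []), .op .shr 0 16 7, .op .shl 1 16 8]

/-- The program for queries. -/
def queryProg : Prog := block [initProg, .loop 18 columnProg, averageProg, .loop 9 searchProg, finishProg]

/-- The walk as computed by the program: the current partial sum, the maximal one (both increased
by `m`), and the sum and the number of the maximizers. -/
def walk (m : ℕ) (bit : ℕ → Bool) : ℕ → ℕ × ℕ × ℕ × ℕ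
  | 0 => (m, m, 0, 1)
  | j + 1 =>
    let s := walk m bit j
    let c := s.1 + 2 * (bit j).toNat - 1
    if s.2.1 < c then (c, c, j + 1, 1)
    else if s.2.1 = c then (c, s.2.1, s.2.2.1 + (j + 1), s.2.2.2 + 1)
    else (c, s.2.1, s.2.2.1, s.2.2.2)

/-- Excludes overflow, and also underflow: thanks to the offset `m`, the natural subtraction in
`walk` is exact during the first `m` columns. -/
theorem walk_bounds (m : ℕ) (bit : ℕ → Bool) (j : ℕ) :
    m ≤ (walk m bit j).1 + j ∧ (walk m bit j).1 ≤ m + j ∧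
      (walk m bit j).2.2.1 ≤ j * (j + 1) ∧ (walk m bit j).2.2.2 ≤ j + 1 := by
  induction j with
  | zero => simp [walk]
  | succ j ih =>
    obtain ⟨h1, h2, h3, h4⟩ := ih
    have hb : (bit j).toNat ≤ 1 := Bool.toNat_le _
    have e : (j + 1) * (j + 1 + 1) = j * (j + 1) + 2 * (j + 1) := by ring
    simp only [walk]
    generalize j * (j + 1) = z at *
    split_ifs <;> refine ⟨?_, ?_, ?_, ?_⟩ <;> simp only <;> omega

/-- What the query program assumes about the memory, in terms of the parameters stored in the
header, of the hash functions `σ b = (a, a')`, of the bits read in the columns, and of the rank `r`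
of the key. -/
structure Stored {w : ℕ} (M : Memory w) (i p s m Q U F G N sb eb r : ℕ) (a a' : ℕ → ℕ)
    (bit : ℕ → Bool) (mem : ℕ → ℕ) : Prop where
  getD : ∀ x, (M.words.getD x 0#w).toNat = mem x
  mem0 : mem 0 = p
  mem1 : mem 1 = s
  mem2 : mem 2 = m
  mem3 : mem 3 = Q
  mem4 : mem 4 = U
  mem5 : mem 5 = F
  mem6 : mem 6 = G
  mem7 : mem 7 = N
  mem8 : mem 8 = sb
  mem9 : mem 9 = eb
  seed : ∀ j < m, mem (sb + 2 * j) = a j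
  seed' : ∀ j < m, mem (sb + 2 * j + 1) = a' j
  bit_eq : ∀ j < m, (mem ((a j * i + a' j) % p % s + 10) / 2 ^ j) &&& 1 = (bit j).toNat
  rank_le : r ≤ N
  lt_iff : ∀ x < N, mem (2 * x + eb) < i + 1 ↔ x < r
  lt_s : 0 < s
  hash_lt : ∀ j < m, a j * i + a' j < 2 ^ w
  key_lt : i + 1 < 2 ^ w
  row_lt : s + 10 < 2 ^ w
  seed_lt : sb + 2 * m < 2 ^ w
  walk_lt : 2 * m + 2 < 2 ^ w
  sq_lt : m * (m + 1) < 2 ^ w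
  mul_lt : m * (m + 1) * Q < 2 ^ w
  entry_lt : 2 * N + eb + 1 < 2 ^ w

namespace Stored

variable {w : ℕ} {M : Memory w} {i p s m Q U F G N sb eb r : ℕ} {a a' : ℕ → ℕ}
    {bit : ℕ → Bool} {mem : ℕ → ℕ}

/-- The registers after `j` columns. -/
def walkRegs (i p s m Q U F G N sb eb : ℕ) (bit : ℕ → Bool) (j : ℕ) : List (ℕ × ℕ) :=
  [(0, i), (2, p), (3, s), (5, Q), (6, U), (7, F), (8, G), (9, N), (10, sb + 2 * j), (11, eb),
   (12, 1), (13, j), (14, (walk m bit j).1), (15, (walk m bit j).2.1), (16, (walk m bit j).2.2.1),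
   (17, (walk m bit j).2.2.2), (18, m - j), (19, 10)]

/-- The registers during binary search, where `V` is the ALP-estimate. -/
def searchRegs (i F G eb V lo len : ℕ) : List (ℕ × ℕ) :=
  [(7, F), (8, G), (9, len), (11, eb), (12, 1), (13, lo), (14, i + 1), (16, V)]

theorem two_pow_ge (h : Stored M i p s m Q U F G N sb eb r a a' bit mem) : 12 ≤ 2 ^ w := by
  have := h.row_lt; have := h.lt_s; omega

theorem width_pos (h : Stored M i p s m Q U F G N sb eb r a a' bit mem) : 0 < w := by
  rcases Nat.eq_zero_or_pos w with rfl | h0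
  · have := h.two_pow_ge; norm_num at this
  · exact h0

/-- Straight-line code is executed symbolically, where each `rfl` evaluates the lookup of an
operand. -/
theorem init (h : Stored M i p s m Q U F G N sb eb r a a' bit mem) :
    Steps M initProg [(0, i)] 27 (walkRegs i p s m Q U F G N sb eb bit 0) := by
  have hw := h.two_pow_ge
  have c : ∀ n < 12, n < 2 ^ w := fun n hn => by omega
  have hg := h.getD
  unfold initProg block
  simp only [List.foldr]
  refine (Steps.const (c 1 (by norm_num))).step ?_
  refine (Steps.const (c 0 (by norm_num))).step ?_
  refine (Steps.const (c 0 (by norm_num))).step ?_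
  refine (Steps.const (c 1 (by norm_num))).step ?_
  refine (Steps.const (c 10 (by norm_num))).step ?_
  refine (Steps.load rfl ((hg _).trans h.mem0)).step ?_
  refine (Steps.load rfl ((hg _).trans h.mem1)).step ?_
  refine (Steps.const (c 2 (by norm_num))).step ?_
  refine (Steps.load rfl ((hg _).trans h.mem2)).step ?_
  refine (Steps.const (c 3 (by norm_num))).step ?_
  refine (Steps.load rfl ((hg _).trans h.mem3)).step ?_
  refine (Steps.const (c 4 (by norm_num))).step ?_
  refine (Steps.load rfl ((hg _).trans h.mem4)).step ?_
  refine (Steps.const (c 5 (by norm_num))).step ?_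
  refine (Steps.load rfl ((hg _).trans h.mem5)).step ?_
  refine (Steps.const (c 6 (by norm_num))).step ?_
  refine (Steps.load rfl ((hg _).trans h.mem6)).step ?_
  refine (Steps.const (c 7 (by norm_num))).step ?_
  refine (Steps.load rfl ((hg _).trans h.mem7)).step ?_
  refine (Steps.const (c 8 (by norm_num))).step ?_
  refine (Steps.load rfl ((hg _).trans h.mem8)).step ?_
  refine (Steps.const (c 9 (by norm_num))).step ?_
  refine (Steps.load rfl ((hg _).trans h.mem9)).step ?_
  refine (Steps.copy rfl).step ?_
  refine (Steps.copy rfl).step ?_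
  refine (Steps.copy rfl).step ?_
  exact Steps.done (by simp [walkRegs, walk, List.lookup])

theorem column (h : Stored M i p s m Q U F G N sb eb r a a' bit mem) {j : ℕ} (hj : j < m) :
    Steps M columnProg (walkRegs i p s m Q U F G N sb eb bit j) 25
      (walkRegs i p s m Q U F G N sb eb bit (j + 1)) := by
  have hw := h.two_pow_ge
  have hw0 := h.width_pos
  have hg := h.getD
  have hsl := h.seed_lt
  have hwl := h.walk_lt
  have hhl := h.hash_lt j hj
  obtain ⟨hb1, hb2, hb3, hb4⟩ := walk_bounds m bit j
  have hbit : (bit j).toNat ≤ 1 := Bool.toNat_le _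
  have hmod := Nat.mod_lt ((a j * i + a' j) % p) h.lt_s
  unfold columnProg block
  simp only [List.foldr]
  refine (Steps.load rfl ((hg _).trans (h.seed j hj))).step ?_
  refine (Steps.add rfl rfl (by omega)).step ?_
  refine (Steps.load rfl ((hg _).trans (h.seed' j hj))).step ?_
  refine (Steps.add rfl rfl (by omega)).step ?_
  refine (Steps.mul rfl rfl (by omega)).step ?_
  refine (Steps.add rfl rfl hhl).step ?_
  refine (Steps.mod rfl rfl).step ?_
  refine (Steps.mod rfl rfl).step ?_
  refine (Steps.add rfl rfl (by have := h.row_lt; omega)).step ?_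
  refine (Steps.load rfl (hg _)).step ?_
  refine (Steps.shr rfl rfl).step ?_
  refine (Steps.and rfl rfl).step ?_
  rw [h.bit_eq j hj]
  refine (Steps.add rfl rfl (by omega)).step ?_
  refine (Steps.add rfl rfl (by omega)).step ?_
  refine (Steps.sub rfl rfl (by omega)).step ?_
  refine (Steps.add rfl rfl (by omega)).step ?_
  refine (Steps.sub rfl rfl (by omega)).step ?_
  refine (Steps.lt hw0 rfl rfl).step ?_
  refine (Steps.eq hw0 rfl rfl).step ?_
  have hc : (walk m bit j).1 + ((bit j).toNat + (bit j).toNat) - 1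
      = (walk m bit j).1 + 2 * (bit j).toNat - 1 := by omega
  have hp : sb + 2 * j + 1 + 1 = sb + 2 * (j + 1) := by ring
  rw [hc, hp]
  refine Steps.seq (T := 5) (T' := 1) (L' := walkRegs i p s m Q U F G N sb eb bit (j + 1))
    (Steps.ite rfl (fun hlt => ?_) (fun hlt => ?_)) (Steps.done (by simp [walkRegs, List.lookup]))
  · have hlt' : (walk m bit j).2.1 < (walk m bit j).1 + 2 * (bit j).toNat - 1 := by
      by_contra h'; simp [h'] at hlt
    refine (Steps.copy rfl).step ?_
    refine (Steps.copy rfl).step ?_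
    refine (Steps.copy rfl).step ?_
    exact Steps.done (by simp [walkRegs, walk, hlt', List.lookup, Nat.sub_sub])
  · have hlt' : ¬ (walk m bit j).2.1 < (walk m bit j).1 + 2 * (bit j).toNat - 1 := by
      intro h'; simp [h'] at hlt
    refine Steps.ite rfl (fun heq => ?_) (fun heq => ?_)
    · have heq' : (walk m bit j).2.1 = (walk m bit j).1 + 2 * (bit j).toNat - 1 := by
        by_contra h'; simp [h'] at heq
      refine (Steps.add rfl rfl ?_).step ?_
      -- The sum of the maximizers stays below `m (m + 1)`, which fits into a word.
      · have h1 : (j + 1) * (j + 1 + 1) ≤ m * (m + 1) :=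
          Nat.mul_le_mul (by omega) (by omega)
        have h2 : (j + 1) * (j + 1 + 1) = j * (j + 1) + 2 * (j + 1) := by ring
        have := h.sq_lt
        omega
      refine (Steps.add rfl rfl (by omega)).step ?_
      exact Steps.done (by simp [walkRegs, walk, heq', List.lookup, Nat.sub_sub])
    · have heq' : ¬ (walk m bit j).2.1 = (walk m bit j).1 + 2 * (bit j).toNat - 1 := by
        intro h'; simp [h'] at heq
      refine (Steps.done ?_).mono (by norm_num)
      simp [walkRegs, walk, hlt', heq', List.lookup, Nat.sub_sub]

/-- The fixed-point ALP-estimate. -/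
def _root_.fixedAverage (m Q U : ℕ) (bit : ℕ → Bool) : ℕ :=
  min U ((walk m bit m).2.2.1 * Q / (walk m bit m).2.2.2)

theorem average (h : Stored M i p s m Q U F G N sb eb r a a' bit mem) :
    Steps M averageProg (walkRegs i p s m Q U F G N sb eb bit m) 9
      (searchRegs i F G eb (fixedAverage m Q U bit) 0 N) := by
  have hw := h.two_pow_ge
  have hw0 := h.width_pos
  have hA := (walk_bounds m bit m).2.2.1
  unfold averageProg block
  simp only [List.foldr]
  refine (Steps.mul rfl rfl (lt_of_le_of_lt (Nat.mul_le_mul_right Q hA) h.mul_lt)).step ?_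
  refine (Steps.div rfl rfl).step ?_
  refine (Steps.lt hw0 rfl rfl).step ?_
  set V := (walk m bit m).2.2.1 * Q / (walk m bit m).2.2.2 with hV
  refine Steps.seq (T := 3) (T' := 3)
    (L' := [(0, i), (7, F), (8, G), (9, N), (11, eb), (12, 1), (16, min U V)])
    (Steps.ite rfl (fun hlt => ?_) (fun hlt => ?_)) ?_
  · have hlt' : U < V := by by_contra h'; simp [h'] at hlt
    refine (Steps.copy rfl).step ?_
    exact Steps.done (by simp [walkRegs, List.lookup, min_eq_left hlt'.le])
  · have hlt' : ¬ U < V := by intro h'; simp [h'] at hlt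
    refine (Steps.done ?_).mono (by norm_num)
    simp [walkRegs, List.lookup, min_eq_right (not_lt.1 hlt')]
  · refine (Steps.const (by omega)).step ?_
    refine (Steps.add rfl rfl h.key_lt).step ?_
    exact Steps.done (by simp [searchRegs, List.lookup, fixedAverage, hV])

theorem search_step (h : Stored M i p s m Q U F G N sb eb r a a' bit mem) {V lo len : ℕ}
    (hlen : len ≠ 0) (hN : lo + len ≤ N) :
    Steps M searchProg (searchRegs i F G eb V lo len) 12
      (if mem (2 * (lo + len / 2) + eb) < i + 1 then
        searchRegs i F G eb V (lo + len / 2 + 1) (len - len / 2 - 1)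
        else searchRegs i F G eb V lo (len / 2)) := by
  have hw0 := h.width_pos
  have hel := h.entry_lt
  have hg := h.getD
  unfold searchProg block
  simp only [List.foldr]
  refine (Steps.shr rfl rfl).step ?_
  rw [pow_one]
  refine (Steps.add rfl rfl (by omega)).step ?_
  refine (Steps.add rfl rfl (by omega)).step ?_
  refine (Steps.add rfl rfl (by omega)).step ?_
  refine (Steps.load rfl (hg _)).step ?_
  rw [← two_mul]
  refine (Steps.lt hw0 rfl rfl).step ?_
  set X := mem (2 * (lo + len / 2) + eb) with hX
  refine Steps.seq (T := 5) (T' := 1) (L' := if X < i + 1 then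
        searchRegs i F G eb V (lo + len / 2 + 1) (len - len / 2 - 1)
        else searchRegs i F G eb V lo (len / 2)) (Steps.ite rfl (fun hlt => ?_) (fun hlt => ?_))
    (Steps.done (by split_ifs <;> simp [searchRegs, List.lookup]))
  · have hlt' : X < i + 1 := by by_contra h'; simp [h'] at hlt
    simp only [if_pos hlt']
    refine (Steps.add rfl rfl (by omega)).step ?_
    refine (Steps.sub rfl rfl (by omega)).step ?_
    refine (Steps.sub rfl rfl (by omega)).step ?_
    exact Steps.done (by simp [searchRegs, List.lookup])
  · have hlt' : ¬ X < i + 1 := by intro h'; simp [h'] at hlt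
    simp only [if_neg hlt']
    refine Steps.mono (T := 2) ?_ (by norm_num)
    refine (Steps.copy rfl).step ?_
    exact Steps.done (by simp [searchRegs, List.lookup])

/-- The invariant is that the rank lies in `[lo, lo + len]`. Each round takes at most 13 steps,
including the test, and at least halves `len`, so `n` rounds suffice if `len < 2 ^ n`. -/
theorem search (h : Stored M i p s m Q U F G N sb eb r a a' bit mem) (V n : ℕ) :
    ∀ lo len : ℕ, len < 2 ^ n → lo ≤ r → r ≤ lo + len → lo + len ≤ N →
      Steps M (.loop 9 searchProg) (searchRegs i F G eb V lo len) (n * 13 + 1)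
        (searchRegs i F G eb V r 0) := by
  induction n with
  | zero =>
    intro lo len h1 h2 h3 h4
    obtain rfl : len = 0 := by omega
    obtain rfl : lo = r := by omega
    exact (Steps.loop_done rfl).mono (by omega)
  | succ n ih =>
    intro lo len h1 h2 h3 h4
    by_cases hlen : len = 0
    · subst hlen
      obtain rfl : lo = r := by omega
      exact (Steps.loop_done rfl).mono (by omega)
    have hs := h.search_step (V := V) hlen h4
    have hk := h.lt_iff (lo + len / 2) (by omega)
    rw [pow_succ] at h1
    refine (Steps.loop_step (L' := _) (T' := n * 13 + 1) rfl hlen hs ?_).mono (by omega)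
    split_ifs with hlt
    · have := hk.1 hlt
      exact ih _ _ (by omega) (by omega) (by omega) (by omega)
    · have : ¬ lo + len / 2 < r := fun h' => hlt (hk.2 h')
      exact ih _ _ (by omega) (by omega) (by omega) (by omega)

theorem finish (h : Stored M i p s m Q U F G N sb eb r a a' bit mem) {V V' : ℕ}
    (hV : V' = if mem (2 * r + eb) = i + 1 then mem (2 * r + eb + 1) else V) :
    Steps M finishProg (searchRegs i F G eb V r 0) 11
      [(0, V' / 2 ^ F), (1, V' * 2 ^ G % 2 ^ w)] := by
  have hw0 := h.width_pos
  have hel := h.entry_lt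
  have hr := h.rank_le
  have hg := h.getD
  unfold finishProg block
  simp only [List.foldr]
  refine (Steps.add rfl rfl (by omega)).step ?_
  rw [← two_mul]
  refine (Steps.add rfl rfl (by omega)).step ?_
  refine (Steps.load rfl (hg _)).step ?_
  refine (Steps.eq hw0 rfl rfl).step ?_
  refine Steps.seq (T := 4) (T' := 3) (L' := [(7, F), (8, G), (16, V')])
    (Steps.ite rfl (fun hlt => ?_) (fun hlt => ?_)) ?_
  · have hlt' : mem (2 * r + eb) = i + 1 := by by_contra h'; simp [h'] at hlt
    refine (Steps.add rfl rfl (by omega)).step ?_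
    refine (Steps.load rfl (hg _)).step ?_
    exact Steps.done (by simp [searchRegs, List.lookup, hV, hlt'])
  · have hlt' : ¬ mem (2 * r + eb) = i + 1 := by intro h'; simp [h'] at hlt
    refine (Steps.done ?_).mono (by norm_num)
    simp [searchRegs, List.lookup, hV, hlt']
  · refine (Steps.shr rfl rfl).step ?_
    refine (Steps.shl rfl rfl).step ?_
    exact Steps.done (by simp [List.lookup])

theorem query (h : Stored M i p s m Q U F G N sb eb r a a' bit mem) {n V : ℕ} (hn : N < 2 ^ n)
    (hV : V = if mem (2 * r + eb) = i + 1 then mem (2 * r + eb + 1) else fixedAverage m Q U bit) :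
    Steps M queryProg [(0, i)] (m * 26 + n * 13 + 50) [(0, V / 2 ^ F), (1, V * 2 ^ G % 2 ^ w)] := by
  have hloop := Steps.loop_count (M := M) (r := 18) (p := columnProg) (T := 25) (m := m)
    (walkRegs i p s m Q U F G N sb eb bit) (fun j _ => rfl) fun j hj => h.column hj
  have hrank := h.rank_le
  have hdone : Steps M .skip [(0, V / 2 ^ F), (1, V * 2 ^ G % 2 ^ w)] 1
      [(0, V / 2 ^ F), (1, V * 2 ^ G % 2 ^ w)] := Steps.done (by simp [List.lookup])
  exact (h.init.seq (hloop.seq (h.average.seq (((h.search (fixedAverage m Q U bit) n 0 N hn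
    (Nat.zero_le _) (by omega) (by omega)).seq ((h.finish hV).seq hdone)))))).mono (by omega)

/-- The query program returns the value `V` of a fixed-point number with `F` fractional bits. -/
theorem answers (h : Stored M i p s m Q U F G N sb eb r a a' bit mem) {n V : ℕ} (hn : N < 2 ^ n)
    (hV : V = if mem (2 * r + eb) = i + 1 then mem (2 * r + eb + 1) else fixedAverage m Q U bit)
    (hFG : F + G = w) {T : ℝ} (hT : ((m * 26 + n * 13 + 50 : ℕ) : ℝ) ≤ T) :
    Answers queryProg M i T ((V : ℝ) / 2 ^ F) := by
  obtain ⟨R, t, he, ht, hR⟩ := h.query hn hV (fun r => if r = 0 then BitVec.ofNat w i else 0#w)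
    (fun r v hv => by
      have hi := h.key_lt
      by_cases hr : r = 0
      · subst hr
        simp at hv
        simp [← hv, Nat.mod_eq_of_lt (by omega : i < 2 ^ w)]
      · simp [List.lookup, show (r == 0) = false by simpa using hr] at hv)
  refine ⟨R, t, he, le_trans (by exact_mod_cast ht) hT, ?_⟩
  rw [hR 0 _ rfl, hR 1 _ rfl]
  -- As `F + G = w`, the left shift pushes the integer part out of the word and aligns the `F`
  -- fractional bits with its top.
  have h1 : V * 2 ^ G % 2 ^ w = V % 2 ^ F * 2 ^ G := by
    rw [← hFG, pow_add, Nat.mul_mod_mul_right]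
  have h2 : ((V / 2 ^ F : ℕ) : ℝ) * 2 ^ F + ((V % 2 ^ F : ℕ) : ℝ) = V := by
    have := Nat.div_add_mod' V (2 ^ F)
    exact_mod_cast this
  rw [h1, ← hFG, pow_add]
  push_cast
  have hF : (0 : ℝ) < 2 ^ F := by positivity
  have hG : (0 : ℝ) < 2 ^ G := by positivity
  rw [mul_div_mul_right _ _ hG.ne', ← h2, add_div, mul_div_cancel_right₀ _ hF.ne']

end Stored

/-! ### The walk of the program and the maximizers -/

/-- Invariant of the one-pass computation: a new partial sum that beats the maximum resets the set
of maximizers, a tie extends it, and a smaller one leaves it alone. -/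
theorem walk_spec {m : ℕ} {bit : ℕ → Bool} {S : ℕ → ℤ} (h0 : S 0 = 0)
    (hS : ∀ j < m, S (j + 1) = S j + if bit j then 1 else -1) {j : ℕ} (hj : j ≤ m) :
    ((walk m bit j).1 : ℤ) = m + S j ∧
    (∀ n ≤ j, m + S n ≤ (walk m bit j).2.1) ∧ (∃ n ≤ j, m + S n = (walk m bit j).2.1) ∧
    (walk m bit j).2.2.1
      = ∑ n ∈ (Finset.range (j + 1)).filter (fun n => m + S n = (walk m bit j).2.1), n ∧
    (walk m bit j).2.2.2
      = ((Finset.range (j + 1)).filter (fun n => m + S n = (walk m bit j).2.1)).card := by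
  induction j with
  | zero =>
    have : (Finset.range 1).filter (fun n => (m : ℤ) + S n = m) = {0} := by
      ext n; simp only [Finset.mem_filter, Finset.mem_range, Finset.mem_singleton]
      constructor
      · rintro ⟨h, -⟩; omega
      · rintro rfl; simp [h0]
    refine ⟨by simp [walk, h0], ?_, ⟨0, le_rfl, by simp [walk, h0]⟩, ?_, ?_⟩
    · intro n hn; obtain rfl : n = 0 := by omega
      simp [walk, h0]
    · simp only [walk, zero_add]; rw [this]; simp
    · simp only [walk, zero_add]; rw [this]; simp
  | succ j ih =>
    obtain ⟨i1, i2, ⟨n₀, hn₀, i3⟩, i4, i5⟩ := ih (by omega)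
    obtain ⟨b1, -, -, -⟩ := walk_bounds m bit j
    have hSj := hS j (by omega)
    have hc : (((walk m bit j).1 + 2 * (bit j).toNat - 1 : ℕ) : ℤ) = m + S (j + 1) := by
      rw [hSj]; cases bit j <;> simp <;> omega
    set c := (walk m bit j).1 + 2 * (bit j).toNat - 1 with hcdef
    set best := (walk m bit j).2.1 with hbest
    by_cases h1 : best < c
    · have hw : walk m bit (j + 1) = (c, c, j + 1, 1) := by simp [walk, ← hcdef, ← hbest, h1]
      rw [hw]
      have hf : (Finset.range (j + 1 + 1)).filter (fun n => (m : ℤ) + S n = (c : ℕ)) = {j + 1} := by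
        ext n; simp only [Finset.mem_filter, Finset.mem_range, Finset.mem_singleton]
        constructor
        · rintro ⟨hn, he⟩
          by_contra hne
          have := i2 n (by omega)
          omega
        · rintro rfl; exact ⟨by omega, hc.symm⟩
      simp only
      refine ⟨hc, fun n hn => ?_, ⟨j + 1, le_rfl, hc.symm⟩, ?_, ?_⟩
      · rcases Nat.lt_or_ge n (j + 1) with h | h
        · have := i2 n (by omega); omega
        · obtain rfl : n = j + 1 := by omega
          exact hc.symm.le
      · rw [hf]; simp
      · rw [hf]; simp
    · by_cases h2 : best = c
      · have hw : walk m bit (j + 1)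
            = (c, best, (walk m bit j).2.2.1 + (j + 1), (walk m bit j).2.2.2 + 1) := by
          simp only [walk]
          rw [← hcdef, ← hbest, if_neg h1, if_pos h2]
        rw [hw]
        simp only
        have hf : (Finset.range (j + 1 + 1)).filter (fun n => (m : ℤ) + S n = best)
            = insert (j + 1) ((Finset.range (j + 1)).filter (fun n => (m : ℤ) + S n = best)) := by
          rw [Finset.range_add_one, Finset.filter_insert, if_pos (by omega)]
        refine ⟨hc, fun n hn => ?_, ⟨j + 1, le_rfl, by omega⟩, ?_, ?_⟩
        · rcases Nat.lt_or_ge n (j + 1) with h | h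
          · exact i2 n (by omega)
          · obtain rfl : n = j + 1 := by omega
            omega
        · rw [hf, Finset.sum_insert (by simp), i4]; ring
        · rw [hf, Finset.card_insert_of_notMem (by simp), i5]
      · have hw : walk m bit (j + 1)
            = (c, best, (walk m bit j).2.2.1, (walk m bit j).2.2.2) := by
          simp only [walk]
          rw [← hcdef, ← hbest, if_neg h1, if_neg h2]
        rw [hw]
        simp only
        have hf : (Finset.range (j + 1 + 1)).filter (fun n => (m : ℤ) + S n = best)
            = (Finset.range (j + 1)).filter (fun n => (m : ℤ) + S n = best) := by
          rw [Finset.range_add_one, Finset.filter_insert, if_neg (by omega)]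
        refine ⟨hc, fun n hn => ?_, ⟨n₀, by omega, i3⟩, ?_, ?_⟩
        · rcases Nat.lt_or_ge n (j + 1) with h | h
          · exact i2 n (by omega)
          · obtain rfl : n = j + 1 := by omega
            omega
        · rw [hf, i4]
        · rw [hf, i5]

/-- The bit read for key `i` in column `j`. -/
def embeddingBit {d s m : ℕ} (H : HashFamily d s) (e : Embedding H m) (i : Fin d) (j : ℕ) : Bool :=
  if h : j < m then e.2 (H.eval (e.1 ⟨j, h⟩) i) ⟨j, h⟩ else false

theorem partialSum_succ {d s m : ℕ} (H : HashFamily d s) (e : Embedding H m) (i : Fin d) {j : ℕ}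
    (hj : j < m) :
    partialSum H e i (j + 1) = partialSum H e i j + if embeddingBit H e i j then 1 else -1 := by
  unfold partialSum embeddingBit
  have : Finset.univ.filter (fun a : Fin m => (a : ℕ) < j + 1)
      = insert ⟨j, hj⟩ (Finset.univ.filter fun a : Fin m => (a : ℕ) < j) := by
    ext a; simp [Fin.ext_iff]; omega
  rw [this, Finset.sum_insert (by simp), dif_pos hj, add_comm]

theorem walk_maximizers {d s m : ℕ} (H : HashFamily d s) (e : Embedding H m) (i : Fin d) :
    (walk m (embeddingBit H e i) m).2.2.1 = ∑ n ∈ maximizers H e i, n ∧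
    (walk m (embeddingBit H e i) m).2.2.2 = (maximizers H e i).card := by
  obtain ⟨-, h2, ⟨n₀, hn₀, h3⟩, h4, h5⟩ := walk_spec (m := m) (bit := embeddingBit H e i)
    (S := partialSum H e i) (by simp [partialSum]) (fun j hj => partialSum_succ H e i hj) le_rfl
  have : maximizers H e i = (Finset.range (m + 1)).filter (fun n => (m : ℤ) + partialSum H e i n
      = (walk m (embeddingBit H e i) m).2.1) := by
    ext n
    simp only [maximizers, Finset.mem_filter]
    refine and_congr_right fun hn => ?_
    have hn' := h2 n (by simp at hn; omega)
    constructor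
    · intro h
      have := h n₀ (by simp; omega)
      omega
    · intro h a ha
      have := h2 a (by simp at ha; omega)
      omega
  rw [this]
  exact ⟨h4, h5⟩

/-! ### Fixed-point arithmetic -/

theorem abs_floor_div_sub_le {v : ℝ} (hv : 0 ≤ v) (F : ℕ) :
    |(⌊v * 2 ^ F⌋₊ : ℝ) / 2 ^ F - v| ≤ 1 / 2 ^ F := by
  have hF : (0 : ℝ) < 2 ^ F := by positivity
  have h1 := Nat.floor_le (mul_nonneg hv hF.le)
  have h2 := Nat.lt_floor_add_one (v * 2 ^ F)
  have : (⌊v * 2 ^ F⌋₊ : ℝ) / 2 ^ F - v = (⌊v * 2 ^ F⌋₊ - v * 2 ^ F) / 2 ^ F := by field_simp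
  rw [this, abs_div, abs_of_pos hF]
  gcongr
  rw [abs_le]; constructor <;> linarith

/-- Scaling an average `A / B` of numbers up to `m` in fixed-point arithmetic; the scaling factor
`c` may be replaced by `u (m + 1)` if it is larger. -/
theorem abs_fixed_scale_sub_le {u c : ℝ} (hu : 0 ≤ u) (hc : 0 ≤ c) {m A B : ℕ} (hB : 1 ≤ B)
    (hBm : B ≤ m + 1) (hA : A ≤ m * B) (F : ℕ) :
    |((min ⌊u * 2 ^ F⌋₊ (A * ⌊min c (u * (m + 1)) * 2 ^ F⌋₊ / B) : ℕ) : ℝ) / 2 ^ F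
      - max 0 (min u ((A : ℝ) / B * c))| ≤ (m + 1) / 2 ^ F := by
  have hF : (0 : ℝ) < 2 ^ F := by positivity
  have hB' : (1 : ℝ) ≤ B := by exact_mod_cast hB
  have hB0 : (0 : ℝ) < B := by linarith
  have hBm' : (B : ℝ) ≤ m + 1 := by exact_mod_cast hBm
  have hA0 : (0 : ℝ) ≤ A := A.cast_nonneg
  have hAm : (A : ℝ) / B ≤ m := by
    rw [div_le_iff₀ hB0]; exact_mod_cast hA
  have hm : (0 : ℝ) ≤ m := m.cast_nonneg
  set q := min c (u * (m + 1)) with hq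
  have hq0 : 0 ≤ q := le_min hc (by positivity)
  have hclamp : max 0 (min u ((A : ℝ) / B * c)) = min u ((A : ℝ) / B * q) := by
    rw [max_eq_right (le_min hu (by positivity))]
    -- The cap keeps the scaling factor within a word even for tiny `ε₂`. It is harmless: a non-zero
    -- average is at least `1/(m+1)`, so already the capped factor yields at least `u`, where the
    -- estimate is clamped.
    rcases le_total c (u * (m + 1)) with h | h
    · rw [hq, min_eq_left h]
    · rw [hq, min_eq_right h]
      rcases Nat.eq_zero_or_pos A with h0 | h0
      · simp [h0]
      · have hA1 : (1 : ℝ) ≤ A := by exact_mod_cast h0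
        have h1 : u ≤ (A : ℝ) / B * (u * (m + 1)) := by
          rw [div_mul_eq_mul_div, le_div_iff₀ hB0]
          have : u * B ≤ u * (m + 1) := mul_le_mul_of_nonneg_left hBm' hu
          nlinarith [mul_nonneg hu (by linarith : (0 : ℝ) ≤ m + 1)]
        have h2 : u ≤ (A : ℝ) / B * c := h1.trans (by gcongr)
        rw [min_eq_left h1, min_eq_left h2]
  rw [hclamp, Nat.cast_min, ← min_div_div_right hF.le]
  refine (abs_min_sub_min_le_max _ _ _ _).trans (max_le ?_ ?_)
  · refine (abs_floor_div_sub_le hu F).trans ?_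
    gcongr; linarith
  · have h1 := Nat.floor_le (mul_nonneg hq0 hF.le)
    have h2 := Nat.lt_floor_add_one (q * 2 ^ F)
    generalize ⌊q * 2 ^ F⌋₊ = Q at h1 h2 ⊢
    have h3 : ((A * Q / B : ℕ) : ℝ) ≤ A * Q / B := by
      have := @Nat.cast_div_le ℝ _ _ _ (A * Q) B
      push_cast at this; exact this
    have h4 : (A * Q : ℝ) / B < ((A * Q / B : ℕ) : ℝ) + 1 := by
      rw [div_lt_iff₀ hB0]
      have := Nat.lt_mul_div_succ (A * Q) (show 0 < B by omega)
      have h' : ((A * Q : ℕ) : ℝ) < ((B * (A * Q / B + 1) : ℕ) : ℝ) := by exact_mod_cast this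
      push_cast at h'
      linarith
    have e : ((A * Q / B : ℕ) : ℝ) / 2 ^ F - (A : ℝ) / B * q
        = (((A * Q / B : ℕ) : ℝ) - (A : ℝ) / B * (q * 2 ^ F)) / 2 ^ F := by field_simp
    rw [e, abs_div, abs_of_pos hF]
    gcongr
    have h5 : (A * Q : ℝ) / B = (A : ℝ) / B * Q := by ring
    rw [h5] at h3 h4
    have hAB : 0 ≤ (A : ℝ) / B := by positivity
    -- Rounding the factor loses at most `A/B ≤ m` units of the last place, and the integer division
    -- at most one more.
    rw [abs_le]
    constructor
    · nlinarith
    · nlinarith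

/-! ### Memory layout -/

/-- The words of the encoding: the header, the rows of the bit array, the seeds, and the released
entries with their keys, in increasing order. -/
def layout (p s m Q U F G N : ℕ) (row a a' key val : ℕ → ℕ) (x : ℕ) : ℕ :=
  if x < 10 then [p, s, m, Q, U, F, G, N, 10 + s, 10 + s + 2 * m].getD x 0
  else if x < 10 + s then row (x - 10)
  else if x < 10 + s + 2 * m then
    if (x - (10 + s)) % 2 = 0 then a ((x - (10 + s)) / 2) else a' ((x - (10 + s)) / 2)
  else if x < 10 + s + 2 * m + 2 * N then
    if (x - (10 + s + 2 * m)) % 2 = 0 then key ((x - (10 + s + 2 * m)) / 2) + 1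
    else val ((x - (10 + s + 2 * m)) / 2)
  else 0

/-- A memory with the given contents. -/
def tabulate (w n : ℕ) (f : ℕ → ℕ) : Memory w := ⟨(List.range n).map fun x => BitVec.ofNat w (f x)⟩

theorem tabulate_getD {w n : ℕ} {f : ℕ → ℕ} (hf : ∀ x < n, f x < 2 ^ w) (hn : ∀ x, n ≤ x → f x = 0)
    (x : ℕ) : ((tabulate w n f).words.getD x 0#w).toNat = f x := by
  unfold tabulate
  rw [List.getD_eq_getElem?_getD, List.getElem?_map]
  rcases lt_or_ge x n with h | h
  · rw [List.getElem?_range h]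
    simp [Nat.mod_eq_of_lt (hf x h)]
  · rw [List.getElem?_eq_none (by simpa using h)]
    simp [hn x h]

theorem tabulate_bits (w n : ℕ) (f : ℕ → ℕ) : (tabulate w n f).bits = w * n := by
  simp [Memory.bits, tabulate]

theorem layout_stored {w p s m Q U F G N r i : ℕ} {row a a' key val : ℕ → ℕ} {bit : ℕ → Bool}
    (hp : p < 2 ^ w) (hs0 : 0 < s) (hQ : Q < 2 ^ w) (hU : U < 2 ^ w)
    (hF : F < 2 ^ w) (hG : G < 2 ^ w) (hlen : 10 + s + 2 * m + 2 * N + 2 < 2 ^ w)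
    (hrow : ∀ x < s, row x < 2 ^ w) (ha : ∀ j < m, a j < 2 ^ w) (ha' : ∀ j < m, a' j < 2 ^ w)
    (hkey : ∀ x < N, key x + 1 < 2 ^ w) (hval : ∀ x < N, val x < 2 ^ w)
    (hbit : ∀ j < m, (row ((a j * i + a' j) % p % s) / 2 ^ j) &&& 1 = (bit j).toNat)
    (hr : r ≤ N) (hlt : ∀ x < N, key x < i ↔ x < r) (hhash : ∀ j < m, a j * i + a' j < 2 ^ w)
    (hi : i + 1 < 2 ^ w) (hsq : m * (m + 1) < 2 ^ w) (hmul : m * (m + 1) * Q < 2 ^ w) :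
    Stored (tabulate w (10 + s + 2 * m + 2 * N) (layout p s m Q U F G N row a a' key val))
      i p s m Q U F G N (10 + s) (10 + s + 2 * m) r a a' bit
      (layout p s m Q U F G N row a a' key val) where
  getD := by
    refine tabulate_getD (fun x hx => ?_) fun x hx => ?_
    · unfold layout
      split_ifs with h1 h2 h3 h4 h5
      · interval_cases x <;> simp <;> omega
      · exact hrow _ (by omega)
      · exact ha _ (by omega)
      · exact ha' _ (by omega)
      · exact hkey _ (by omega)
      · exact hval _ (by omega)
    · unfold layout
      rw [if_neg (by omega), if_neg (by omega), if_neg (by omega), if_neg (by omega)]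
  mem0 := rfl
  mem1 := rfl
  mem2 := rfl
  mem3 := rfl
  mem4 := rfl
  mem5 := rfl
  mem6 := rfl
  mem7 := rfl
  mem8 := rfl
  mem9 := rfl
  seed j hj := by
    unfold layout
    rw [if_neg (by omega), if_neg (by omega), if_pos (by omega), if_pos (by omega)]
    congr 1; omega
  seed' j hj := by
    unfold layout
    rw [if_neg (by omega), if_neg (by omega), if_pos (by omega), if_neg (by omega)]
    congr 1; omega
  bit_eq j hj := by
    have := Nat.mod_lt ((a j * i + a' j) % p) hs0
    unfold layout
    rw [if_neg (by omega), if_pos (by omega), Nat.add_sub_cancel]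
    exact hbit j hj
  rank_le := hr
  lt_iff x hx := by
    unfold layout
    rw [if_neg (by omega), if_neg (by omega), if_neg (by omega), if_pos (by omega),
      if_pos (by omega), ← hlt x hx, show (2 * x + (10 + s + 2 * m) - (10 + s + 2 * m)) / 2 = x by omega]
    omega
  lt_s := hs0
  hash_lt := hhash
  key_lt := hi
  row_lt := by omega
  seed_lt := by omega
  walk_lt := by omega
  sq_lt := hsq
  mul_lt := hmul
  entry_lt := by omega

theorem layout_entry {p s m Q U F G N x : ℕ} {row a a' key val : ℕ → ℕ} (hx : x < N) :
    layout p s m Q U F G N row a a' key val (2 * x + (10 + s + 2 * m)) = key x + 1 ∧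
    layout p s m Q U F G N row a a' key val (2 * x + (10 + s + 2 * m) + 1) = val x := by
  unfold layout
  rw [if_neg (by omega), if_neg (by omega), if_neg (by omega), if_pos (by omega),
    if_pos (by omega), if_neg (by omega), if_neg (by omega), if_neg (by omega), if_pos (by omega),
    if_neg (by omega)]
  refine ⟨?_, ?_⟩ <;> congr 1
  · congr 1; omega
  · omega

theorem layout_of_ge {p s m Q U F G N x : ℕ} {row a a' key val : ℕ → ℕ}
    (hx : 10 + s + 2 * m + 2 * N ≤ x) : layout p s m Q U F G N row a a' key val x = 0 := by
  unfold layout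
  rw [if_neg (by omega), if_neg (by omega), if_neg (by omega), if_neg (by omega)]

/-! ### The encoding -/

/-- The position `x` holds a released entry. -/
def IsReleased {d : ℕ} (c : Fin d → ℕ) (x : ℕ) : Prop := ∃ h : x < d, c ⟨x, h⟩ ≠ 0

open Classical in
/-- The number of released entries before position `x`. -/
noncomputable def releasedBefore {d : ℕ} (c : Fin d → ℕ) (x : ℕ) : ℕ := Nat.count (IsReleased c) x

theorem isReleased_iff {d : ℕ} {c : Fin d → ℕ} (i : Fin d) : IsReleased c i ↔ c i ≠ 0 :=
  ⟨fun ⟨_, h⟩ => h, fun h => ⟨i.2, h⟩⟩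

theorem releasedBefore_le {d : ℕ} (c : Fin d → ℕ) (x : ℕ) : releasedBefore c x ≤ x := by
  classical
  exact Nat.count_le _

theorem releasedBefore_eq_card {d : ℕ} (c : Fin d → ℕ) :
    releasedBefore c d = (Finset.univ.filter fun i => c i ≠ 0).card := by
  classical
  unfold releasedBefore
  rw [Nat.count_eq_card_filter_range, ← Finset.card_map Fin.valEmbedding]
  congr 1
  ext x
  simp only [Finset.mem_filter, Finset.mem_range, Finset.mem_map, Finset.mem_univ, true_and]
  constructor
  · rintro ⟨hx, _, h⟩; exact ⟨⟨x, hx⟩, h, rfl⟩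
  · rintro ⟨y, hy, rfl⟩; exact ⟨y.2, y.2, hy⟩

/-- The side condition under which `Nat.nth` is meaningful for a finite set. -/
theorem lt_card_of_lt_releasedBefore {d : ℕ} {c : Fin d → ℕ} {x : ℕ}
    (hx : x < releasedBefore c d) (hf : (Set.ofPred (IsReleased c)).Finite) :
    x < hf.toFinset.card := by
  classical
  exact hx.trans_le (Nat.count_le_card hf d)

theorem nth_released {d : ℕ} {c : Fin d → ℕ} {x : ℕ} (hx : x < releasedBefore c d) :
    IsReleased c (Nat.nth (IsReleased c) x) :=
  Nat.nth_mem x (lt_card_of_lt_releasedBefore hx)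

/-- Enumerating and counting are adjoint; hence the rank that binary search finds for key `i` is
`releasedBefore c i`. -/
theorem nth_released_lt_iff {d : ℕ} {c : Fin d → ℕ} {x : ℕ} (hx : x < releasedBefore c d) (i : ℕ) :
    Nat.nth (IsReleased c) x < i ↔ x < releasedBefore c i := by
  classical
  refine ⟨fun h => ?_, Nat.nth_lt_of_lt_count⟩
  have := Nat.count_strict_mono (nth_released hx) h
  rwa [Nat.count_nth (lt_card_of_lt_releasedBefore hx)] at this

/-- The encoding of the quantized entries `c` (where `0` means that an entry is not released, and
`n + 1` stands for the value `n`), the seeds, and the bit array. -/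
noncomputable def encode {d s p m : ℕ} (hs : 0 < s) (hp : p.Prime) (w Q U F : ℕ)
    (o : (Fin d → ℕ) × Embedding (affineHash d hs hp) m) : Memory w :=
  tabulate w (10 + s + 2 * m + 2 * releasedBefore o.1 d)
    (layout p s m Q U F (w - F) (releasedBefore o.1 d)
      (fun x => if h : x < s then Nat.ofBits (fun b : Fin m => o.2.2 ⟨x, h⟩ b) else 0)
      (fun j => if h : j < m then ((o.2.1 ⟨j, h⟩ : Fin (p - 1) × Fin p).1 : ℕ) + 1 else 0)
      (fun j => if h : j < m then ((o.2.1 ⟨j, h⟩ : Fin (p - 1) × Fin p).2 : ℕ) else 0)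
      (Nat.nth (IsReleased o.1))
      (fun x => if h : Nat.nth (IsReleased o.1) x < d then o.1 ⟨_, h⟩ - 1 else 0))

/-- The encoding satisfies `Stored` with rank `releasedBefore o.1 i`. Key `i` was released exactly
if the entry at this rank carries it. -/
theorem encode_answers {d s p m w Q U F : ℕ} (hs : 0 < s) (hp : p.Prime)
    (hdp : d ≤ p) (hpw : p * p < 2 ^ w) (hlen : 10 + s + 2 * m + 2 * d + 2 < 2 ^ w) (hmw : m ≤ w)
    (hsq : m * (m + 1) < 2 ^ w) (hmul : m * (m + 1) * Q < 2 ^ w) (hQ : Q < 2 ^ w)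
    (hU : U < 2 ^ w) (hF : F ≤ w) (o : (Fin d → ℕ) × Embedding (affineHash d hs hp) m)
    (hc : ∀ i, o.1 i ≤ 2 ^ w) (i : Fin d) {n : ℕ} (hn : d < 2 ^ n) {T : ℝ}
    (hT : ((m * 26 + n * 13 + 50 : ℕ) : ℝ) ≤ T) :
    Answers queryProg (encode hs hp w Q U F o) i T
      (((if o.1 i ≠ 0 then o.1 i - 1
        else fixedAverage m Q U (embeddingBit (affineHash d hs hp) o.2 i) : ℕ) : ℝ) / 2 ^ F) := by
  obtain ⟨c, e⟩ := o
  have hN := releasedBefore_le c d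
  have hw : w < 2 ^ w := Nat.lt_two_pow_self
  have hi := i.2
  have hpp : p ≤ p * p := Nat.le_mul_self p
  have hstored := layout_stored (w := w) (p := p) (s := s) (m := m) (Q := Q) (U := U) (F := F)
    (G := w - F) (N := releasedBefore c d) (r := releasedBefore c i) (i := i)
    (row := fun x => if h : x < s then Nat.ofBits (fun b : Fin m => e.2 ⟨x, h⟩ b) else 0)
    (a := fun j => if h : j < m then ((e.1 ⟨j, h⟩ : Fin (p - 1) × Fin p).1 : ℕ) + 1 else 0)
    (a' := fun j => if h : j < m then ((e.1 ⟨j, h⟩ : Fin (p - 1) × Fin p).2 : ℕ) else 0)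
    (key := Nat.nth (IsReleased c))
    (val := fun x => if h : Nat.nth (IsReleased c) x < d then c ⟨_, h⟩ - 1 else 0)
    (bit := embeddingBit (affineHash d hs hp) e i)
    (by omega) hs hQ hU (by omega) (by omega) (by omega)
    (fun x hx => by
      simp only [hx, dif_pos]
      exact (Nat.ofBits_lt_two_pow _).trans_le (Nat.pow_le_pow_right two_pos hmw))
    (fun j hj => by
      simp only [hj, dif_pos]
      have := (e.1 ⟨j, hj⟩ : Fin (p - 1) × Fin p).1.2
      omega)
    (fun j hj => by
      simp only [hj, dif_pos]
      have := (e.1 ⟨j, hj⟩ : Fin (p - 1) × Fin p).2.2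
      omega)
    (fun x hx => by
      obtain ⟨h, -⟩ := nth_released hx
      omega)
    (fun x hx => by
      obtain ⟨h, h'⟩ := nth_released hx
      simp only [h, dif_pos]
      have := hc ⟨_, h⟩
      simp only at this
      omega)
    (fun j hj => by
      have hlt := Nat.mod_lt ((((e.1 ⟨j, hj⟩ : Fin (p - 1) × Fin p).1 : ℕ) + 1) * i +
        ((e.1 ⟨j, hj⟩ : Fin (p - 1) × Fin p).2 : ℕ)) hp.pos
      have hlt' := Nat.mod_lt (((((e.1 ⟨j, hj⟩ : Fin (p - 1) × Fin p).1 : ℕ) + 1) * i +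
        ((e.1 ⟨j, hj⟩ : Fin (p - 1) × Fin p).2 : ℕ)) % p) hs
      have hb : embeddingBit (affineHash d hs hp) e i j
          = e.2 ((affineHash d hs hp).eval (e.1 ⟨j, hj⟩) i) ⟨j, hj⟩ := dif_pos hj
      rw [hb]
      simp only [hj, dif_pos, hlt']
      have ht := Nat.testBit_ofBits_lt (fun b : Fin m => e.2 ⟨_, hlt'⟩ b) j hj
      rw [Nat.testBit_eq_decide_div_mod_eq] at ht
      have h2 : (e.2 ((affineHash d hs hp).eval (e.1 ⟨j, hj⟩) i) ⟨j, hj⟩) = e.2 ⟨_, hlt'⟩ ⟨j, hj⟩ :=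
        rfl
      rw [h2, ← ht, Nat.and_one_is_mod]
      rcases Nat.mod_two_eq_zero_or_one (Nat.ofBits (fun b : Fin m => e.2 ⟨_, hlt'⟩ b) / 2 ^ j)
        with h | h <;> simp [h])
    (by classical exact Nat.count_monotone _ hi.le)
    (fun x hx => nth_released_lt_iff hx i)
    (fun j hj => by
      simp only [hj, dif_pos]
      have h1 := (e.1 ⟨j, hj⟩ : Fin (p - 1) × Fin p).1.2
      have h2 := (e.1 ⟨j, hj⟩ : Fin (p - 1) × Fin p).2.2
      have h3 : (((e.1 ⟨j, hj⟩ : Fin (p - 1) × Fin p).1 : ℕ) + 1) * i ≤ (p - 1) * p :=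
        Nat.mul_le_mul (by omega) (by omega)
      have h4 : (p - 1) * p + p = p * p := by
        rw [← Nat.succ_mul]; congr 1; omega
      omega)
    (by omega) hsq hmul
  refine hstored.answers (n := n) (by omega) ?_ (by omega) hT
  by_cases h : c i ≠ 0
  · have hrel : IsReleased c i := (isReleased_iff i).2 h
    have hnth : Nat.nth (IsReleased c) (releasedBefore c i) = i := by
      classical exact Nat.nth_count hrel
    have hlt : releasedBefore c i < releasedBefore c d := by
      classical exact Nat.count_strict_mono hrel hi
    obtain ⟨h1, h2⟩ := layout_entry (p := p) (s := s) (m := m) (Q := Q) (U := U) (F := F)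
      (G := w - F)
      (row := fun x => if h : x < s then Nat.ofBits (fun b : Fin m => e.2 ⟨x, h⟩ b) else 0)
      (a := fun j => if h : j < m then ((e.1 ⟨j, h⟩ : Fin (p - 1) × Fin p).1 : ℕ) + 1 else 0)
      (a' := fun j => if h : j < m then ((e.1 ⟨j, h⟩ : Fin (p - 1) × Fin p).2 : ℕ) else 0)
      (key := Nat.nth (IsReleased c))
      (val := fun x => if h : Nat.nth (IsReleased c) x < d then c ⟨_, h⟩ - 1 else 0) hlt
    have hcond : (c, e).1 i ≠ 0 := h
    rw [if_pos hcond, if_pos (by rw [h1, hnth]), h2]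
    simp only [hnth, hi, dif_pos]
  · have hcond : ¬ (c, e).1 i ≠ 0 := h
    rw [if_neg hcond, if_neg]
    intro hcon
    rcases lt_or_ge (releasedBefore c i) (releasedBefore c d) with hlt | hge
    · rw [(layout_entry hlt).1] at hcon
      have hrel := nth_released hlt
      rw [Nat.succ_injective hcon] at hrel
      exact h ((isReleased_iff i).1 hrel)
    -- If all released keys are below `i`, the search ends behind the last entry, where memory reads
    -- `0`. Keys are stored increased by one, so this never looks like a hit.
    · rw [layout_of_ge (by omega)] at hcon
      omega

/-- Fixed-point representation of the released entries, clamped to `[0, u]`. -/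
noncomputable def quantize {d : ℕ} (u : ℝ) (F : ℕ) (v : Fin d → ℝ) (i : Fin d) : ℕ :=
  if v i = 0 then 0 else ⌊max 0 (min u (v i)) * 2 ^ F⌋₊ + 1

theorem quantize_ne_zero_iff {d : ℕ} (u : ℝ) (F : ℕ) (v : Fin d → ℝ) (i : Fin d) :
    quantize u F v i ≠ 0 ↔ v i ≠ 0 := by
  unfold quantize; split_ifs with h <;> simp [h]

theorem measurable_quantize {d : ℕ} (u : ℝ) (F : ℕ) : Measurable (quantize (d := d) u F) := by
  refine measurable_pi_lambda _ fun i => Measurable.ite ?_ measurable_const ?_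
  · exact measurableSet_preimage (measurable_pi_apply (X := fun _ : Fin d => ℝ) i)
      (measurableSet_singleton (0 : ℝ))
  · refine Measurable.comp (measurable_from_nat (f := fun n : ℕ => n + 1)) ?_
    exact Nat.measurable_floor.comp
      ((measurable_const.max (measurable_const.min (measurable_pi_apply i))).mul_const _)

theorem quantize_le {d : ℕ} {u : ℝ} (hu : 0 ≤ u) (F : ℕ) (v : Fin d → ℝ) (i : Fin d) :
    quantize u F v i ≤ ⌊u * 2 ^ F⌋₊ + 1 := by
  unfold quantize
  split_ifs
  · exact Nat.zero_le _
  · gcongr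
    exact max_le hu (min_le_left _ _)

/-- The fixed-point answer is close to the estimate. -/
theorem abs_value_sub_estimate_le {d s : ℕ} (H : HashFamily d s) {α ε₁ ε₂ u : ℝ} (hα : 0 < α)
    (hε₂ : 0 < ε₂) (hu : 0 ≤ u) (F : ℕ) (o : Output H α ε₁ ε₂) (i : Fin d) :
    |((if quantize u F o.1 i ≠ 0 then quantize u F o.1 i - 1
        else fixedAverage (levels α (thr d ε₁ * ε₂))
          ⌊min (α / ε₂) (u * (levels α (thr d ε₁ * ε₂) + 1)) * 2 ^ F⌋₊ ⌊u * 2 ^ F⌋₊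
          (embeddingBit H o.2 i) : ℕ) : ℝ) / 2 ^ F - estimate H α ε₁ ε₂ u o i|
      ≤ (levels α (thr d ε₁ * ε₂) + 1) / 2 ^ F := by
  set m := levels α (thr d ε₁ * ε₂) with hm
  by_cases h : o.1 i = 0
  · rw [if_neg (by rw [quantize_ne_zero_iff]; simpa using h)]
    unfold estimate
    rw [if_neg (by simpa using h)]
    obtain ⟨h1, h2⟩ := walk_maximizers H o.2 i
    unfold fixedAverage
    rw [h1, h2]
    have hest : alpEstimate H α ε₂ o.2 i = ((∑ n ∈ maximizers H o.2 i, n : ℕ) : ℝ) /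
        ((maximizers H o.2 i).card : ℝ) * (α / ε₂) := by
      unfold alpEstimate alp1Estimate
      push_cast; ring
    have hsub : maximizers H o.2 i ⊆ Finset.range (m + 1) := by
      intro n hn
      simp only [maximizers, Finset.mem_filter] at hn
      exact hn.1
    rw [hest]
    refine abs_fixed_scale_sub_le hu (by positivity) (maximizers_nonempty H o.2 i).card_pos ?_ ?_ F
    · have := Finset.card_le_card hsub
      rwa [Finset.card_range] at this
    · refine (Finset.sum_le_card_nsmul _ _ m fun n hn => ?_).trans (le_of_eq ?_)
      · have := Finset.mem_range.1 (hsub hn); omega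
      · rw [smul_eq_mul, mul_comm]
  · rw [if_pos ((quantize_ne_zero_iff u F o.1 i).2 h)]
    unfold estimate quantize
    rw [if_pos h, if_neg h, Nat.add_sub_cancel]
    refine (abs_floor_div_sub_le (le_max_left _ _) F).trans ?_
    gcongr
    have : (0 : ℝ) ≤ m := m.cast_nonneg
    linarith

/-! ### Sizes of the parameters -/

/-- Every quantity is bounded by a power of two whose exponent is linear in `L`. The term `3 * M +
(A + M)` in the word size serves `m (m + 1) Q`, and `S` serves the length of the memory. -/
theorem words_fit {S M A L d s p m Q U w F : ℕ} (hL : 1 ≤ L) (hw : w = (S + 3 * M + A + M + 10) * L)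
    (hF : F = (A + M) * L) (hd : d ≤ 2 ^ L) (hs : s ≤ S * d) (hp : p ≤ 2 * d) (hm : m ≤ M * L)
    (hQ : Q ≤ 2 ^ L * (m + 1) * 2 ^ F) (hU : U ≤ 2 ^ L * 2 ^ F) :
    p * p < 2 ^ w ∧ 10 + s + 2 * m + 2 * d + 2 < 2 ^ w ∧ m ≤ w ∧ m * (m + 1) < 2 ^ w ∧
      m * (m + 1) * Q < 2 ^ w ∧ Q < 2 ^ w ∧ U < 2 ^ w ∧ F ≤ w := by
  have hm' : m + 1 ≤ 2 ^ (M * L) := (Nat.lt_two_pow_self (n := m)).trans_le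
    (Nat.pow_le_pow_right two_pos hm)
  have hSL : S ≤ 2 ^ (S * L) := Nat.lt_two_pow_self.le.trans
    (Nat.pow_le_pow_right two_pos (Nat.le_mul_of_pos_right S hL))
  have hwe : w = S * L + 3 * (M * L) + (A * L + M * L) + 10 * L := by rw [hw]; ring
  have hFe : F = A * L + M * L := by rw [hF]; ring
  have hlift : ∀ {a e : ℕ}, a ≤ 2 ^ e → e < w → a < 2 ^ w := fun h h' =>
    h.trans_lt (Nat.pow_lt_pow_right one_lt_two h')
  have hp' : p ≤ 2 ^ (L + 1) := by rw [pow_succ]; omega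
  have hQ' : Q ≤ 2 ^ (L + M * L + F) := by
    rw [pow_add, pow_add]; exact hQ.trans (by gcongr)
  have hmm : m * (m + 1) ≤ 2 ^ (M * L + M * L) := by
    rw [pow_add]; exact Nat.mul_le_mul (by omega) hm'
  refine ⟨?_, ?_, by omega, hlift hmm (by omega), ?_, hlift hQ' (by omega),
    hlift (hU.trans_eq (pow_add 2 L F).symm) (by omega), by omega⟩
  · refine hlift (e := (L + 1) + (L + 1)) ?_ (by omega)
    rw [pow_add]; exact Nat.mul_le_mul hp' hp'
  · set E := S * L + M * L + 5 * L with hE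
    have hle : ∀ {e : ℕ}, e ≤ E → 2 ^ e ≤ 2 ^ E := fun h => Nat.pow_le_pow_right two_pos h
    have h1 : (16 : ℕ) ≤ 2 ^ E := (by norm_num : (16 : ℕ) = 2 ^ 4) ▸ hle (by omega)
    have h2 : s ≤ 2 ^ E := by
      refine (hs.trans (Nat.mul_le_mul hSL hd)).trans ?_
      rw [← pow_add]; exact hle (by omega)
    have h3 : 2 * m ≤ 2 ^ E := by
      refine (show 2 * m ≤ 2 ^ (M * L + 1) by rw [pow_succ]; omega).trans (hle (by omega))
    have h4 : 2 * d ≤ 2 ^ E := by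
      refine (show 2 * d ≤ 2 ^ (L + 1) by rw [pow_succ]; omega).trans (hle (by omega))
    refine hlift (e := E + 2) ?_ (by omega)
    rw [pow_add]; omega
  · refine hlift (e := (M * L + M * L) + (L + M * L + F)) ?_ (by omega)
    rw [pow_add]; exact Nat.mul_le_mul hmm hQ'

theorem levels_thr_le {d : ℕ} {α₀ lam α ε₁ ε₂ : ℝ} (hd : 2 ≤ d) (hα₀ : 0 < α₀) (hα : α₀ ≤ α)
    (hε₁ : 0 < ε₁) (hε₂ : 0 < ε₂) (h : ε₂ ≤ lam * ε₁) :
    (levels α (thr d ε₁ * ε₂) : ℝ) ≤ lam / α₀ * Real.log d + 1 := by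
  have hα0 := hα₀.trans_le hα
  have hd' : (2 : ℝ) ≤ d := by exact_mod_cast hd
  have ht := thr_nonneg hd hε₁
  have hle : thr d ε₁ * ε₂ ≤ lam * Real.log d := by
    unfold thr at ht ⊢
    have hlog : Real.log (d / 2) ≤ Real.log d := Real.log_le_log (by linarith) (by linarith)
    have h0 : 0 ≤ Real.log ((d : ℝ) / 2) := Real.log_nonneg (by linarith)
    have hlam : 0 ≤ lam := by
      by_contra hneg
      nlinarith
    calc Real.log (d / 2) / ε₁ * ε₂ ≤ Real.log (d / 2) / ε₁ * (lam * ε₁) := by gcongr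
      _ = lam * Real.log (d / 2) := by field_simp
      _ ≤ _ := by gcongr
  have h0 : 0 ≤ thr d ε₁ * ε₂ / α := by positivity
  refine (Nat.ceil_lt_add_one h0).le.trans ?_
  gcongr
  calc thr d ε₁ * ε₂ / α ≤ thr d ε₁ * ε₂ / α₀ := by gcongr
    _ ≤ lam * Real.log d / α₀ := by gcongr
    _ = _ := by ring

theorem log_two_ge_half : (1 : ℝ) / 2 ≤ Real.log 2 := by linarith [Real.log_two_gt_d9]

/-- The size of the dimension and the range, in bits. -/
theorem clog_bounds {d : ℕ} (hd : 2 ≤ d) {u : ℝ} (hu : 0 ≤ u) :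
    1 ≤ Nat.clog 2 (d + ⌈u⌉₊) ∧ d ≤ 2 ^ Nat.clog 2 (d + ⌈u⌉₊) ∧
      (d : ℝ) + u ≤ 2 ^ Nat.clog 2 (d + ⌈u⌉₊) ∧ Real.log d ≤ Nat.clog 2 (d + ⌈u⌉₊) ∧
      (Nat.clog 2 (d + ⌈u⌉₊) : ℝ) ≤ 6 * Real.log (d + u) := by
  have h1 : d + ⌈u⌉₊ ≤ 2 ^ Nat.clog 2 (d + ⌈u⌉₊) := Nat.le_pow_clog one_lt_two _
  have h2 : 2 ^ (Nat.clog 2 (d + ⌈u⌉₊)).pred < d + ⌈u⌉₊ :=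
    Nat.pow_pred_clog_lt_self one_lt_two (by omega)
  have hpos : 1 ≤ Nat.clog 2 (d + ⌈u⌉₊) := Nat.clog_pos one_lt_two (by omega)
  generalize Nat.clog 2 (d + ⌈u⌉₊) = L at *
  have hd' : (2 : ℝ) ≤ d := by exact_mod_cast hd
  have h3 : (d : ℝ) + u ≤ 2 ^ L := by
    have : ((d + ⌈u⌉₊ : ℕ) : ℝ) ≤ ((2 ^ L : ℕ) : ℝ) := by exact_mod_cast h1
    push_cast at this
    linarith [Nat.le_ceil u]
  have hlog2 : Real.log 2 ≤ 1 := by linarith [Real.log_two_lt_d9]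
  refine ⟨hpos, by omega, h3, ?_, ?_⟩
  · have : Real.log d ≤ Real.log (2 ^ L) := Real.log_le_log (by linarith) (by linarith)
    rw [Real.log_pow] at this
    nlinarith [(L.cast_nonneg : (0 : ℝ) ≤ L)]
  · have h4 : (2 : ℝ) ^ L.pred ≤ 2 * (d + u) := by
      have : ((2 ^ L.pred : ℕ) : ℝ) < ((d + ⌈u⌉₊ : ℕ) : ℝ) := by exact_mod_cast h2
      push_cast at this
      linarith [Nat.ceil_lt_add_one hu]
    have h5 := Real.log_le_log (by positivity) h4
    rw [Real.log_pow, Real.log_mul (by norm_num) (by positivity), Nat.pred_eq_sub_one,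
      Nat.cast_sub hpos, Nat.cast_one] at h5
    have h6 : Real.log 2 ≤ Real.log (d + u) := Real.log_le_log (by norm_num) (by linarith)
    have h7 : (L : ℝ) * Real.log 2 ≤ 3 * Real.log (d + u) := by linarith
    nlinarith [log_two_ge_half, (L.cast_nonneg : (0 : ℝ) ≤ L)]

/-- Of the fractional bits, `M * L` absorb the factor `m + 1` and `⌈a⌉₊ * L` pay for `x ^ a`. For
negative `a` the latter number is `0`, which suffices as `1 ≤ x`. -/
theorem rpow_neg_bound {a x δ : ℝ} {L m M : ℕ} (hx1 : 1 ≤ x) (hx : x ≤ 2 ^ L) (hm : m ≤ M * L)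
    (hδ : δ ≤ (m + 1) / 2 ^ ((⌈a⌉₊ + M) * L)) : δ ≤ x ^ (-a) := by
  have h0 : 0 < x := by linarith
  have hm' : (m : ℝ) + 1 ≤ 2 ^ (M * L) := by
    exact_mod_cast (Nat.lt_two_pow_self (n := m)).trans_le (Nat.pow_le_pow_right two_pos hm)
  have h1 : x ^ a ≤ 2 ^ (⌈a⌉₊ * L) := by
    calc x ^ a ≤ x ^ (⌈a⌉₊ : ℝ) := Real.rpow_le_rpow_of_exponent_le hx1 (Nat.le_ceil a)
      _ = x ^ ⌈a⌉₊ := Real.rpow_natCast _ _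
      _ ≤ (2 ^ L) ^ ⌈a⌉₊ := by gcongr
      _ = _ := by rw [← pow_mul, mul_comm]
  have h2 : (0 : ℝ) < x ^ a := Real.rpow_pos_of_pos h0 a
  rw [Real.rpow_neg h0.le]
  refine hδ.trans ?_
  rw [add_mul, pow_add, div_le_iff₀ (by positivity), inv_mul_eq_div, le_div_iff₀ h2, mul_comm]
  gcongr

/-! ### The implementation -/

theorem exists_encoding {α₀ ρ₁ lam a : ℝ} (hα₀ : 0 < α₀) {d k s : ℕ} {u α ε₁ ε₂ : ℝ}
    (hd : 2 ≤ d) (hkd : k ≤ d) (hu : 0 ≤ u) (hα : α₀ ≤ α) (hs0 : 0 < s) (hs : (s : ℝ) ≤ ρ₁ * k)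
    (hε₁ : 0 < ε₁) (hε₂ : 0 < ε₂) (h21 : ε₂ ≤ lam * ε₁) :
    ∃ H : HashFamily d s, H.Universal ∧ ∃ enc : Output H α ε₁ ε₂ → Memory (wordSize
        (⌈ρ₁⌉₊ + 3 * (⌈lam / α₀⌉₊ + 1) + ⌈a⌉₊ + (⌈lam / α₀⌉₊ + 1) + 10) d u),
      Measurable enc ∧
      (∀ o i, ∃ v, Answers queryProg (enc o) (i : Fin d)
          ((26 * (lam / α₀ + 2) + 152) * Real.log d) v ∧
        |v - estimate H α ε₁ ε₂ u o i| ≤ ((d : ℝ) + u) ^ (-a)) ∧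
      ∀ o, (enc o).bits
        = wordSize (⌈ρ₁⌉₊ + 3 * (⌈lam / α₀⌉₊ + 1) + ⌈a⌉₊ + (⌈lam / α₀⌉₊ + 1) + 10) d u *
          (10 + s + 2 * levels α (thr d ε₁ * ε₂) + 2 * supportCard o.1) := by
  -- Bertrand's postulate: `p > d` keeps the keys distinct mod `p`, and `p ≤ 2d` keeps the hash
  -- computation within a word.
  obtain ⟨p, hp, hdp, hp2⟩ := Nat.exists_prime_lt_and_le_two_mul d (by omega)
  obtain ⟨hL, hdL, hduL, hlogL, -⟩ := clog_bounds hd hu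
  have hmle := levels_thr_le hd hα₀ hα hε₁ hε₂ h21
  set w := wordSize (⌈ρ₁⌉₊ + 3 * (⌈lam / α₀⌉₊ + 1) + ⌈a⌉₊ + (⌈lam / α₀⌉₊ + 1) + 10) d u with hw
  unfold wordSize at hw
  generalize Nat.clog 2 (d + ⌈u⌉₊) = L at hw hL hdL hduL hlogL
  obtain ⟨m, hm⟩ : ∃ m, levels α (thr d ε₁ * ε₂) = m := ⟨_, rfl⟩
  rw [hm] at hmle
  set M := ⌈lam / α₀⌉₊ + 1 with hM
  have hlam : 0 ≤ lam := by
    by_contra hneg; nlinarith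
  have hlogd : 0 ≤ Real.log d := Real.log_natCast_nonneg d
  have hmL : m ≤ M * L := by
    have h1 : lam / α₀ * Real.log d ≤ ⌈lam / α₀⌉₊ * L :=
      mul_le_mul (Nat.le_ceil _) hlogL hlogd (Nat.cast_nonneg _)
    have h2 : (1 : ℝ) ≤ L := by exact_mod_cast hL
    have : (m : ℝ) ≤ ((M * L : ℕ) : ℝ) := by
      rw [hM]; push_cast; linarith
    exact_mod_cast this
  set F := (⌈a⌉₊ + M) * L with hF
  have hsd : s ≤ ⌈ρ₁⌉₊ * d := by
    have : (s : ℝ) ≤ ((⌈ρ₁⌉₊ * d : ℕ) : ℝ) := by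
      push_cast
      exact hs.trans (mul_le_mul (Nat.le_ceil _) (by exact_mod_cast hkd) k.cast_nonneg
        (Nat.cast_nonneg _))
    exact_mod_cast this
  have huL : u ≤ 2 ^ L := by
    have : (0 : ℝ) ≤ d := d.cast_nonneg
    linarith
  have hQ : ⌊min (α / ε₂) (u * (m + 1)) * 2 ^ F⌋₊ ≤ 2 ^ L * (m + 1) * 2 ^ F := by
    refine Nat.floor_le_of_le ?_
    push_cast
    gcongr
    exact (min_le_right _ _).trans (by gcongr)
  have hU : ⌊u * 2 ^ F⌋₊ ≤ 2 ^ L * 2 ^ F := by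
    refine Nat.floor_le_of_le ?_
    push_cast
    gcongr
  obtain ⟨b1, b2, b3, b4, b5, b6, b7, b8⟩ := words_fit hL hw hF hdL hsd hp2 hmL hQ hU
  subst hm
  refine ⟨affineHash d hs0 hp, affineHash_universal d hs0 hp hdp.le, fun o => encode hs0 hp w
    ⌊min (α / ε₂) (u * (levels α (thr d ε₁ * ε₂) + 1)) * 2 ^ F⌋₊ ⌊u * 2 ^ F⌋₊ F
    (quantize u F o.1, o.2), ?_, fun o i => ⟨_, encode_answers hs0 hp hdp.le b1 b2 b3 b4 b5 b6 b7 b8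
      (quantize u F o.1, o.2) (fun i => (quantize_le hu F o.1 i).trans b7) i
      (Nat.lt_pow_succ_log_self one_lt_two d) ?_, ?_⟩, fun o => ?_⟩
  -- After quantization only countably many outputs remain, so the rest of the encoding is
  -- measurable for free.
  · have : Countable ((Fin d → ℕ) × Embedding (affineHash d hs0 hp) (levels α (thr d ε₁ * ε₂))) := by
      infer_instance
    exact (measurable_of_countable (encode hs0 hp w
      ⌊min (α / ε₂) (u * (levels α (thr d ε₁ * ε₂) + 1)) * 2 ^ F⌋₊ ⌊u * 2 ^ F⌋₊ F)).comp
      (((measurable_quantize u F).comp measurable_fst).prodMk measurable_snd)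
  · have hd' : (2 : ℝ) ≤ d := by exact_mod_cast hd
    have h1 : Real.log 2 ≤ Real.log d := Real.log_le_log two_pos hd'
    have h2 := log_two_ge_half
    have h3 : (Nat.log 2 d : ℝ) ≤ 2 * Real.log d := by
      have : ((2 ^ Nat.log 2 d : ℕ) : ℝ) ≤ d := by
        exact_mod_cast Nat.pow_log_le_self 2 (by omega)
      push_cast at this
      have := Real.log_le_log (by positivity) this
      rw [Real.log_pow] at this
      nlinarith [((Nat.log 2 d).cast_nonneg : (0 : ℝ) ≤ Nat.log 2 d)]
    -- The walk takes `26 m` steps and the search `13` per round. The additive constants sum to `26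
    -- + 13 + 50 = 89 ≤ 178 log d`; together with `26 log d` for the search this is `(52 + 152) log
    -- d`.
    push_cast
    nlinarith
  · exact rpow_neg_bound (by have : (2 : ℝ) ≤ d := by exact_mod_cast hd
                             linarith) hduL hmL
      (abs_value_sub_estimate_le (affineHash d hs0 hp) (hα₀.trans_le hα) hε₂ hu F o i)
  · have : releasedBefore (quantize u F o.1) d = supportCard o.1 := by
      rw [releasedBefore_eq_card]
      unfold supportCard
      congr 1
      ext i
      simp only [Finset.mem_filter, quantize_ne_zero_iff]
    simp only [encode, tabulate_bits, this]

/-! ### Transfer to the encoded mechanism and conclusion -/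

theorem lintegral_map_ofReal_le {Ω R : Type*} [MeasurableSpace Ω] [MeasurableSpace R]
    (μ : Measure Ω) [IsProbabilityMeasure μ] {φ : Ω → R} {g : R → ℝ} {f : Ω → ℝ} {B δ : ℝ}
    (hB : 0 ≤ B) (hδ : 0 ≤ δ) (hgf : ∀ o, g (φ o) ≤ f o + δ)
    (hf : ∫⁻ o, ENNReal.ofReal (f o) ∂μ ≤ ENNReal.ofReal B) :
    ∫⁻ M, ENNReal.ofReal (g M) ∂(μ.map φ) ≤ ENNReal.ofReal (B + δ) := by
  refine (lintegral_map_le _ _).trans ?_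
  calc ∫⁻ o, ENNReal.ofReal (g (φ o)) ∂μ
      ≤ ∫⁻ o, (ENNReal.ofReal (f o) + ENNReal.ofReal δ) ∂μ := lintegral_mono fun o =>
        (ENNReal.ofReal_le_ofReal (hgf o)).trans ENNReal.ofReal_add_le
    _ = ∫⁻ o, ENNReal.ofReal (f o) ∂μ + ENNReal.ofReal δ := by
        rw [lintegral_add_right _ measurable_const, lintegral_const, measure_univ, mul_one]
    _ ≤ ENNReal.ofReal B + ENNReal.ofReal δ := by gcongr
    _ = _ := (ENNReal.ofReal_add hB hδ).symm

theorem IsDP.map {d k : ℕ} {ε : ℝ} {R R' : Type*} [MeasurableSpace R] [MeasurableSpace R']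
    {M : (Fin d → ℝ) → Measure R} (h : IsDP k ε M) {φ : R → R'} (hφ : Measurable φ) :
    IsDP k ε fun x => (M x).map φ := fun x x' hx hx' hxk hxk' hxx' S hS => by
  simp only [Measure.map_apply hφ hS]
  exact h x x' hx hx' hxk hxk' hxx' _ (hφ hS)

theorem isProbabilityMeasure_thresholdALP {d s : ℕ} (H : HashFamily d s) {α ε₁ ε₂ : ℝ}
    (hα : 0 < α) (hε₁ : 0 < ε₁) (x : Fin d → ℝ) :
    IsProbabilityMeasure (thresholdALP H α ε₁ ε₂ x) := by
  have := isProbabilityMeasure_threshold hε₁ (thr d ε₁) x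
  have : IsProbabilityMeasure (alp H α (thr d ε₁) ε₂ x) := isProbabilityMeasure_alp1 H hα.le _ _
  unfold thresholdALP
  infer_instance

/-- The number of words of an encoding, if few entries are released. -/
theorem bits_le {α₀ ρ₁ κ lam c : ℝ} (hα₀ : 0 < α₀) (hκ : 0 < κ) (hlam : 0 ≤ lam) (hc : 0 < c)
    {d k s m N W : ℕ} {u : ℝ} (hd : 2 ≤ d) (hu : 0 ≤ u) (hk : 1 ≤ k) (hkκ : κ * Real.log d ≤ k)
    (hs : (s : ℝ) ≤ ρ₁ * k) (hm : (m : ℝ) ≤ lam / α₀ * Real.log d + 1)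
    (hN : (N : ℝ) ≤ k + (2 + c * Real.log d)) :
    ((wordSize W d u * (10 + s + 2 * m + 2 * N) : ℕ) : ℝ)
      ≤ 6 * W * (10 + ρ₁ + 2 * (lam / α₀ / κ + 1) + 2 * (3 + c / κ)) * k * Real.log (d + u) := by
  obtain ⟨-, -, -, -, hL⟩ := clog_bounds hd hu
  have hk' : (1 : ℝ) ≤ k := by exact_mod_cast hk
  have hlog : Real.log d ≤ k / κ := by rw [le_div_iff₀ hκ]; linarith
  have h1 : lam / α₀ * Real.log d ≤ lam / α₀ / κ * k := by
    calc lam / α₀ * Real.log d ≤ lam / α₀ * (k / κ) := by gcongr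
      _ = _ := by ring
  have h2 : c * Real.log d ≤ c / κ * k := by
    calc c * Real.log d ≤ c * (k / κ) := by gcongr
      _ = _ := by ring
  have hd' : (2 : ℝ) ≤ d := by exact_mod_cast hd
  have hlogdu : 0 ≤ Real.log (d + u) := Real.log_nonneg (by linarith)
  have hsum : (10 + s + 2 * m + 2 * N : ℝ)
      ≤ (10 + ρ₁ + 2 * (lam / α₀ / κ + 1) + 2 * (3 + c / κ)) * k := by linarith
  unfold wordSize
  push_cast
  calc (W : ℝ) * Nat.clog 2 (d + ⌈u⌉₊) * (10 + s + 2 * m + 2 * N)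
      ≤ W * (6 * Real.log (d + u)) *
        ((10 + ρ₁ + 2 * (lam / α₀ / κ + 1) + 2 * (3 + c / κ)) * k) := by gcongr
    _ = _ := by ring

theorem theorem5 (α₀ α₁ ρ₀ ρ₁ κ lam a : ℝ) (hα₀ : 0 < α₀) (hρ₀ : 2 < ρ₀) (hκ : 0 < κ) :
    ∃ (prog : Prog) (W : ℕ) (C : ℝ) (D : ℝ → ℝ), 0 < W ∧
      ∀ (d k s : ℕ) (u α ε ε₁ ε₂ : ℝ),
        2 ≤ d → k ≤ d → κ * Real.log d ≤ k → 0 ≤ u →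
        α₀ ≤ α → α ≤ α₁ → ρ₀ * k ≤ s → s ≤ ρ₁ * k →
        0 < ε₁ → 0 < ε₂ → ε₁ ≤ lam * ε₂ → ε₂ ≤ lam * ε₁ → ε = ε₁ + ε₂ →
        -- The mechanism with exact real arithmetic, for any universal hash family
        (∀ H : HashFamily d s, H.Universal →
          IsDP k ε (thresholdALP H α ε₁ ε₂) ∧
          ∀ x : Fin d → ℝ, (∀ i, 0 ≤ x i ∧ x i ≤ u) → IsSparse k x →
            (∀ i, ∫⁻ o, ENNReal.ofReal |x i - estimate H α ε₁ ε₂ u o i|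
                ∂(thresholdALP H α ε₁ ε₂ x) ≤ ENNReal.ofReal (C / ε)) ∧
            ∫⁻ o, ENNReal.ofReal (⨆ i, |x i - estimate H α ε₁ ε₂ u o i|)
                ∂(thresholdALP H α ε₁ ε₂ x) ≤ ENNReal.ofReal (C * Real.log d / ε)) ∧
        -- Its implementation on a word RAM, for a suitable universal hash family
        (ε ≤ ((d : ℝ) + u) ^ a → ∃ H : HashFamily d s, H.Universal ∧
          ∃ (enc : Output H α ε₁ ε₂ → Memory (wordSize W d u))
            (ans : Memory (wordSize W d u) → Fin d → ℝ),
            Measurable enc ∧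
            IsDP k ε (fun x => (thresholdALP H α ε₁ ε₂ x).map enc) ∧
            (∀ (o : Output H α ε₁ ε₂) (i : Fin d),
              Answers prog (enc o) i (C * Real.log d) (ans (enc o) i) ∧
              |ans (enc o) i - estimate H α ε₁ ε₂ u o i| ≤ ((d : ℝ) + u) ^ (-a)) ∧
            ∀ x : Fin d → ℝ, (∀ i, 0 ≤ x i ∧ x i ≤ u) → IsSparse k x →
              (∀ i, ∫⁻ M, ENNReal.ofReal |x i - ans M i|
                  ∂((thresholdALP H α ε₁ ε₂ x).map enc) ≤ ENNReal.ofReal (C / ε)) ∧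
              ∫⁻ M, ENNReal.ofReal (⨆ i, |x i - ans M i|)
                  ∂((thresholdALP H α ε₁ ε₂ x).map enc) ≤
                ENNReal.ofReal (C * Real.log d / ε) ∧
              ∀ c : ℝ, 0 < c →
                (thresholdALP H α ε₁ ε₂ x).map enc
                    {M | D c * k * Real.log ((d : ℝ) + u) < (M.bits : ℝ)} ≤
                  ENNReal.ofReal ((d : ℝ) ^ (-c))) := by

  obtain ⟨C₀, hC₀, herr⟩ := exists_error_constant (α₀ := α₀) (α₁ := α₁) (ρ₀ := ρ₀) (lam := lam)
    hα₀ hρ₀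
  set Cq : ℝ := 26 * (lam / α₀ + 2) + 152 with hCq
  set W : ℕ := ⌈ρ₁⌉₊ + 3 * (⌈lam / α₀⌉₊ + 1) + ⌈a⌉₊ + (⌈lam / α₀⌉₊ + 1) + 10 with hW
  -- The `+ 2` pays for the fixed-point error, which is at most `1/ε ≤ 2 log d / ε`; `Cq` is the
  -- constant of the running time.
  refine ⟨queryProg, W, max (C₀ + 2) Cq,
    fun c => 6 * W * (10 + ρ₁ + 2 * (lam / α₀ / κ + 1) + 2 * (3 + c / κ)), by omega, ?_⟩
  intro d k s u α ε ε₁ ε₂ hd hkd hkκ hu hαl hαu hks hsk hε₁ hε₂ hl₁ hl₂ hε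
  subst hε
  have hα : 0 < α := hα₀.trans_le hαl
  have hd' : (2 : ℝ) ≤ d := by exact_mod_cast hd
  have hlogd : 1 / 2 ≤ Real.log d := log_two_ge_half.trans (Real.log_le_log two_pos hd')
  have hk : 0 < k := by
    have : (0 : ℝ) < k := (mul_pos hκ (by linarith)).trans_le hkκ
    exact_mod_cast this
  have hk' : (1 : ℝ) ≤ k := by exact_mod_cast hk
  have hs : 0 < s := by
    have : (0 : ℝ) < s := by nlinarith
    exact_mod_cast this
  have hlam : 0 ≤ lam := by
    by_contra hneg; nlinarith
  have hε0 : 0 < ε₁ + ε₂ := by linarith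
  have hC : C₀ + 2 ≤ max (C₀ + 2) Cq := le_max_left _ _
  have herr' := herr d k s u α ε₁ ε₂ hd hk hαl hαu hks hε₁ hε₂ hl₁ hl₂
  refine ⟨fun H hH => ⟨isDP_thresholdALP k H hα hε₁ hε₂, fun x hx hxk => ?_⟩, fun hεa => ?_⟩
  · obtain ⟨h1, h2⟩ := herr' H hH x hx hxk
    refine ⟨fun i => (h1 i).trans (ENNReal.ofReal_le_ofReal ?_),
      h2.trans (ENNReal.ofReal_le_ofReal ?_)⟩
    · gcongr; linarith
    · gcongr; linarith
  obtain ⟨H, hH, enc, henc, hans, hbits⟩ :=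
    exists_encoding (ρ₁ := ρ₁) (a := a) hα₀ hd hkd hu hαl hs hsk hε₁ hε₂ hl₂
  choose val hval herrv using hans
  have hδ : ((d : ℝ) + u) ^ (-a) ≤ 1 / (ε₁ + ε₂) := by
    rw [Real.rpow_neg (by linarith), ← one_div]
    exact one_div_le_one_div_of_le hε0 hεa
  have hδ0 : 0 ≤ ((d : ℝ) + u) ^ (-a) := Real.rpow_nonneg (by linarith) _
  classical
  -- Defined on every memory content, with the junk value `0` where the program gives no answer in
  -- time; on encodings `Answers.unique` identifies it.
  set ans : Memory (wordSize W d u) → Fin d → ℝ := fun M i =>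
    if h : ∃ v, Answers queryProg M i (Cq * Real.log d) v then h.choose else 0 with hansdef
  have hansval : ∀ o i, ans (enc o) i = val o i := fun o i => by
    have h : ∃ v, Answers queryProg (enc o) i (Cq * Real.log d) v := ⟨_, hval o i⟩
    rw [hansdef]
    simp only [dif_pos h]
    exact h.choose_spec.unique (hval o i)
  have hclose : ∀ o i, |ans (enc o) i - estimate H α ε₁ ε₂ u o i| ≤ ((d : ℝ) + u) ^ (-a) :=
    fun o i => by rw [hansval]; exact herrv o i
  have hdist : ∀ (x : Fin d → ℝ) o i, |x i - ans (enc o) i|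
      ≤ |x i - estimate H α ε₁ ε₂ u o i| + ((d : ℝ) + u) ^ (-a) := fun x o i => by
    have := abs_sub_le (x i) (estimate H α ε₁ ε₂ u o i) (ans (enc o) i)
    have h2 := hclose o i
    rw [abs_sub_comm] at h2
    linarith
  refine ⟨H, hH, enc, ans, henc, (isDP_thresholdALP k H hα hε₁ hε₂).map henc,
    fun o i => ⟨?_, hclose o i⟩, fun x hx hxk => ⟨fun i => ?_, ?_, fun c hc => ?_⟩⟩
  · obtain ⟨R, t, he, ht, hv⟩ := hval o i
    refine ⟨R, t, he, ht.trans ?_, (hansval o i).trans hv⟩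
    gcongr
    exact le_max_right _ _
  · have := isProbabilityMeasure_thresholdALP H (ε₂ := ε₂) hα hε₁ x
    refine (lintegral_map_ofReal_le _ (φ := enc) (g := fun M => |x i - ans M i|)
      (by positivity) hδ0 (fun o => hdist x o i)
      ((herr' H hH x hx hxk).1 i)).trans (ENNReal.ofReal_le_ofReal ?_)
    calc C₀ / (ε₁ + ε₂) + ((d : ℝ) + u) ^ (-a) ≤ C₀ / (ε₁ + ε₂) + 1 / (ε₁ + ε₂) := by gcongr
      _ = (C₀ + 1) / (ε₁ + ε₂) := by ring
      _ ≤ _ := by gcongr; linarith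
  · have := isProbabilityMeasure_thresholdALP H (ε₂ := ε₂) hα hε₁ x
    have : Nonempty (Fin d) := ⟨⟨0, by omega⟩⟩
    refine (lintegral_map_ofReal_le _ (φ := enc) (g := fun M => ⨆ i, |x i - ans M i|)
      (by positivity) hδ0 (fun o => ciSup_le fun i =>
      (hdist x o i).trans ?_) (herr' H hH x hx hxk).2).trans (ENNReal.ofReal_le_ofReal ?_)
    · gcongr
      exact le_ciSup (f := fun i => |x i - estimate H α ε₁ ε₂ u o i|)
        (Set.finite_range _).bddAbove i
    · calc C₀ * Real.log d / (ε₁ + ε₂) + ((d : ℝ) + u) ^ (-a)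
          ≤ C₀ * Real.log d / (ε₁ + ε₂) + 1 / (ε₁ + ε₂) := by gcongr
        _ = (C₀ * Real.log d + 1) / (ε₁ + ε₂) := by ring
        _ ≤ _ := by
          gcongr
          nlinarith
  · rw [Measure.map_apply henc trivial]
    refine (measure_mono fun o ho => ?_).trans
      ((thresholdALP_supportCard_le hd H hα hε₁ hxk (2 + c * Real.log d)).trans_eq ?_)
    · by_contra hcon
      have hlt : 6 * W * (10 + ρ₁ + 2 * (lam / α₀ / κ + 1) + 2 * (3 + c / κ)) * k
          * Real.log (d + u) < ((enc o).bits : ℝ) := ho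
      refine hlt.not_ge ?_
      rw [hbits]
      exact bits_le hα₀ hκ hlam hc hd hu hk hkκ hsk (levels_thr_le hd hα₀ hαl hε₁ hε₂ hl₂)
        (not_lt.1 hcon)
    -- The excess `2 + c log d` was chosen so that the tail bound `exp (2 - R)` equals `d ^ (-c)`.
    · rw [Real.rpow_def_of_pos (by linarith)]
      congr 2
      ring
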